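/- **Setting.** Let $\mathbb D=\{|z|<1\}\subset\mathbb C$ and let $\mathbb H=\{(z_1,z_2)\in\mathbb C^2:|z_1|<|z_2|<1\}$ be the Hartogs triangle, with Lebesgue measure $dV$. Let $K(z,w)$ be the Bergman kernel of $\mathbb H$, i.e. the function for which $z\mapsto\int_{\mathbb H}K(z,w)f(w)\,dV(w)$ is, for every $f\in L^2(\mathbb H)$, the orthogonal projection of $f$ onto the space of square-integrable holomorphic functions on $\mathbb H$. Put $$Pf(z)=\int_{\mathbb H}K(z,w)f(w)\,dV(w),\qquad P^+f(z)=\int_{\mathbb H}|K(z,w)|f(w)\,dV(w).$$ Such an operator is *bounded* on $L^p(\mathbb H,\mu\,dV)$ if for every $f\in L^p(\mathbb H,\mu\,dV)$ the integral converges absolutely for all $z\in\mathbb H$ and the resulting function has $L^p(\mathbb H,\mu\,dV)$-norm at most $C\|f\|_{L^p(\mathbb H,\mu\,dV)}$ with a finite $C$ independent of $f$; its norm $\|\cdot\|$ on $L^p(\mathbb H,\mu\,dV)$ is the least such $C$, and $\infty$ if it is not bounded. For $0\ne z\in\mathbb D$ let $T_z=\{w\in\mathbb D:|1-\bar w\,z/|z||<1-|z|\}$,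 and let $T_0=\mathbb D$. For $z_1,z_2\in\mathbb D$ let $T'_{z_1,z_2}=\{(w_1,w_2)\in\mathbb H: w_1/w_2\in T_{z_1},\ w_2\in T_{z_2}\}$. For a measure $m$ let $\langle f\rangle^{m}_U=m(U)^{-1}\int_U|f|\,dm$ (possibly $\infty$), and let $du=|w_2|^{-2}dV$ on $\mathbb H$. For $1<p<\infty$ put $p'=p/(p-1)$. Consider weights $\mu$ on $\mathbb H$ that are locally integrable and of the form $\mu(z_1,z_2)=\mu_1(z_1/z_2)\,\mu_2(z_2)$ with $\mu_1,\mu_2>0$ almost everywhere on $\mathbb D$. Put $\nu=|z_2|^{-p'}\mu^{-p'/p}$, $\nu_1=\mu_1^{-p'/p}$ and $\nu_2(w)=|w|^{-p'}\mu_2(w)^{-p'/p}$, so that $\nu(z_1,z_2)=\nu_1(z_1/z_2)\nu_2(z_2)$, and define, with values in $[0,\infty]$, $$[\mu,\nu]_p=\sup_{z_1,z_2\in\mathbb D}\langle|w_2|^{2-p}\mu\rangle^{du}_{T'_{z_1,z_2}}\big(\langle|w_2|^2\nu\rangle^{du}_{T'_{z_1,z_2}}\big)^{p-1},$$ $$[\mu,\nu]^{0,0}_p=\langle|w_2|^{2-p}\mu\rangle^{du}_{\mathbb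 H}\big(\langle|w_2|^2\nu\rangle^{du}_{\mathbb H}\big)^{p-1},$$ $$[\mu,\nu]^{1,0}_p=\Big(\langle|w_2|^{2-p}\mu_2\rangle^{dV}_{\mathbb D}\big(\langle|w_2|^2\nu_2\rangle^{dV}_{\mathbb D}\big)^{p-1}\Big)^{1/p}\Big(\sup_{z\in\mathbb D,\,|z|>1/2}\langle\mu_1\rangle^{dV}_{T_z}\big(\langle\nu_1\rangle^{dV}_{T_z}\big)^{p-1}\Big)^{\max\{1,1/(p-1)\}},$$ $$[\mu,\nu]^{0,1}_p=\Big(\sup_{z\in\mathbb D,\,|z|>1/2}\langle|w_2|^{2-p}\mu_2\rangle^{dV}_{T_z}\big(\langle|w_2|^2\nu_2\rangle^{dV}_{T_z}\big)^{p-1}\Big)^{\max\{1,1/(p-1)\}}\Big(\langle\mu_1\rangle^{dV}_{\mathbb D}\big(\langle\nu_1\rangle^{dV}_{\mathbb D}\big)^{p-1}\Big)^{1/p},$$ $$[\mu,\nu]^{1,1}_p=\sup_{z_1,z_2\in\mathbb D,\ |z_1|,|z_2|>1/2}\langle|w_2|^{2-p}\mu\rangle^{du}_{T'_{z_1,z_2}}\big(\langle|w_2|^2\nu\rangle^{du}_{T'_{z_1,z_2}}\big)^{p-1},$$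 $$U_p(\mu)=\big([\mu,\nu]^{0,0}_p\big)^{1/p}+pp'\big([\mu,\nu]^{1,0}_p+[\mu,\nu]^{0,1}_p\big)+(pp')^2\big([\mu,\nu]^{1,1}_p\big)^{\max\{1,1/(p-1)\}}.$$ **Theorem.** (i) There is an absolute constant $C$ such that for all $1<p<\infty$ and all weights $\mu$ as above: $P$ is bounded on $L^p(\mathbb H,\mu\,dV)$ if and only if $[\mu,\nu]_p<\infty$, and $$[\mu,\nu]_p^{1/(2p)}\le C\,\|P\|,\qquad \|P\|\le\|P^+\|\le C\,U_p(\mu),$$ with norms on $L^p(\mathbb H,\mu\,dV)$. (ii) The upper bound is sharp: for every $1<p<\infty$ there is $c>0$ such that for every $M\ge 0$ there is a weight $\mu$ as above with $[\mu,\nu]^{1,1}_p\ge M$, $U_p(\mu)<\infty$ and $\|P\|\ge c\,U_p(\mu)$. -/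

import Mathlib

open MeasureTheory Set
open scoped ENNReal NNReal ComplexConjugate

noncomputable section

namespace HartogsBergman

/-! ### The Bergman projection of a domain in `ℂ²` -/

/-- `h` belongs to the Bergman space `A²(Ω)`: holomorphic and square integrable on `Ω`. -/
def MemBergman (Ω : Set (ℂ × ℂ)) (h : ℂ × ℂ → ℂ) : Prop :=
  DifferentiableOn ℂ h Ω ∧ MemLp h 2 (volume.restrict Ω)

/-- For `f ∈ L²(Ω)`: the function `g` is the orthogonal projection of `f` onto `A²(Ω)`, that is
`g ∈ A²(Ω)` and `f - g` is orthogonal to `A²(Ω)` in `L²(Ω)`. -/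
def IsBergmanProjection (Ω : Set (ℂ × ℂ)) (f g : ℂ × ℂ → ℂ) : Prop :=
  MemBergman Ω g ∧ ∀ h, MemBergman Ω h → ∫ w in Ω, (f w - g w) * conj (h w) = 0

/-- `K` represents the orthogonal projection `L²(Ω) → A²(Ω)` as an (absolutely convergent) integral
operator: for every `f ∈ L²(Ω)` the projection of `f` is `z ↦ ∫_Ω K(z, w) f(w) dV(w)`. For each
`z ∈ Ω` this determines `K(z, ·)` almost everywhere on `Ω`. -/
def IsBergmanKernel (Ω : Set (ℂ × ℂ)) (K : ℂ × ℂ → ℂ × ℂ → ℂ) : Prop :=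
  ∀ f : ℂ × ℂ → ℂ, MemLp f 2 (volume.restrict Ω) →
    (∀ z ∈ Ω, IntegrableOn (fun w => K z w * f w) Ω) ∧
      IsBergmanProjection Ω f (fun z => ∫ w in Ω, K z w * f w)

open Classical in
/-- The Bergman kernel of `Ω`. -/
def bergmanKernel (Ω : Set (ℂ × ℂ)) : ℂ × ℂ → ℂ × ℂ → ℂ :=
  if h : ∃ K, IsBergmanKernel Ω K then h.choose else 0

/-! ### Integral operators on weighted `L^p` spaces -/

/-- The measure `μ dV` on `Ω`. -/
def weightedVolume (Ω : Set (ℂ × ℂ)) (μ : ℂ × ℂ → ℝ) : Measure (ℂ × ℂ) :=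
  (volume.restrict Ω).withDensity fun z => ENNReal.ofReal (μ z)

/-- The integral operator `f ↦ ∫_Ω k(·, w) f(w) dV(w)` is defined (by absolutely convergent
integrals) on all of `L^p(Ω, μ dV)`, and `C` is a bound for it from `L^p(Ω, μ dV)` to itself. -/
def IsLpBound (Ω : Set (ℂ × ℂ)) (k : ℂ × ℂ → ℂ × ℂ → ℂ) (p : ℝ) (μ : ℂ × ℂ → ℝ) (C : ℝ≥0∞) :
    Prop :=
  ∀ f : ℂ × ℂ → ℂ, MemLp f (ENNReal.ofReal p) (weightedVolume Ω μ) →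
    (∀ z ∈ Ω, IntegrableOn (fun w => k z w * f w) Ω) ∧
      eLpNorm (fun z => ∫ w in Ω, k z w * f w) (ENNReal.ofReal p) (weightedVolume Ω μ) ≤
        C * eLpNorm f (ENNReal.ofReal p) (weightedVolume Ω μ)

/-- The integral operator with kernel `k` is bounded on `L^p(Ω, μ dV)`. -/
def IsBoundedOnLp (Ω : Set (ℂ × ℂ)) (k : ℂ × ℂ → ℂ × ℂ → ℂ) (p : ℝ) (μ : ℂ × ℂ → ℝ) : Prop :=
  ∃ C : ℝ≥0, IsLpBound Ω k p μ C

/-- The norm on `L^p(Ω, μ dV)` of the integral operator with kernel `k`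
(`∞` if the operator is not bounded there). -/
def lpOpNorm (Ω : Set (ℂ × ℂ)) (k : ℂ × ℂ → ℂ × ℂ → ℂ) (p : ℝ) (μ : ℂ × ℂ → ℝ) : ℝ≥0∞ :=
  sInf {C : ℝ≥0∞ | IsLpBound Ω k p μ C}

/-! ### The Hartogs triangle -/

/-- The open unit disc. -/
def disc : Set ℂ := Metric.ball 0 1

/-- The Hartogs triangle. -/
def hartogs : Set (ℂ × ℂ) := {z | ‖z.1‖ < ‖z.2‖ ∧ ‖z.2‖ < 1}

/-- The kernel of the Bergman projection `P` of the Hartogs triangle. -/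
def kernelP : ℂ × ℂ → ℂ × ℂ → ℂ := bergmanKernel hartogs

/-- The kernel of the positive Bergman projection `P⁺` of the Hartogs triangle. -/
def kernelPplus : ℂ × ℂ → ℂ × ℂ → ℂ := fun z w => (‖bergmanKernel hartogs z w‖ : ℂ)

/-- The measure `du = |w₂|⁻² dV`. -/
def measureU : Measure (ℂ × ℂ) :=
  volume.withDensity fun w => ENNReal.ofReal (‖w.2‖ ^ (-2 : ℝ))

open Classical in
/-- The Carleson tent `T_z` in the unit disc. -/
def tent (z : ℂ) : Set ℂ :=
  if z = 0 then disc else {w ∈ disc | ‖1 - conj w * (z / (‖z‖ : ℂ))‖ < 1 - ‖z‖}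

/-- The induced Carleson tent `T'_{z₁,z₂}` in the Hartogs triangle. -/
def inducedTent (z₁ z₂ : ℂ) : Set (ℂ × ℂ) :=
  {w ∈ hartogs | w.1 / w.2 ∈ tent z₁ ∧ w.2 ∈ tent z₂}

/-! ### Weights and their characteristics -/

/-- `μ` is a positive (almost everywhere), locally integrable weight on the Hartogs triangle of the
form `μ(z₁, z₂) = μ₁(z₁ / z₂) μ₂(z₂)`. -/
structure IsProductWeight (μ : ℂ × ℂ → ℝ) (μ₁ μ₂ : ℂ → ℝ) : Prop where
  pos₁ : ∀ᵐ t ∂volume.restrict disc, 0 < μ₁ t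
  pos₂ : ∀ᵐ t ∂volume.restrict disc, 0 < μ₂ t
  eq_mul : ∀ z ∈ hartogs, μ z = μ₁ (z.1 / z.2) * μ₂ z.2
  locallyIntegrable : LocallyIntegrableOn μ hartogs

/-- The Hölder conjugate `p' = p / (p - 1)`. -/
def conjExp (p : ℝ) : ℝ := p / (p - 1)

/-- The dual weight `ν = |z₂|^{-p'} μ^{-p'/p}`. -/
def dualWeight (p : ℝ) (μ : ℂ × ℂ → ℝ) (z : ℂ × ℂ) : ℝ :=
  ‖z.2‖ ^ (-conjExp p) * μ z ^ (-conjExp p / p)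

/-- The first factor `ν₁ = μ₁^{-p'/p}` in `ν(z₁, z₂) = ν₁(z₁ / z₂) ν₂(z₂)`. -/
def dualWeight₁ (p : ℝ) (μ₁ : ℂ → ℝ) (t : ℂ) : ℝ := μ₁ t ^ (-conjExp p / p)

/-- The second factor `ν₂ = |t|^{-p'} μ₂^{-p'/p}` in `ν(z₁, z₂) = ν₁(z₁ / z₂) ν₂(z₂)`. -/
def dualWeight₂ (p : ℝ) (μ₂ : ℂ → ℝ) (t : ℂ) : ℝ :=
  ‖t‖ ^ (-conjExp p) * μ₂ t ^ (-conjExp p / p)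

/-- `⟨a⟩_U ⟨b⟩_U^{p-1}`, where `⟨a⟩_U` is the average of `|a|` over `U` with respect to `m`. -/
def avgProd {α : Type*} [MeasurableSpace α] (p : ℝ) (m : Measure α) (a b : α → ℝ) (U : Set α) :
    ℝ≥0∞ :=
  (⨍⁻ x in U, ‖a x‖ₑ ∂m) * (⨍⁻ x in U, ‖b x‖ₑ ∂m) ^ (p - 1)

/-- `⟨|w₂|^{2-p} μ⟩_U ⟨|w₂|² ν⟩_U^{p-1}` with averages with respect to `du`, for `U ⊆ ℍ`. -/
def hartogsProd (p : ℝ) (μ : ℂ × ℂ → ℝ) (U : Set (ℂ × ℂ)) : ℝ≥0∞ :=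
  avgProd p measureU (fun w => ‖w.2‖ ^ (2 - p) * μ w)
    (fun w => ‖w.2‖ ^ 2 * dualWeight p μ w) U

/-- `⟨μ₁⟩_U ⟨ν₁⟩_U^{p-1}` with averages with respect to `dV`, for `U ⊆ 𝔻`. -/
def discProd₁ (p : ℝ) (μ₁ : ℂ → ℝ) (U : Set ℂ) : ℝ≥0∞ :=
  avgProd p volume μ₁ (dualWeight₁ p μ₁) U

/-- `⟨|w₂|^{2-p} μ₂⟩_U ⟨|w₂|² ν₂⟩_U^{p-1}` with averages with respect to `dV`, for `U ⊆ 𝔻`. -/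
def discProd₂ (p : ℝ) (μ₂ : ℂ → ℝ) (U : Set ℂ) : ℝ≥0∞ :=
  avgProd p volume (fun w => ‖w‖ ^ (2 - p) * μ₂ w) (fun w => ‖w‖ ^ 2 * dualWeight₂ p μ₂ w) U

/-- The Bekollé–Bonami type constant `[μ, ν]_p`. -/
def char (p : ℝ) (μ : ℂ × ℂ → ℝ) : ℝ≥0∞ :=
  ⨆ z₁ ∈ disc, ⨆ z₂ ∈ disc, hartogsProd p μ (inducedTent z₁ z₂)

/-- `[μ, ν]_p^{0,0}`. -/
def char00 (p : ℝ) (μ : ℂ × ℂ → ℝ) : ℝ≥0∞ := hartogsProd p μ hartogs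

/-- `[μ, ν]_p^{1,0}`. -/
def char10 (p : ℝ) (μ₁ μ₂ : ℂ → ℝ) : ℝ≥0∞ :=
  discProd₂ p μ₂ disc ^ (1 / p) *
    (⨆ z ∈ disc, ⨆ _ : 1 / 2 < ‖z‖, discProd₁ p μ₁ (tent z)) ^ max 1 (1 / (p - 1))

/-- `[μ, ν]_p^{0,1}`. -/
def char01 (p : ℝ) (μ₁ μ₂ : ℂ → ℝ) : ℝ≥0∞ :=
  (⨆ z ∈ disc, ⨆ _ : 1 / 2 < ‖z‖, discProd₂ p μ₂ (tent z)) ^ max 1 (1 / (p - 1)) *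
    discProd₁ p μ₁ disc ^ (1 / p)

/-- `[μ, ν]_p^{1,1}`. -/
def char11 (p : ℝ) (μ : ℂ × ℂ → ℝ) : ℝ≥0∞ :=
  ⨆ z₁ ∈ disc, ⨆ z₂ ∈ disc, ⨆ _ : 1 / 2 < ‖z₁‖ ∧ 1 / 2 < ‖z₂‖,
    hartogsProd p μ (inducedTent z₁ z₂)

/-- `([μ,ν]_p^{0,0})^{1/p} + p p' ([μ,ν]_p^{1,0} + [μ,ν]_p^{0,1})
  + (p p')² ([μ,ν]_p^{1,1})^{max{1, 1/(p-1)}}`. -/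
def upperBound (p : ℝ) (μ : ℂ × ℂ → ℝ) (μ₁ μ₂ : ℂ → ℝ) : ℝ≥0∞ :=
  char00 p μ ^ (1 / p) +
    ENNReal.ofReal (p * conjExp p) * (char10 p μ₁ μ₂ + char01 p μ₁ μ₂) +
    ENNReal.ofReal ((p * conjExp p) ^ 2) * char11 p μ ^ max 1 (1 / (p - 1))

end HartogsBergman

end

/-! The substitution (t₁, t₂) ↦ (t₁t₂, t₂) maps 𝔻 × (𝔻 ∖ {0}) onto ℍ with Jacobian |t₂|², so f ↦ t₂
f(t₁t₂, t₂) is an isometry of L²(ℍ) onto L²(𝔻²). It matches the two Bergman spaces, because a square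
integrable holomorphic function on the punctured disc has a removable singularity
(`isLittleO_inv_of_setLIntegral_sq`). Hence the kernel of ℍ is (z₂ w̄₂)⁻¹ times a product of two
disc kernels (`isBergmanKernel_hartogsKernel`). A kernel specified only through its projections is
known just almost everywhere in w, and that suffices (`ae_bergmanKernel_eq`).

The same substitution turns the L^p(μ) norm of f into the norm of t₂f for the product weight W₁ ⊗
W₂, where W₁ = μ₁ and W₂ = |t|^{2-p} μ₂. It turns du into Lebesgue measure and induced tents into
products of tents. So the whole problem factors: the constant over all tents is a product of two
one-variable constants (`char_eq`), and U_p is exactly the expanded product of two factors A^{1/p} +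
pp' B^{max{1,1/(p-1)}}, with A the quantity for the whole disc and B the one for small tents
(`upperBound_eq`).

Upper bound. Up to an absolute constant, the modulus of the disc kernel is at most 1 plus the
averaging kernels of two shifted 8-adic grids of tents (`enorm_discKernel_le`). The constant 1
contributes A^{1/p} by Hölder. Each grid is laminar and its tents have disjoint tops of comparable
area, so it gives a sparse form; nested maximal functions bound it by a multiple of pp' B when p ≥ 2
(`IsLaminar.sum_mul_div_le`), and exchanging the two functions covers p ≤ 2 (`isFormBound_disc`).
One-variable form bounds multiply under tensor products (`IsFormBound.prod`), and duality returns to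
the operator P⁺, which dominates P.

Lower bound. Every tent has a companion set of comparable area from which the kernel is seen with
almost constant argument (`exists_companion`). Testing on the dual weight from tent to companion and
from companion to tent, then multiplying, gives the 2p-th power estimate
(`IsLpBound.hartogsProd_le`).

Sharpness. The weight |1-t|^{δ-2} in both variables for p ≥ 2, or its power 1-p for p ≤ 2, makes U_p
at most a constant times δ⁻². Tensor test functions supported near the point 1 show that the norm is
at least a constant times δ⁻² (`exists_sharp_of_family`). -/

noncomputable section

namespace HartogsBergman

/-! ### Maximal functions and sparse forms over finite laminar families -/

section Laminar

variable {X ι : Type*} [MeasurableSpace X]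

/-- Any two members of the family are nested or disjoint. -/
def IsLaminar (S : ι → Set X) : Prop :=
  ∀ i j, Disjoint (S i) (S j) ∨ S i ⊆ S j ∨ S j ⊆ S i

/-- A set of the family that is maximal for inclusion absorbs every member it meets, and the
remaining members are disjoint from it. Induction on those loses no constant, so no covering lemma
is needed. -/
theorem IsLaminar.mul_measure_biUnion_le {S : ι → Set X} (hS : IsLaminar S)
    (hm : ∀ i, MeasurableSet (S i)) (μ ν : Measure X) (c : ℝ≥0∞) (F : Finset ι) :
    (∀ i ∈ F, c * μ (S i) ≤ ν (S i)) → c * μ (⋃ i ∈ F, S i) ≤ ν (⋃ i ∈ F, S i) := by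
  classical
  induction F using Finset.strongInduction with
  | H F ih =>
    intro h
    rcases F.eq_empty_or_nonempty with rfl | hne
    · simp
    obtain ⟨i₀, hi₀, hmax⟩ := F.exists_maximalFor S hne
    set F' := (F.erase i₀).filter fun j => Disjoint (S i₀) (S j)
    have hsub : F' ⊂ F := lt_of_le_of_lt (Finset.filter_subset _ _) (Finset.erase_ssubset hi₀)
    have hU : (⋃ i ∈ F, S i) = S i₀ ∪ ⋃ i ∈ F', S i := by
      apply subset_antisymm
      · refine iUnion₂_subset fun j hj => ?_
        rcases hS i₀ j with hd | hle | hle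
        · by_cases hji : j = i₀
          · rw [hji]; exact subset_union_left
          · refine subset_union_of_subset_right ?_ _
            exact subset_biUnion_of_mem (u := S)
              (show j ∈ (F' : Set ι) by simp [F', hji, hj, hd])
        · exact subset_union_of_subset_left (hmax hj hle) _
        · exact subset_union_of_subset_left hle _
      · refine union_subset (subset_biUnion_of_mem (u := S) hi₀) ?_
        exact biUnion_subset_biUnion_left fun j hj => hsub.subset hj
    have hd : Disjoint (S i₀) (⋃ i ∈ F', S i) := by
      rw [disjoint_iUnion₂_right]
      intro j hj
      exact (Finset.mem_filter.mp hj).2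
    have hmU : MeasurableSet (⋃ i ∈ F', S i) := F'.measurableSet_biUnion fun i _ => hm i
    rw [hU, measure_union hd hmU, measure_union hd hmU, mul_add]
    exact add_le_add (h i₀ hi₀) (ih F' hsub fun i hi => h i (hsub.subset hi))

/-- The maximal function over a finite family of sets, with respect to the measure `μ`. -/
def maxAvg (μ : Measure X) (S : ι → Set X) (F : Finset ι) (φ : X → ℝ≥0∞) (x : X) : ℝ≥0∞ :=
  F.sup fun i => (S i).indicator (fun _ => (∫⁻ y in S i, φ y ∂μ) / μ (S i)) x

theorem measurable_maxAvg (μ : Measure X) {S : ι → Set X} (hm : ∀ i, MeasurableSet (S i))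
    (F : Finset ι) (φ : X → ℝ≥0∞) : Measurable (maxAvg μ S F φ) := by
  have : maxAvg μ S F φ =
      F.sup fun i => (S i).indicator (fun _ => (∫⁻ y in S i, φ y ∂μ) / μ (S i)) := by
    ext x; simp [maxAvg, Finset.sup_apply]
  rw [this]
  refine Finset.sup_induction (p := Measurable) measurable_const (fun _ h₁ _ h₂ => h₁.sup h₂) ?_
  exact fun i _ => measurable_const.indicator (hm i)

theorem div_le_maxAvg (μ : Measure X) {S : ι → Set X} {F : Finset ι} (φ : X → ℝ≥0∞) {i : ι}
    (hi : i ∈ F) {x : X} (hx : x ∈ S i) :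
    (∫⁻ y in S i, φ y ∂μ) / μ (S i) ≤ maxAvg μ S F φ x := by
  have := Finset.le_sup (f := fun i => (S i).indicator
    (fun _ => (∫⁻ y in S i, φ y ∂μ) / μ (S i)) x) hi
  simpa [hx, maxAvg] using this

/-- The superlevel set is the union of the sets whose average exceeds t, and on each of them the
inequality is immediate. This is the weak (1,1) bound with constant 1 for an arbitrary measure,
which is why no doubling of the weights is ever required. -/
theorem IsLaminar.mul_measure_lt_maxAvg_le {S : ι → Set X} (hS : IsLaminar S)
    (hm : ∀ i, MeasurableSet (S i)) (μ : Measure X) (F : Finset ι)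
    (φ : X → ℝ≥0∞) (t : ℝ≥0∞) :
    t * μ {x | t < maxAvg μ S F φ x} ≤ (μ.withDensity φ) {x | t < maxAvg μ S F φ x} := by
  classical
  have hset : {x | t < maxAvg μ S F φ x} =
      ⋃ i ∈ F.filter (fun i => t < (∫⁻ y in S i, φ y ∂μ) / μ (S i)), S i := by
    ext x
    simp only [mem_ofPred_eq, maxAvg, Finset.lt_sup_iff, mem_iUnion, Finset.mem_filter, exists_prop]
    constructor
    · rintro ⟨i, hi, hlt⟩
      by_cases hx : x ∈ S i
      · exact ⟨i, ⟨hi, by simpa [hx] using hlt⟩, hx⟩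
      · simp [hx] at hlt
    · rintro ⟨i, ⟨hi, hlt⟩, hx⟩
      exact ⟨i, hi, by simpa [hx] using hlt⟩
  rw [hset]
  refine hS.mul_measure_biUnion_le hm _ _ _ _ fun i hi => ?_
  rw [withDensity_apply _ (hm i)]
  exact ENNReal.mul_le_of_le_div (Finset.mem_filter.mp hi).2.le

/-- If `I ≤ A * I ^ (1/q)` with `I` finite, then `I ^ (1/p) ≤ A`. -/
theorem rpow_le_of_le_mul_rpow {p q : ℝ} (hpq : p.HolderConjugate q) {I A : ℝ≥0∞} (hI : I ≠ ∞)
    (h : I ≤ A * I ^ (1 / q)) : I ^ (1 / p) ≤ A := by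
  rcases eq_or_ne I 0 with rfl | h0
  · rw [ENNReal.zero_rpow_of_pos (one_div_pos.mpr hpq.pos)]; exact zero_le
  have h1 : I ^ (1 / p) * I ^ (1 / q) = I := by
    rw [← ENNReal.rpow_add _ _ h0 hI, hpq.one_div_add_one_div, one_div_one, ENNReal.rpow_one]
  have h2 : I ^ (1 / q) ≠ 0 := by simp [ENNReal.rpow_eq_zero_iff, h0, hI]
  have h3 : I ^ (1 / q) ≠ ∞ := ENNReal.rpow_ne_top_of_nonneg (one_div_pos.mpr hpq.symm.pos).le hI
  rw [← h1] at h
  have h' : I ^ (1 / p) * I ^ (1 / q) ≤ A * I ^ (1 / q) := by rwa [h1] at h ⊢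
  exact (ENNReal.mul_le_mul_iff_left h2 h3).mp h'

/-- The strong type maximal inequality over a laminar family, with the constant `p' = q`
independent of the measure. -/
theorem IsLaminar.lintegral_maxAvg_rpow_le {S : ι → Set X} (hS : IsLaminar S)
    (hm : ∀ i, MeasurableSet (S i)) (μ : Measure X) (F : Finset ι)
    (h0 : ∀ i ∈ F, μ (S i) ≠ 0) (htop : ∀ i ∈ F, μ (S i) ≠ ∞)
    {φ : X → ℝ≥0∞} (hφ : Measurable φ) {p q : ℝ} (hpq : p.HolderConjugate q) :
    (∫⁻ x, maxAvg μ S F φ x ^ p ∂μ) ^ (1 / p) ≤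
      ENNReal.ofReal q * (∫⁻ x, φ x ^ p ∂μ) ^ (1 / p) := by
  have hp := hpq.pos
  have hq := hpq.symm.pos
  by_cases hfin : ∫⁻ x, φ x ^ p ∂μ = ∞
  · rw [hfin, ENNReal.top_rpow_of_pos (one_div_pos.mpr hp), ENNReal.mul_top (by simpa using hq)]
    exact le_top
  have havg : ∀ i ∈ F, (∫⁻ y in S i, φ y ∂μ) / μ (S i) ≠ ∞ := by
    intro i hi
    refine ENNReal.div_ne_top ?_ (h0 i hi)
    have h1 : ∫⁻ y in S i, φ y ∂μ ≤
        (∫⁻ y in S i, φ y ^ p ∂μ) ^ (1 / p) * (∫⁻ y in S i, 1 ^ q ∂μ) ^ (1 / q) := by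
      simpa using ENNReal.lintegral_mul_le_Lp_mul_Lq (μ.restrict (S i)) hpq hφ.aemeasurable
        (g := fun _ => 1) aemeasurable_const
    refine ne_top_of_le_ne_top (ENNReal.mul_ne_top ?_ ?_) h1
    · exact ENNReal.rpow_ne_top_of_nonneg (one_div_pos.mpr hp).le
        (ne_top_of_le_ne_top hfin (setLIntegral_le_lintegral _ _))
    · refine ENNReal.rpow_ne_top_of_nonneg (one_div_pos.mpr hq).le ?_
      simpa using htop i hi
  set M := maxAvg μ S F φ with hM
  have hMm : Measurable M := measurable_maxAvg μ hm F φ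
  have hMtop : ∀ x, M x ≠ ∞ := by
    intro x
    refine ((Finset.sup_lt_iff (by simp)).mpr fun i hi => ?_).ne
    by_cases hx : x ∈ S i
    · simpa [hx] using (havg i hi).lt_top
    · simp [hx]
  -- The argument ends by cancelling a power of this integral, so its finiteness has to be known
  -- beforehand. It holds because the family is finite.
  have hIfin : ∫⁻ x, M x ^ p ∂μ ≠ ∞ := by
    have hle : ∀ x, M x ^ p ≤
        ∑ i ∈ F, (S i).indicator (fun _ => ((∫⁻ y in S i, φ y ∂μ) / μ (S i)) ^ p) x := by
      intro x
      rcases F.eq_empty_or_nonempty with rfl | hne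
      · simp [hM, maxAvg, hp]
      obtain ⟨i, hi, hieq⟩ := Finset.exists_mem_eq_sup F hne
        (fun i => (S i).indicator (fun _ => (∫⁻ y in S i, φ y ∂μ) / μ (S i)) x)
      rw [hM, maxAvg, hieq]
      refine le_trans ?_ (Finset.single_le_sum (f := fun i => (S i).indicator
        (fun _ => ((∫⁻ y in S i, φ y ∂μ) / μ (S i)) ^ p) x) (fun _ _ => zero_le) hi)
      by_cases hx : x ∈ S i <;> simp [hx, hp]
    refine ne_top_of_le_ne_top ?_ (lintegral_mono hle)
    rw [lintegral_finsetSum _ fun i _ => measurable_const.indicator (hm i)]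
    refine ENNReal.sum_ne_top.mpr fun i hi => ?_
    rw [lintegral_indicator_const (hm i)]
    exact ENNReal.mul_ne_top (ENNReal.rpow_ne_top_of_nonneg hp.le (havg i hi)) (htop i hi)
  have hreal : ∀ (ν : Measure X) {r : ℝ}, 0 < r → ∫⁻ x, M x ^ r ∂ν =
      ENNReal.ofReal r * ∫⁻ t in Ioi (0 : ℝ),
        ν {x | ENNReal.ofReal t < M x} * ENNReal.ofReal (t ^ (r - 1)) := by
    intro ν r hr
    have := lintegral_rpow_eq_lintegral_meas_lt_mul ν (f := fun x => (M x).toReal)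
      (ae_of_all _ fun _ => ENNReal.toReal_nonneg) hMm.ennreal_toReal.aemeasurable hr
    rw [show (fun x => M x ^ r) = fun x => ENNReal.ofReal ((M x).toReal ^ r) by
      ext x
      rw [← ENNReal.ofReal_rpow_of_nonneg ENNReal.toReal_nonneg hr.le,
        ENNReal.ofReal_toReal (hMtop x)], this]
    congr 1
    refine setLIntegral_congr_fun measurableSet_Ioi fun t ht => ?_
    congr 2
    ext x
    simp only [mem_ofPred_eq]
    rw [ENNReal.ofReal_lt_iff_lt_toReal (le_of_lt ht) (hMtop x)]
  have hp1 : 0 < p - 1 := sub_pos.mpr hpq.lt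
  -- Layer cake twice, once for μ and once for φ dμ, with the weak type bound in between. The ratio
  -- of the two outer factors is p/(p-1) = q.
  have key : ∫⁻ x, M x ^ p ∂μ ≤ ENNReal.ofReal q * ∫⁻ x, φ x * M x ^ (p - 1) ∂μ := by
    have e1 : ∫⁻ x, φ x * M x ^ (p - 1) ∂μ = ∫⁻ x, M x ^ (p - 1) ∂(μ.withDensity φ) := by
      rw [lintegral_withDensity_eq_lintegral_mul _ hφ (hMm.pow_const _)]
      rfl
    rw [e1, hreal μ hp, hreal _ hp1, ← mul_assoc, ← ENNReal.ofReal_mul hq.le]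
    rw [show q * (p - 1) = p by
      have := hpq.mul_eq_add; linarith]
    gcongr 1
    refine setLIntegral_mono' measurableSet_Ioi fun t ht => ?_
    have ht : 0 < t := ht
    calc μ {x | ENNReal.ofReal t < M x} * ENNReal.ofReal (t ^ (p - 1))
        = (ENNReal.ofReal t * μ {x | ENNReal.ofReal t < M x}) *
            ENNReal.ofReal (t ^ (p - 1 - 1)) := by
          rw [mul_comm (ENNReal.ofReal t), mul_assoc, ← ENNReal.ofReal_mul ht.le]
          congr 2
          conv_rhs => rw [← Real.rpow_one_add' ht.le (by
            rw [show 1 + (p - 1 - 1) = p - 1 by ring]; exact hp1.ne')]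
          congr 1; ring
      _ ≤ _ := by
          gcongr
          exact hS.mul_measure_lt_maxAvg_le hm μ F φ _
  refine rpow_le_of_le_mul_rpow hpq hIfin (key.trans ?_)
  rw [mul_assoc]
  gcongr
  have := ENNReal.lintegral_mul_le_Lp_mul_Lq μ hpq hφ.aemeasurable
    (hMm.pow_const (p - 1)).aemeasurable
  refine this.trans (le_of_eq ?_)
  congr 3
  ext x
  rw [← ENNReal.rpow_mul]
  congr 1
  have := hpq.mul_eq_add; linarith

/-- Hölder for three functions with reciprocal exponents 1/p, 1/p and (p-2)/p, arranged in two steps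
so that p = 2 needs no separate treatment. -/
theorem lintegral_mul_mul_rpow_le {μ : Measure X} {p q : ℝ} (hpq : p.HolderConjugate q)
    (hp : 2 ≤ p) {f g h : X → ℝ≥0∞} (hf : Measurable f) (hg : Measurable g) (hh : Measurable h) :
    ∫⁻ x, f x * (g x * h x ^ (p - 2)) ∂μ ≤
      (∫⁻ x, f x ^ p ∂μ) ^ (1 / p) * ((∫⁻ x, g x ^ p ∂μ) ^ (1 / p) *
        (∫⁻ x, h x ^ p ∂μ) ^ ((p - 2) / p)) := by
  have hp0 := hpq.pos
  have hq0 := hpq.symm.pos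
  have hpq' := hpq.mul_eq_add
  have hp1 : 0 < p - 1 := by linarith
  have hqe : q = p / (p - 1) := by field_simp; linarith
  refine (ENNReal.lintegral_mul_le_Lp_mul_Lq μ hpq hf.aemeasurable
    (hg.mul (hh.pow_const _)).aemeasurable).trans ?_
  gcongr 1
  have h1 := ENNReal.lintegral_mul_norm_pow_le (μ := μ) (hg.pow_const p).aemeasurable
    (hh.pow_const p).aemeasurable (p := 1 / (p - 1)) (q := (p - 2) / (p - 1)) (by positivity)
    (div_nonneg (by linarith) hp1.le) (by field_simp; ring)
  calc _ = (∫⁻ x, (g x ^ p) ^ (1 / (p - 1)) * (h x ^ p) ^ ((p - 2) / (p - 1)) ∂μ) ^ (1 / q) := by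
        congr 2
        ext x
        simp only [Pi.mul_apply]
        rw [ENNReal.mul_rpow_of_nonneg _ _ hq0.le, ← ENNReal.rpow_mul, ← ENNReal.rpow_mul,
          ← ENNReal.rpow_mul, hqe]
        congr 2 <;> field_simp
    _ ≤ _ := ENNReal.rpow_le_rpow h1 (one_div_pos.mpr hq0).le
    _ = _ := by
        rw [ENNReal.mul_rpow_of_nonneg _ _ (one_div_pos.mpr hq0).le, ← ENNReal.rpow_mul,
          ← ENNReal.rpow_mul, hqe]
        congr 2 <;> field_simp

theorem rpow_one_add {r : ℝ} (hr : 0 ≤ r) (x : ℝ≥0∞) : x ^ (1 + r) = x * x ^ r := by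
  rw [ENNReal.rpow_add_of_nonneg _ _ zero_le_one hr, ENNReal.rpow_one]

theorem measurable_fun_div {f v : X → ℝ≥0∞} (hf : Measurable f) (hv : Measurable v) :
    Measurable fun x => f x / v x := hf.div hv

theorem setLIntegral_div_withDensity {m : Measure X} {v : X → ℝ≥0∞} (hv : Measurable v)
    (hv0 : ∀ x, v x ≠ 0) (hvt : ∀ x, v x ≠ ∞) {f : X → ℝ≥0∞} (hf : Measurable f) {s : Set X}
    (hs : MeasurableSet s) :
    ∫⁻ x in s, f x / v x ∂(m.withDensity v) = ∫⁻ x in s, f x ∂m := by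
  rw [setLIntegral_withDensity_eq_setLIntegral_mul _ hv (measurable_fun_div hf hv) hs]
  refine lintegral_congr fun x => ?_
  simp only [Pi.mul_apply]
  rw [ENNReal.mul_div_cancel (hv0 x) (hvt x)]

theorem lintegral_div_rpow_withDensity {m : Measure X} {v : X → ℝ≥0∞} (hv : Measurable v)
    (hv0 : ∀ x, v x ≠ 0) (hvt : ∀ x, v x ≠ ∞) {f : X → ℝ≥0∞} (hf : Measurable f) {p : ℝ}
    (hp : 0 ≤ p) :
    ∫⁻ x, (f x / v x) ^ p ∂(m.withDensity v) = ∫⁻ x, f x ^ p * v x ^ (1 - p) ∂m := by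
  rw [lintegral_withDensity_eq_lintegral_mul _ hv ((measurable_fun_div hf hv).pow_const _)]
  refine lintegral_congr fun x => ?_
  simp only [Pi.mul_apply]
  rw [ENNReal.div_rpow_of_nonneg _ _ hp, div_eq_mul_inv, ← ENNReal.rpow_neg, mul_left_comm,
    sub_eq_add_neg, ENNReal.rpow_add _ _ (hv0 x) (hvt x), ENNReal.rpow_one]

theorem setLIntegral_ne_zero {m : Measure X} {v : X → ℝ≥0∞} (hv : Measurable v)
    (hv0 : ∀ x, v x ≠ 0) {s : Set X} (hs : m s ≠ 0) : ∫⁻ x in s, v x ∂m ≠ 0 := by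
  rw [Ne, lintegral_eq_zero_iff hv]
  intro h
  apply hs
  rw [← Measure.restrict_eq_zero, ← ae_eq_bot, ← Filter.eventually_false_iff_eq_bot]
  filter_upwards [h] with x hx using hv0 x hx

/-- The weighted estimate for sparse forms, with a constant that does not grow exponentially
in `p`. -/
theorem IsLaminar.sum_mul_div_le {S E : ι → Set X} (hS : IsLaminar S)
    (hm : ∀ i, MeasurableSet (S i)) (hE : ∀ i, MeasurableSet (E i)) (hES : ∀ i, E i ⊆ S i)
    (hEd : Pairwise fun i j => Disjoint (E i) (E j)) {m : Measure X} {κ : ℝ≥0∞}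
    (hκ : ∀ i, m (S i) ≤ κ * m (E i)) (hm0 : ∀ i, m (S i) ≠ 0) (hmt : ∀ i, m (S i) ≠ ∞)
    {p q : ℝ} (hpq : p.HolderConjugate q) (hp2 : 2 ≤ p) {v : X → ℝ≥0∞} (hv : Measurable v)
    (hv0 : ∀ x, v x ≠ 0) (hvt : ∀ x, v x ≠ ∞) {B : ℝ≥0∞} (hB : B ≠ ∞)
    (hBS : ∀ i, (∫⁻ x in S i, v x ^ (1 - p) ∂m) * (∫⁻ x in S i, v x ∂m) ^ (p - 1) ≤
      B * m (S i) ^ p) {f g : X → ℝ≥0∞} (hf : Measurable f) (hg : Measurable g) (F : Finset ι) :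
    ∑ i ∈ F, (∫⁻ x in S i, f x ∂m) * (∫⁻ x in S i, g x ∂m) / m (S i) ≤
      κ * B * (ENNReal.ofReal q ^ (p - 1) * ENNReal.ofReal p) *
        ((∫⁻ x, f x ^ p * v x ^ (1 - p) ∂m) ^ (1 / p) * (∫⁻ x, g x ^ q * v x ∂m) ^ (1 / q)) := by
  have hp0 := hpq.pos
  have hq0 := hpq.symm.pos
  have hpq' := hpq.mul_eq_add
  have hp1 : 0 < p - 1 := by linarith
  have hqe : q = p / (p - 1) := by field_simp; linarith
  set u : X → ℝ≥0∞ := fun x => v x ^ (1 - p) with hu_def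
  have hu : Measurable u := hv.pow_const _
  have hu0 : ∀ x, u x ≠ 0 := fun x => by simp [u, ENNReal.rpow_eq_zero_iff, hv0 x, hvt x]
  have hut : ∀ x, u x ≠ ∞ := fun x => ENNReal.rpow_ne_top_of_ne_zero (hv0 x) (hvt x)
  set V : ι → ℝ≥0∞ := fun i => ∫⁻ x in S i, v x ∂m with hV
  set U : ι → ℝ≥0∞ := fun i => ∫⁻ x in S i, u x ∂m with hU
  have hV0 : ∀ i, V i ≠ 0 := fun i => setLIntegral_ne_zero hv hv0 (hm0 i)
  have hU0 : ∀ i, U i ≠ 0 := fun i => setLIntegral_ne_zero hu hu0 (hm0 i)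
  have hfin : ∀ i, U i * V i ^ (p - 1) ≠ ∞ := fun i =>
    ne_top_of_le_ne_top (ENNReal.mul_ne_top hB
      (ENNReal.rpow_ne_top_of_nonneg hp0.le (hmt i))) (hBS i)
  have hVt : ∀ i, V i ≠ ∞ := by
    intro i h
    apply hfin i
    rw [h, ENNReal.top_rpow_of_pos hp1, ENNReal.mul_top (hU0 i)]
  have hUt : ∀ i, U i ≠ ∞ := by
    intro i h
    apply hfin i
    rw [h, ENNReal.top_mul]
    simp [ENNReal.rpow_eq_zero_iff, hV0 i, hVt i]
  set μv := m.withDensity v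
  set μu := m.withDensity u
  have hμv : ∀ i, μv (S i) = V i := fun i => withDensity_apply _ (hm i)
  have hμu : ∀ i, μu (S i) = U i := fun i => withDensity_apply _ (hm i)
  -- On each set let a and b be the averages of f/v against v dm and of g/u against u dm, and write
  -- b = c^{p-1}. One factor c is kept pointwise through C, and the remaining c^{p-2} is averaged
  -- again through the second maximal function M. All the maximal bounds are independent of the
  -- weights, so B enters exactly once.
  set A := maxAvg μv S F fun x => f x / v x
  set G := maxAvg μu S F fun x => g x / u x
  set C : X → ℝ≥0∞ := fun x => G x ^ (1 / (p - 1))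
  set M := maxAvg μv S F fun x => C x / v x
  have hA : Measurable A := measurable_maxAvg _ hm _ _
  have hG : Measurable G := measurable_maxAvg _ hm _ _
  have hC : Measurable C := hG.pow_const _
  have hM : Measurable M := measurable_maxAvg _ hm _ _
  have hterm : ∀ i ∈ F, (∫⁻ x in S i, f x ∂m) * (∫⁻ x in S i, g x ∂m) / m (S i) ≤
      κ * B * ∫⁻ x in E i, A x * (C x * M x ^ (p - 2)) ∂m := by
    intro i hi
    set a := (∫⁻ x in S i, f x ∂m) / V i with ha
    set b := (∫⁻ x in S i, g x ∂m) / U i with hb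
    set c := b ^ (1 / (p - 1)) with hc
    have hbc : b = c * c ^ (p - 2) := by
      rw [← rpow_one_add (by linarith : (0 : ℝ) ≤ p - 2), hc, ← ENNReal.rpow_mul]
      rw [show 1 / (p - 1) * (1 + (p - 2)) = 1 by field_simp; ring, ENNReal.rpow_one]
    have hfa : ∫⁻ x in S i, f x ∂m = a * V i := (ENNReal.div_mul_cancel (hV0 i) (hVt i)).symm
    have hgb : ∫⁻ x in S i, g x ∂m = b * U i := (ENNReal.div_mul_cancel (hU0 i) (hUt i)).symm
    have hxA : ∀ x ∈ S i, a ≤ A x := by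
      intro x hx
      refine le_trans (le_of_eq ?_) (div_le_maxAvg μv _ hi hx)
      rw [hμv, setLIntegral_div_withDensity hv hv0 hvt hf (hm i)]
    have hxC : ∀ x ∈ S i, c ≤ C x := by
      intro x hx
      refine ENNReal.rpow_le_rpow ?_ (by positivity)
      refine le_trans (le_of_eq ?_) (div_le_maxAvg μu _ hi hx)
      rw [hμu, setLIntegral_div_withDensity hu hu0 hut hg (hm i)]
    have hxM : ∀ x ∈ S i, c * (m (S i) / V i) ≤ M x := by
      intro x hx
      refine le_trans ?_ (div_le_maxAvg μv _ hi hx)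
      rw [hμv, setLIntegral_div_withDensity hv hv0 hvt hC (hm i), ← mul_div_assoc]
      gcongr
      rw [← setLIntegral_const]
      exact setLIntegral_mono' (hm i) hxC
    -- The characteristic is used in the form that leaves the factor (m(S)/v(S))^{p-2}, which
    -- combines with c^{p-2} to the average estimated by M.
    have hUV : U i * V i / m (S i) ≤ B * m (S i) * (m (S i) / V i) ^ (p - 2) := by
      have h1 := hBS i
      rw [ENNReal.div_le_iff (hm0 i) (hmt i)]
      have hVp : V i ^ (p - 2) ≠ 0 := by simp [ENNReal.rpow_eq_zero_iff, hV0 i, hVt i]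
      have hVp' : V i ^ (p - 2) ≠ ∞ :=
        ENNReal.rpow_ne_top_of_nonneg (by linarith) (hVt i)
      rw [ENNReal.div_rpow_of_nonneg _ _ (by linarith), ← mul_div_assoc, ← ENNReal.mul_div_right_comm,
        ENNReal.le_div_iff_mul_le (Or.inl hVp) (Or.inl hVp')]
      calc U i * V i * V i ^ (p - 2) = U i * V i ^ (p - 1) := by
            rw [mul_assoc, ← rpow_one_add (by linarith : (0 : ℝ) ≤ p - 2)]
            congr 2; ring
        _ ≤ B * m (S i) ^ p := h1
        _ = _ := by
            have : m (S i) ^ p = m (S i) ^ (1 + ((p - 2) + 1)) := by congr 1; ring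
            rw [this, rpow_one_add (by linarith),
              ENNReal.rpow_add_of_nonneg _ _ (by linarith) zero_le_one, ENNReal.rpow_one]
            ring
    calc (∫⁻ x in S i, f x ∂m) * (∫⁻ x in S i, g x ∂m) / m (S i)
        = a * b * (U i * V i / m (S i)) := by
          rw [hfa, hgb]; simp only [div_eq_mul_inv]; ring
      _ ≤ a * b * (B * m (S i) * (m (S i) / V i) ^ (p - 2)) := by gcongr
      _ = a * (c * (c * (m (S i) / V i)) ^ (p - 2)) * B * m (S i) := by
          rw [hbc, ENNReal.mul_rpow_of_nonneg _ _ (by linarith : (0 : ℝ) ≤ p - 2)]; ring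
      _ ≤ a * (c * (c * (m (S i) / V i)) ^ (p - 2)) * B * (κ * m (E i)) := by
          gcongr; exact hκ i
      _ = κ * B * ∫⁻ _ in E i, a * (c * (c * (m (S i) / V i)) ^ (p - 2)) ∂m := by
          rw [setLIntegral_const]; ring
      _ ≤ _ := by
          gcongr 1
          refine setLIntegral_mono' (hE i) fun x hx => ?_
          have hx := hES i hx
          refine mul_le_mul' ?_ (mul_le_mul' ?_ ?_)
          · exact hxA x hx
          · exact hxC x hx
          · exact ENNReal.rpow_le_rpow (hxM x hx) (by linarith)
  -- Only disjointness of the sets E is used here. Dividing C by v moves the integral to v dm, where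
  -- A and M are bounded.
  have hsum : ∑ i ∈ F, ∫⁻ x in E i, A x * (C x * M x ^ (p - 2)) ∂m ≤
      ∫⁻ x, A x * (C x / v x * M x ^ (p - 2)) ∂μv := by
    rw [← lintegral_biUnion_finset (fun i _ j _ hij => hEd hij) (fun i _ => hE i)]
    refine (setLIntegral_le_lintegral _ _).trans (le_of_eq ?_)
    rw [lintegral_withDensity_eq_lintegral_mul _ hv
      (g := fun x => A x * (C x / v x * M x ^ (p - 2)))
      (hA.mul ((measurable_fun_div hC hv).mul (hM.pow_const _)))]
    refine lintegral_congr fun x => ?_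
    simp only [Pi.mul_apply]
    conv_lhs => rw [← ENNReal.mul_div_cancel (hv0 x) (hvt x) (b := C x)]
    ring
  have hAbd : (∫⁻ x, A x ^ p ∂μv) ^ (1 / p) ≤
      ENNReal.ofReal q * (∫⁻ x, f x ^ p * v x ^ (1 - p) ∂m) ^ (1 / p) := by
    rw [← lintegral_div_rpow_withDensity hv hv0 hvt hf hp0.le]
    exact hS.lintegral_maxAvg_rpow_le hm μv F (fun i _ => hμv i ▸ hV0 i)
      (fun i _ => hμv i ▸ hVt i) (measurable_fun_div hf hv) hpq
  have hGbd : (∫⁻ x, G x ^ q ∂μu) ^ (1 / q) ≤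
      ENNReal.ofReal p * (∫⁻ x, g x ^ q * v x ∂m) ^ (1 / q) := by
    have := hS.lintegral_maxAvg_rpow_le hm μu F (fun i _ => hμu i ▸ hU0 i)
      (fun i _ => hμu i ▸ hUt i) (measurable_fun_div hg hu) hpq.symm
    rw [lintegral_div_rpow_withDensity hu hu0 hut hg hq0.le] at this
    refine this.trans (le_of_eq ?_)
    congr 3
    ext x
    rw [hu_def, ← ENNReal.rpow_mul, show (1 - p) * (1 - q) = 1 by linarith, ENNReal.rpow_one]
  have hMbd : (∫⁻ x, M x ^ p ∂μv) ^ (1 / p) ≤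
      ENNReal.ofReal q * (∫⁻ x, (C x / v x) ^ p ∂μv) ^ (1 / p) :=
    hS.lintegral_maxAvg_rpow_le hm μv F (fun i _ => hμv i ▸ hV0 i)
      (fun i _ => hμv i ▸ hVt i) (measurable_fun_div hC hv) hpq
  -- Both sides integrate the same function, since C^p = G^{p/(p-1)} = G^q and v^{1-p} = u.
  have hCG : ∫⁻ x, (C x / v x) ^ p ∂μv = ∫⁻ x, G x ^ q ∂μu := by
    rw [lintegral_div_rpow_withDensity hv hv0 hvt hC hp0.le,
      lintegral_withDensity_eq_lintegral_mul _ hu (hG.pow_const _)]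
    refine lintegral_congr fun x => ?_
    simp only [Pi.mul_apply, C, u]
    rw [← ENNReal.rpow_mul, mul_comm, hqe]
    congr 2; ring
  set I := ∫⁻ x, G x ^ q ∂μu
  calc _ ≤ ∑ i ∈ F, κ * B * ∫⁻ x in E i, A x * (C x * M x ^ (p - 2)) ∂m := Finset.sum_le_sum hterm
    _ ≤ κ * B * ∫⁻ x, A x * (C x / v x * M x ^ (p - 2)) ∂μv := by
        rw [← Finset.mul_sum]; gcongr
    _ ≤ κ * B * ((∫⁻ x, A x ^ p ∂μv) ^ (1 / p) * (I ^ (1 / p) *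
          ((∫⁻ x, M x ^ p ∂μv) ^ (1 / p)) ^ (p - 2))) := by
        gcongr 1
        refine (lintegral_mul_mul_rpow_le hpq hp2 hA (measurable_fun_div hC hv) hM).trans (le_of_eq ?_)
        rw [hCG, ← ENNReal.rpow_mul]
        congr 4; ring
    _ ≤ κ * B * ((ENNReal.ofReal q * (∫⁻ x, f x ^ p * v x ^ (1 - p) ∂m) ^ (1 / p)) *
          (I ^ (1 / p) * (ENNReal.ofReal q * I ^ (1 / p)) ^ (p - 2))) := by
        rw [hCG] at hMbd
        gcongr
    _ = κ * B * (ENNReal.ofReal q ^ (p - 1) * (∫⁻ x, f x ^ p * v x ^ (1 - p) ∂m) ^ (1 / p) *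
          I ^ (1 / q)) := by
        have e1 : ∀ z : ℝ≥0∞, z ^ (p - 1) = z * z ^ (p - 2) := by
          intro z
          rw [← rpow_one_add (by linarith : (0 : ℝ) ≤ p - 2)]
          congr 1; ring
        have e2 : I ^ (1 / q) = I ^ (1 / p) * (I ^ (1 / p)) ^ (p - 2) := by
          rw [← e1, ← ENNReal.rpow_mul, hqe]
          congr 1; field_simp
        rw [e1, e2, ENNReal.mul_rpow_of_nonneg _ _ (by linarith : (0 : ℝ) ≤ p - 2)]
        ring
    _ ≤ κ * B * (ENNReal.ofReal q ^ (p - 1) * (∫⁻ x, f x ^ p * v x ^ (1 - p) ∂m) ^ (1 / p) *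
          (ENNReal.ofReal p * (∫⁻ x, g x ^ q * v x ∂m) ^ (1 / q))) := by gcongr
    _ = _ := by ring

end Laminar

/-! ### Carleson tents as lenses, and laminar grids of them -/

/-- The part in the unit disc of a disc centred at `ζ`. -/
def lens (ζ : ℂ) (r : ℝ) : Set ℂ := Metric.ball ζ r ∩ disc

theorem measurableSet_disc : MeasurableSet disc := measurableSet_ball

theorem measurableSet_lens (ζ : ℂ) (r : ℝ) : MeasurableSet (lens ζ r) :=
  measurableSet_ball.inter measurableSet_disc

theorem mem_disc {z : ℂ} : z ∈ disc ↔ ‖z‖ < 1 := by simp [disc]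

theorem mem_lens {ζ w : ℂ} {r : ℝ} : w ∈ lens ζ r ↔ ‖w - ζ‖ < r ∧ ‖w‖ < 1 := by
  simp [lens, mem_disc, dist_eq_norm]

/-- A unimodular ζ satisfies ζ̄ζ = 1, so the quantity defining tents is a Euclidean distance and
every tent with nonzero vertex is the part in the unit disc of a disc centred on the circle. -/
theorem norm_one_sub_conj_mul {ζ : ℂ} (hζ : ‖ζ‖ = 1) (w : ℂ) : ‖1 - conj w * ζ‖ = ‖w - ζ‖ := by
  have h : conj ζ * ζ = 1 := by
    rw [← Complex.normSq_eq_conj_mul_self, Complex.normSq_eq_norm_sq, hζ]; simp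
  have : 1 - conj w * ζ = conj (ζ - w) * ζ := by rw [map_sub, sub_mul, h]
  rw [this, norm_mul, hζ, RCLike.norm_conj, mul_one, norm_sub_rev]

theorem tent_of_ne_zero {z : ℂ} (hz : z ≠ 0) : tent z = lens (z / (‖z‖ : ℂ)) (1 - ‖z‖) := by
  have h1 : ‖z / (‖z‖ : ℂ)‖ = 1 := by simp [hz]
  ext w
  rw [tent, if_neg hz, mem_lens, mem_ofPred_eq, norm_one_sub_conj_mul h1, mem_disc, and_comm]

theorem tent_eq_lens {ζ : ℂ} (hζ : ‖ζ‖ = 1) {r : ℝ} (hr : r < 1) :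
    tent (((1 - r : ℝ) : ℂ) * ζ) = lens ζ r := by
  have hn : ‖((1 - r : ℝ) : ℂ) * ζ‖ = 1 - r := by
    rw [norm_mul, hζ, Complex.norm_real, Real.norm_of_nonneg (by linarith), mul_one]
  have h0 : ((1 - r : ℝ) : ℂ) ≠ 0 := by exact_mod_cast (by linarith : (1 - r : ℝ) ≠ 0)
  rw [tent_of_ne_zero (norm_pos_iff.mp (by rw [hn]; linarith)), hn, mul_div_cancel_left₀ _ h0,
    sub_sub_cancel]

theorem measurableSet_tent (z : ℂ) : MeasurableSet (tent z) := by
  rcases eq_or_ne z 0 with rfl | hz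
  · simpa [tent] using measurableSet_disc
  · rw [tent_of_ne_zero hz]; exact measurableSet_lens _ _

theorem tent_subset_disc (z : ℂ) : tent z ⊆ disc := by
  rcases eq_or_ne z 0 with rfl | hz
  · simp [tent]
  · rw [tent_of_ne_zero hz]; exact inter_subset_right

theorem volume_ball_eq (a : ℂ) {r : ℝ} (hr : 0 ≤ r) :
    volume (Metric.ball a r) = ENNReal.ofReal (Real.pi * r ^ 2) := by
  rw [Complex.volume_ball, mul_comm, ENNReal.ofReal_mul Real.pi_pos.le, ENNReal.ofReal_pow hr]
  congr 1
  rw [← NNReal.coe_real_pi, ENNReal.ofReal_coe_nnreal]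

theorem volume_lens_le (ζ : ℂ) {r : ℝ} (hr : 0 ≤ r) :
    volume (lens ζ r) ≤ ENNReal.ofReal (Real.pi * r ^ 2) := by
  rw [← volume_ball_eq ζ hr]; exact measure_mono inter_subset_left

/-- The part of a lens at height comparable to its size. -/
def lensTop (ζ : ℂ) (r : ℝ) : Set ℂ := lens ζ r ∩ {w | r / 4 ≤ 1 - ‖w‖}

theorem measurableSet_lensTop (ζ : ℂ) (r : ℝ) : MeasurableSet (lensTop ζ r) :=
  (measurableSet_lens ζ r).inter
    (measurableSet_le measurable_const (measurable_const.sub measurable_norm))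

/-- Points of this ball have distance less than r/2 + r/4 from ζ and modulus less than 1 - r/2 +
r/4. The radius r/4 is the source of the constant 16 in the area comparisons. -/
theorem ball_subset_lensTop {ζ : ℂ} (hζ : ‖ζ‖ = 1) {r : ℝ} (hr : 0 < r) (hr1 : r ≤ 1) :
    Metric.ball (((1 - r / 2 : ℝ) : ℂ) * ζ) (r / 4) ⊆ lensTop ζ r := by
  intro w hw
  rw [Metric.mem_ball, dist_eq_norm] at hw
  have h1 : ‖((1 - r / 2 : ℝ) : ℂ) * ζ‖ = 1 - r / 2 := by
    rw [norm_mul, hζ, Complex.norm_real, Real.norm_of_nonneg (by linarith), mul_one]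
  have h2 : ‖((1 - r / 2 : ℝ) : ℂ) * ζ - ζ‖ = r / 2 := by
    rw [show ((1 - r / 2 : ℝ) : ℂ) * ζ - ζ = ((-(r / 2) : ℝ) : ℂ) * ζ by push_cast; ring,
      norm_mul, hζ, Complex.norm_real, norm_neg, Real.norm_of_nonneg (by linarith), mul_one]
  have h3 : ‖w - ζ‖ ≤ ‖w - ((1 - r / 2 : ℝ) : ℂ) * ζ‖ + ‖((1 - r / 2 : ℝ) : ℂ) * ζ - ζ‖ :=
    norm_sub_le_norm_sub_add_norm_sub _ _ _
  have h4 : ‖w‖ ≤ ‖w - ((1 - r / 2 : ℝ) : ℂ) * ζ‖ + ‖((1 - r / 2 : ℝ) : ℂ) * ζ‖ := by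
    simpa using norm_add_le (w - ((1 - r / 2 : ℝ) : ℂ) * ζ) (((1 - r / 2 : ℝ) : ℂ) * ζ)
  refine ⟨mem_lens.mpr ⟨by linarith, by linarith⟩, ?_⟩
  change r / 4 ≤ 1 - ‖w‖
  linarith

theorem volume_lens_le_lensTop {ζ : ℂ} (hζ : ‖ζ‖ = 1) {r : ℝ} (hr : 0 < r) (hr1 : r ≤ 1) :
    volume (lens ζ r) ≤ 16 * volume (lensTop ζ r) := by
  calc volume (lens ζ r) ≤ ENNReal.ofReal (Real.pi * r ^ 2) := volume_lens_le ζ hr.le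
    _ = 16 * ENNReal.ofReal (Real.pi * (r / 4) ^ 2) := by
        rw [← ENNReal.ofReal_ofNat 16, ← ENNReal.ofReal_mul (by norm_num)]
        congr 1; ring
    _ ≤ _ := by
        rw [← volume_ball_eq (((1 - r / 2 : ℝ) : ℂ) * ζ) (by linarith)]
        gcongr
        exact ball_subset_lensTop hζ hr hr1

theorem le_volume_lens {ζ : ℂ} (hζ : ‖ζ‖ = 1) {r : ℝ} (hr : 0 < r) (hr1 : r ≤ 1) :
    ENNReal.ofReal (Real.pi * r ^ 2 / 16) ≤ volume (lens ζ r) := by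
  rw [show Real.pi * r ^ 2 / 16 = Real.pi * (r / 4) ^ 2 by ring,
    ← volume_ball_eq (((1 - r / 2 : ℝ) : ℂ) * ζ) (by linarith)]
  exact measure_mono ((ball_subset_lensTop hζ hr hr1).trans inter_subset_left)

/-! ### The 8-adic grid of arcs and its lenses -/

/-- The length of the chord of the unit circle over an arc of length `x`. -/
def chord (x : ℝ) : ℝ := 2 * Real.sin (x / 2)

theorem norm_exp_sub_exp (a b : ℝ) :
    ‖Complex.exp (Complex.I * a) - Complex.exp (Complex.I * b)‖ = |chord (a - b)| := by
  have h : Complex.exp (Complex.I * a) - Complex.exp (Complex.I * b) =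
      Complex.exp (Complex.I * b) * (Complex.exp (Complex.I * ((a - b : ℝ) : ℂ)) - 1) := by
    rw [mul_sub, ← Complex.exp_add, mul_one]
    congr 2; push_cast; ring
  rw [h, norm_mul, Complex.norm_exp_I_mul_ofReal_sub_one, mul_comm Complex.I,
    Complex.norm_exp_ofReal_mul_I, one_mul]
  rfl

theorem chord_le {x : ℝ} (hx : 0 ≤ x) : chord x ≤ x := by
  have := Real.sin_le (x := x / 2) (by linarith)
  unfold chord; linarith

/-- The derivative cos(t/2) is at least 7/8 on [0, 1]. Gaps between angles thus survive, up to the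
factor 3/4, as gaps between distances. -/
theorem chord_sub_ge {x y : ℝ} (hx : 0 ≤ x) (hxy : x ≤ y) (hy : y ≤ 1) :
    3 / 4 * (y - x) ≤ chord y - chord x := by
  have hd : ∀ t, HasDerivAt chord (Real.cos (t / 2)) t := by
    intro t
    have := ((Real.hasDerivAt_sin (t / 2)).comp t ((hasDerivAt_id t).div_const 2)).const_mul 2
    exact this.congr_deriv (by ring)
  refine (convex_Icc (0 : ℝ) 1).mul_sub_le_image_sub_of_le_deriv
    (fun t _ => (hd t).continuousAt.continuousWithinAt)
    (fun t _ => (hd t).differentiableAt.differentiableWithinAt) ?_ x ⟨hx, hxy.trans hy⟩ y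
    ⟨hx.trans hxy, hy⟩ hxy
  intro t ht
  rw [interior_Icc] at ht
  rw [(hd t).deriv]
  have := Real.one_sub_sq_div_two_le_cos (x := t / 2)
  nlinarith [ht.1, ht.2]

theorem chord_mono {x y : ℝ} (hx : 0 ≤ x) (hxy : x ≤ y) (hy : y ≤ Real.pi) :
    chord x ≤ chord y := by
  have := Real.sin_le_sin_of_le_of_le_pi_div_two (x := x / 2) (y := y / 2) (by linarith [Real.pi_pos])
    (by linarith) (by linarith)
  unfold chord; linarith

theorem chord_zero : chord 0 = 0 := by simp [chord]

theorem chord_abs {x : ℝ} (hx : |x| ≤ Real.pi) : |chord x| = chord |x| := by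
  rcases abs_cases x with ⟨h, h0⟩ | ⟨h, h0⟩ <;> rw [h] at hx ⊢
  · exact abs_of_nonneg (by simpa [chord_zero] using chord_mono le_rfl h0 hx)
  · rw [← abs_neg, show -chord x = chord (-x) by simp [chord, neg_div]]
    exact abs_of_nonneg (by simpa [chord_zero] using chord_mono le_rfl (by linarith) hx)

/-- Length of the arcs of generation `k` of the `8`-adic grid on the circle. -/
def cell (k : ℕ) : ℝ := 2 * Real.pi / 8 ^ (k + 1)

theorem cell_pos (k : ℕ) : 0 < cell k := by unfold cell; positivity

/-- The largest cell has length π/4, so all radii and gaps stay in the range [0, 1] where chords are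
nearly linear. -/
theorem cell_le (k : ℕ) : cell k ≤ 4 / 5 := by
  have h : (8 : ℝ) ≤ 8 ^ (k + 1) := by
    have := pow_le_pow_right₀ (by norm_num : (1 : ℝ) ≤ 8) (show 1 ≤ k + 1 by omega)
    simpa using this
  unfold cell
  rw [div_le_iff₀ (by positivity)]
  nlinarith [Real.pi_lt_d2]

/-- Midpoint of the `j`-th arc of generation `k` of the grid rotated by `2πs`. -/
def gridAngle (s : ℝ) (k : ℕ) (j : ℤ) : ℝ := cell k * (j + 1 / 2) + 2 * Real.pi * s

/-- The centre of the `j`-th lens of generation `k`. -/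
def gridCenter (s : ℝ) (k : ℕ) (j : ℤ) : ℂ := Complex.exp (Complex.I * (gridAngle s k j : ℝ))

/-- The radius of the lenses of generation `k`. -/
def gridRadius (k : ℕ) : ℝ := chord (3 / 8 * cell k)

theorem norm_gridCenter (s : ℝ) (k : ℕ) (j : ℤ) : ‖gridCenter s k j‖ = 1 := by
  rw [gridCenter, mul_comm, Complex.norm_exp_ofReal_mul_I]

theorem gridRadius_pos (k : ℕ) : 0 < gridRadius k := by
  have := chord_sub_ge le_rfl (by linarith [cell_pos k] : (0 : ℝ) ≤ 3 / 8 * cell k)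
    (by linarith [cell_le k])
  rw [chord_zero] at this
  unfold gridRadius
  linarith [cell_pos k]

theorem gridRadius_le (k : ℕ) : gridRadius k ≤ 3 / 8 * cell k :=
  chord_le (by linarith [cell_pos k])

theorem gridRadius_lt_half (k : ℕ) : gridRadius k < 1 / 2 := by
  linarith [gridRadius_le k, cell_le k]

theorem cell_mul_pow (k n : ℕ) : cell k = cell (k + n) * 8 ^ n := by
  unfold cell
  rw [show k + n + 1 = (k + 1) + n by ring, pow_add (8 : ℝ) (k + 1) n]
  field_simp

theorem two_pi_eq (k : ℕ) : 2 * Real.pi = cell k * 8 ^ (k + 1) := by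
  unfold cell; field_simp

theorem gridCenter_add (s : ℝ) (k : ℕ) (j m : ℤ) :
    gridCenter s k (j + 8 ^ (k + 1) * m) = gridCenter s k j := by
  unfold gridCenter
  rw [Complex.exp_eq_exp_iff_exists_int]
  refine ⟨m, ?_⟩
  have : gridAngle s k (j + 8 ^ (k + 1) * m) = gridAngle s k j + m * (2 * Real.pi) := by
    unfold gridAngle
    rw [two_pi_eq k]; push_cast; ring
  rw [this]; push_cast; ring

/-- After translating by a multiple of the period, two centres are at angular distance at most
`π`, so that their distance is a chord. -/
theorem exists_gridAngle_sub_le (s : ℝ) (k k' : ℕ) (j j' : ℤ) : ∃ m : ℤ,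
    |gridAngle s k j - gridAngle s k' (j' + 8 ^ (k' + 1) * m)| ≤ Real.pi ∧
    ‖gridCenter s k' j' - gridCenter s k j‖ =
      chord |gridAngle s k j - gridAngle s k' (j' + 8 ^ (k' + 1) * m)| := by
  set x := (gridAngle s k j - gridAngle s k' j') / (2 * Real.pi) with hx
  have hπ := Real.pi_pos
  have h1 : gridAngle s k j - gridAngle s k' (j' + 8 ^ (k' + 1) * round x) =
      (x - round x) * (2 * Real.pi) := by
    have h2 : gridAngle s k' (j' + 8 ^ (k' + 1) * round x) =
        gridAngle s k' j' + round x * (2 * Real.pi) := by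
      unfold gridAngle
      rw [two_pi_eq k']; push_cast; ring
    rw [h2, sub_mul, hx]
    field_simp
    ring
  have h3 : |gridAngle s k j - gridAngle s k' (j' + 8 ^ (k' + 1) * round x)| ≤ Real.pi := by
    rw [h1, abs_mul, abs_of_pos (by positivity : 0 < 2 * Real.pi)]
    nlinarith [abs_sub_round x]
  refine ⟨round x, h3, ?_⟩
  rw [← gridCenter_add s k' j' (round x), norm_sub_rev, gridCenter, gridCenter, norm_exp_sub_exp,
    chord_abs h3]

theorem lens_subset_lens {ζ ζ' : ℂ} {r r' : ℝ} (h : ‖ζ' - ζ‖ + r' ≤ r) :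
    lens ζ' r' ⊆ lens ζ r := by
  intro w hw
  rw [mem_lens] at hw ⊢
  refine ⟨?_, hw.2⟩
  have : ‖w - ζ‖ ≤ ‖w - ζ'‖ + ‖ζ' - ζ‖ := norm_sub_le_norm_sub_add_norm_sub _ _ _
  linarith [hw.1]

theorem disjoint_lens {ζ ζ' : ℂ} {r r' : ℝ} (h : r + r' ≤ ‖ζ' - ζ‖) :
    Disjoint (lens ζ r) (lens ζ' r') := by
  rw [Set.disjoint_left]
  intro w hw hw'
  rw [mem_lens] at hw hw'
  have : ‖ζ' - ζ‖ ≤ ‖ζ' - w‖ + ‖w - ζ‖ := norm_sub_le_norm_sub_add_norm_sub _ _ _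
  rw [norm_sub_rev ζ' w] at this
  linarith [hw.1, hw'.1]

/-- In units u of the finer cell, the coarse half-width 3/8 is the integer 3·8ⁿ while the distance
between centres is a half-integer. The finer centre is therefore at least u/2 away from the edge of
the coarse arc. The corresponding chord gap is at least (3/4)(u/2) = 3u/8, which is at least the
finer radius, so the finer lens lies entirely on one side. Lenses over full cells would leave no
slack for curvature. -/
theorem gridLens_nested_or_disjoint (s : ℝ) (k n : ℕ) (j j' : ℤ) :
    Disjoint (lens (gridCenter s k j) (gridRadius k))
      (lens (gridCenter s (k + (n + 1)) j') (gridRadius (k + (n + 1)))) ∨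
    lens (gridCenter s (k + (n + 1)) j') (gridRadius (k + (n + 1))) ⊆
      lens (gridCenter s k j) (gridRadius k) := by
  obtain ⟨m, hm, hdist⟩ := exists_gridAngle_sub_le s k (k + (n + 1)) j j'
  set u := cell (k + (n + 1)) with hu
  have hu0 : 0 < u := cell_pos _
  have hcell : cell k = u * (8 * 8 ^ n) := by rw [cell_mul_pow k (n + 1)]; ring
  have hck := cell_le k
  -- The summand 4·8ⁿ is the offset of the coarse midpoint; the finer midpoint contributes the 1/2
  -- that keeps Y - 1/2 off the integers.
  set Y : ℤ := 8 * 8 ^ n * j - (j' + 8 ^ (k + (n + 1) + 1) * m) + 4 * 8 ^ n with hY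
  have hang : gridAngle s k j - gridAngle s (k + (n + 1)) (j' + 8 ^ (k + (n + 1) + 1) * m) =
      u * (Y - 1 / 2) := by
    unfold gridAngle
    rw [hcell, ← hu, hY]; push_cast; ring
  rw [hang, abs_mul, abs_of_pos hu0] at hm hdist
  have hn1 : (1 : ℝ) ≤ 8 ^ n := one_le_pow₀ (by norm_num)
  have hθ : 3 / 8 * cell k = u * (3 * 8 ^ n) := by rw [hcell]; ring
  have hrJ : gridRadius (k + (n + 1)) ≤ 3 / 8 * u := gridRadius_le _
  have hrI : gridRadius k = chord (u * (3 * 8 ^ n)) := by rw [gridRadius, hθ]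
  have hcase : |(Y : ℝ) - 1 / 2| + 1 / 2 ≤ 3 * 8 ^ n ∨ 3 * 8 ^ n + 1 / 2 ≤ |(Y : ℝ) - 1 / 2| := by
    rcases le_or_gt Y 0 with h0 | h0
    · have h0' : (Y : ℝ) ≤ 0 := by exact_mod_cast h0
      rw [abs_of_nonpos (by linarith)]
      rcases le_or_gt (-(3 * 8 ^ n) + 1) Y with h | h
      · left
        have : (-(3 * 8 ^ n) + 1 : ℝ) ≤ Y := by exact_mod_cast h
        linarith
      · right
        have : Y ≤ -(3 * 8 ^ n) := by omega
        have : (Y : ℝ) ≤ -(3 * 8 ^ n) := by exact_mod_cast this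
        linarith
    · have h0' : (1 : ℝ) ≤ Y := by exact_mod_cast h0
      rw [abs_of_nonneg (by linarith)]
      rcases le_or_gt Y (3 * 8 ^ n) with h | h
      · left
        have : (Y : ℝ) ≤ (3 * 8 ^ n) := by exact_mod_cast h
        linarith
      · right
        have : (3 * 8 ^ n + 1 : ℤ) ≤ Y := h
        have : (3 * 8 ^ n + 1 : ℝ) ≤ Y := by exact_mod_cast this
        linarith
  have hu1 : u * (3 * 8 ^ n) + u / 2 ≤ 1 := by
    rw [← hθ]
    have : u ≤ cell k := by rw [hcell]; nlinarith
    linarith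
  rcases hcase with h | h
  · right
    apply lens_subset_lens
    rw [hdist, hrI]
    have := chord_sub_ge (x := u * |(Y : ℝ) - 1 / 2|) (y := u * (3 * 8 ^ n)) (by positivity)
      (by nlinarith) (by linarith)
    nlinarith
  · left
    apply disjoint_lens
    rw [hdist, hrI]
    have h1 := chord_mono (x := u * (3 * 8 ^ n) + u / 2) (y := u * |(Y : ℝ) - 1 / 2|) (by positivity)
      (by nlinarith) hm
    have h2 := chord_sub_ge (x := u * (3 * 8 ^ n)) (y := u * (3 * 8 ^ n) + u / 2) (by positivity)
      (by linarith) hu1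
    nlinarith

/-- Distinct centres are at least one cell apart, hence at chordal distance at least 3/4 of a cell,
and each of the two radii is at most 3/8 of a cell. -/
theorem gridLens_disjoint (s : ℝ) (k : ℕ) {j j' : ℤ} (h : ∀ m : ℤ, j ≠ j' + 8 ^ (k + 1) * m) :
    Disjoint (lens (gridCenter s k j) (gridRadius k))
      (lens (gridCenter s k j') (gridRadius k)) := by
  obtain ⟨m, hm, hdist⟩ := exists_gridAngle_sub_le s k k j j'
  have hu0 : 0 < cell k := cell_pos _
  have hck := cell_le k
  set Y : ℤ := j - (j' + 8 ^ (k + 1) * m) with hY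
  have hang : gridAngle s k j - gridAngle s k (j' + 8 ^ (k + 1) * m) = cell k * Y := by
    unfold gridAngle
    rw [hY]; push_cast; ring
  rw [hang, abs_mul, abs_of_pos hu0] at hm hdist
  have hY1 : (1 : ℝ) ≤ |(Y : ℝ)| := by
    have : Y ≠ 0 := fun h0 => h m (by omega)
    exact_mod_cast Int.one_le_abs this
  apply disjoint_lens
  rw [hdist]
  have h1 := chord_mono (x := cell k) (y := cell k * |(Y : ℝ)|) hu0.le (by nlinarith) hm
  have h2 := chord_sub_ge le_rfl hu0.le (by linarith)
  rw [chord_zero] at h2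
  linarith [gridRadius_le k]

/-- Indices of the lenses in a grid. -/
abbrev GridIndex := Σ k : ℕ, Fin (8 ^ (k + 1))

/-- The lenses of the grid rotated by `2πs`. -/
def gridLens (s : ℝ) (i : GridIndex) : Set ℂ := lens (gridCenter s i.1 (i.2 : ℤ)) (gridRadius i.1)

/-- The upper parts of the lenses of the grid rotated by `2πs`. -/
def gridTop (s : ℝ) (i : GridIndex) : Set ℂ :=
  lensTop (gridCenter s i.1 (i.2 : ℤ)) (gridRadius i.1)

theorem fin_ne_add_mul {N : ℕ} {a b : Fin N} (h : a ≠ b) (m : ℤ) :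
    (a : ℤ) ≠ b + (N : ℤ) * m := by
  intro hab
  apply h
  have h1 : (a : ℤ) % N = (b : ℤ) % N := by rw [hab, Int.add_mul_emod_self_left]
  rw [Int.emod_eq_of_lt (by positivity) (by exact_mod_cast a.2),
    Int.emod_eq_of_lt (by positivity) (by exact_mod_cast b.2)] at h1
  exact Fin.ext (by exact_mod_cast h1)

theorem gridLens_disjoint_of_ne (s : ℝ) {k : ℕ} {a b : Fin (8 ^ (k + 1))} (h : a ≠ b) :
    Disjoint (gridLens s ⟨k, a⟩) (gridLens s ⟨k, b⟩) :=
  gridLens_disjoint s k fun m => by simpa using fin_ne_add_mul h m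

theorem isLaminar_gridLens (s : ℝ) : IsLaminar (gridLens s) := by
  rintro ⟨k, a⟩ ⟨k', b⟩
  rcases lt_trichotomy k k' with h | rfl | h
  · obtain ⟨n, rfl⟩ := Nat.exists_eq_add_of_lt h
    rcases gridLens_nested_or_disjoint s k n a b with h | h
    · exact Or.inl h
    · exact Or.inr (Or.inr h)
  · by_cases hab : a = b
    · subst hab; exact Or.inr (Or.inl subset_rfl)
    · exact Or.inl (gridLens_disjoint_of_ne s hab)
  · obtain ⟨n, rfl⟩ := Nat.exists_eq_add_of_lt h
    rcases gridLens_nested_or_disjoint s k' n b a with h | h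
    · exact Or.inl h.symm
    · exact Or.inr (Or.inl h)

theorem gridRadius_add_le (k n : ℕ) : gridRadius (k + n + 1) ≤ gridRadius k / 4 := by
  have h1 := gridRadius_le (k + n + 1)
  have h2 := chord_sub_ge le_rfl (by linarith [cell_pos k] : (0 : ℝ) ≤ 3 / 8 * cell k)
    (by linarith [cell_le k])
  rw [chord_zero] at h2
  have h3 : cell k = cell (k + n + 1) * 8 ^ (n + 1) := cell_mul_pow k (n + 1)
  have h4 : (8 : ℝ) ≤ 8 ^ (n + 1) := by
    rw [pow_succ]; nlinarith [one_le_pow₀ (by norm_num : (1 : ℝ) ≤ 8) (n := n)]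
  have h5 := cell_pos (k + n + 1)
  have h6 : gridRadius k = chord (3 / 8 * cell k) := rfl
  nlinarith

/-- A point of the smaller lens has height 1 - |w| below r', while the top requires height at least
r/4. -/
theorem disjoint_lensTop {ζ ζ' : ℂ} (hζ' : ‖ζ'‖ = 1) {r r' : ℝ} (h : r' ≤ r / 4) :
    Disjoint (lensTop ζ r) (lensTop ζ' r') := by
  rw [Set.disjoint_left]
  rintro w ⟨-, hw⟩ ⟨hw', -⟩
  have hw : r / 4 ≤ 1 - ‖w‖ := hw
  have h1 := (mem_lens.mp hw').1
  have h2 : ‖ζ'‖ ≤ ‖ζ' - w‖ + ‖w‖ := by simpa using norm_add_le (ζ' - w) w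
  rw [norm_sub_rev] at h2
  linarith

theorem pairwise_disjoint_gridTop (s : ℝ) :
    Pairwise fun i j => Disjoint (gridTop s i) (gridTop s j) := by
  rintro ⟨k, a⟩ ⟨k', b⟩ hne
  rcases lt_trichotomy k k' with h | rfl | h
  · obtain ⟨n, rfl⟩ := Nat.exists_eq_add_of_lt h
    exact disjoint_lensTop (norm_gridCenter _ _ _) (gridRadius_add_le k n)
  · have hab : a ≠ b := fun h => hne (by rw [h])
    exact (gridLens_disjoint_of_ne s hab).mono inter_subset_left inter_subset_left
  · obtain ⟨n, rfl⟩ := Nat.exists_eq_add_of_lt h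
    exact (disjoint_lensTop (norm_gridCenter _ _ _) (gridRadius_add_le k' n)).symm

/-- Every real number is well inside a cell of one of two shifted integer grids. -/
theorem exists_shift_near (y : ℝ) (n : ℕ) : ∃ s : ℝ, (s = 0 ∨ s = 1 / 3) ∧ ∃ j : ℤ,
    |y - 8 ^ n * s - (j + 1 / 2)| ≤ 1 / 3 := by
  -- The number 8ⁿ/3 has fractional part 1/3 or 2/3 at every scale, so a single rotation by one
  -- third moves points near cell boundaries well inside cells in all generations at once.
  obtain ⟨a, b, hb, hab⟩ : ∃ a : ℤ, ∃ b : ℝ, (b = 1 / 3 ∨ b = 2 / 3) ∧ (8 : ℝ) ^ n * (1 / 3) = a + b := by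
    induction n with
    | zero => exact ⟨0, 1 / 3, Or.inl rfl, by norm_num⟩
    | succ n ih =>
      obtain ⟨a, b, hb | hb, hab⟩ := ih
      · exact ⟨8 * a + 2, 2 / 3, Or.inr rfl, by
          rw [pow_succ, mul_assoc, mul_comm (8 : ℝ), ← mul_assoc, hab, hb]; push_cast; ring⟩
      · exact ⟨8 * a + 5, 1 / 3, Or.inl rfl, by
          rw [pow_succ, mul_assoc, mul_comm (8 : ℝ), ← mul_assoc, hab, hb]; push_cast; ring⟩
  have hf0 := Int.floor_le y
  have hf1 := Int.lt_floor_add_one y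
  by_cases h1 : y - ⌊y⌋ < 1 / 6
  · refine ⟨1 / 3, Or.inr rfl, ⌊y⌋ - a - 1, ?_⟩
    rw [hab, abs_le]; push_cast
    rcases hb with rfl | rfl <;> constructor <;> linarith
  by_cases h2 : 5 / 6 < y - ⌊y⌋
  · refine ⟨1 / 3, Or.inr rfl, ⌊y⌋ - a, ?_⟩
    rw [hab, abs_le]
    push_cast
    rcases hb with rfl | rfl <;> constructor <;> linarith
  · refine ⟨0, Or.inl rfl, ⌊y⌋, ?_⟩
    rw [abs_le]
    constructor <;> linarith

/-- The one-third trick on the circle: in one of the two grids arg z lies within 1/3 of a cell from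
a centre. The lens reaches out to 3/8 of a cell, which leaves room for the height of z and for the
distance from z to w. -/
theorem exists_mem_gridLens {z w : ℂ} (hz : ‖z‖ < 1) (hw : ‖w‖ < 1) {d : ℝ} (hz1 : 1 - ‖z‖ ≤ d)
    (hzw : ‖z - w‖ ≤ d) {k : ℕ} (hd : d ≤ 1 / (16 * 8 ^ (k + 1))) :
    ∃ s : ℝ, (s = 0 ∨ s = 1 / 3) ∧ ∃ a : Fin (8 ^ (k + 1)),
      z ∈ gridLens s ⟨k, a⟩ ∧ w ∈ gridLens s ⟨k, a⟩ := by
  obtain ⟨s, hs, j, hj⟩ := exists_shift_near (z.arg / cell k) (k + 1)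
  refine ⟨s, hs, ?_⟩
  have hc0 := cell_pos k
  have hc1 := cell_le k
  have hdiff : |z.arg - gridAngle s k j| ≤ cell k / 3 := by
    have : z.arg - gridAngle s k j = cell k * (z.arg / cell k - 8 ^ (k + 1) * s - (j + 1 / 2)) := by
      unfold gridAngle
      rw [two_pi_eq k]; field_simp; ring
    rw [this, abs_mul, abs_of_pos hc0]
    nlinarith
  have hzc : ‖z - gridCenter s k j‖ ≤ d + chord (cell k / 3) := by
    have h1 : ‖Complex.exp (Complex.I * (z.arg : ℝ)) - gridCenter s k j‖ ≤ chord (cell k / 3) := by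
      rw [gridCenter, norm_exp_sub_exp, chord_abs (by linarith [Real.pi_gt_three])]
      exact chord_mono (abs_nonneg _) hdiff (by linarith [Real.pi_gt_three])
    have h2 : ‖z - Complex.exp (Complex.I * (z.arg : ℝ))‖ = 1 - ‖z‖ := by
      have h3 : z - Complex.exp (Complex.I * (z.arg : ℝ)) =
          ((‖z‖ - 1 : ℝ) : ℂ) * Complex.exp (Complex.I * (z.arg : ℝ)) := by
        push_cast
        rw [sub_mul, one_mul, mul_comm Complex.I, Complex.norm_mul_exp_arg_mul_I]
      rw [h3, norm_mul, mul_comm Complex.I, Complex.norm_exp_ofReal_mul_I, Complex.norm_real,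
        Real.norm_of_nonpos (by linarith)]
      ring
    have := norm_sub_le_norm_sub_add_norm_sub z (Complex.exp (Complex.I * (z.arg : ℝ)))
      (gridCenter s k j)
    linarith
  -- The chord gap between 1/3 and 3/8 of a cell is at least (3/4)(1/24) = 1/32 of a cell, and d is
  -- at most the cell divided by 32π.
  have hr : d + d + chord (cell k / 3) < gridRadius k := by
    have h1 := chord_sub_ge (x := cell k / 3) (y := 3 / 8 * cell k) (by linarith) (by linarith)
      (by linarith)
    have h2 : gridRadius k = chord (3 / 8 * cell k) := rfl
    have h3 : 1 / (16 * 8 ^ (k + 1)) * (32 * Real.pi) = cell k := by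
      unfold cell; field_simp; ring
    have h4 : (0 : ℝ) < 1 / (16 * 8 ^ (k + 1)) := by positivity
    nlinarith [Real.pi_gt_three]
  have hj' : gridCenter s k j = gridCenter s k (j % 8 ^ (k + 1)) := by
    rw [← gridCenter_add s k (j % 8 ^ (k + 1)) (j / 8 ^ (k + 1)), Int.emod_add_mul_ediv]
  have hpos : (0 : ℤ) < 8 ^ (k + 1) := by positivity
  have hb0 := Int.emod_nonneg j hpos.ne'
  have hb1 := Int.emod_lt_of_pos j hpos
  refine ⟨⟨(j % 8 ^ (k + 1)).toNat, by zify; rw [Int.toNat_of_nonneg hb0]; exact_mod_cast hb1⟩, ?_, ?_⟩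
  · simp only [gridLens]
    rw [Int.toNat_of_nonneg hb0, ← hj', mem_lens]
    refine ⟨?_, hz⟩
    have : 0 ≤ d := (norm_nonneg _).trans hzw
    linarith
  · simp only [gridLens]
    rw [Int.toNat_of_nonneg hb0, ← hj', mem_lens]
    refine ⟨?_, hw⟩
    have := norm_sub_le_norm_sub_add_norm_sub w z (gridCenter s k j)
    rw [norm_sub_rev w z] at this
    linarith

/-! ### The Bergman kernel of the disc and weighted bounds for its modulus -/

/-- The Bergman kernel of the unit disc. -/
def discKernel (z w : ℂ) : ℂ := ((Real.pi : ℂ) * (1 - z * conj w) ^ 2)⁻¹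

theorem measurable_discKernel : Measurable fun x : ℂ × ℂ => discKernel x.1 x.2 := by
  have : Measurable fun x : ℂ × ℂ => (1 - x.1 * conj x.2 : ℂ) := by
    apply Continuous.measurable
    fun_prop
  exact ((this.pow_const 2).const_mul _).inv

theorem one_sub_norm_le {z w : ℂ} (hw : ‖w‖ < 1) :
    1 - ‖z‖ ≤ ‖1 - z * conj w‖ := by
  have h1 : ‖(1 : ℂ)‖ - ‖z * conj w‖ ≤ ‖1 - z * conj w‖ := norm_sub_norm_le _ _
  rw [norm_one, norm_mul, RCLike.norm_conj] at h1
  nlinarith [norm_nonneg z, norm_nonneg w]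

/-- The difference of the squares is (1-|z|²)(1-|w|²). -/
theorem norm_sub_le_norm_one_sub {z w : ℂ} (hz : ‖z‖ < 1) (hw : ‖w‖ < 1) :
    ‖z - w‖ ≤ ‖1 - z * conj w‖ := by
  rw [← sq_le_sq₀ (norm_nonneg _) (norm_nonneg _), ← Complex.normSq_eq_norm_sq,
    ← Complex.normSq_eq_norm_sq]
  have h1 : Complex.normSq z < 1 := by rw [Complex.normSq_eq_norm_sq]; nlinarith [norm_nonneg z]
  have h2 : Complex.normSq w < 1 := by rw [Complex.normSq_eq_norm_sq]; nlinarith [norm_nonneg w]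
  have h3 : Complex.normSq (1 - z * conj w) - Complex.normSq (z - w) =
      (1 - Complex.normSq z) * (1 - Complex.normSq w) := by
    simp only [Complex.normSq_apply, Complex.sub_re, Complex.sub_im, Complex.mul_re,
      Complex.mul_im, Complex.conj_re, Complex.conj_im, Complex.one_re, Complex.one_im]
    ring
  nlinarith

theorem norm_discKernel (z w : ℂ) : ‖discKernel z w‖ = (Real.pi * ‖1 - z * conj w‖ ^ 2)⁻¹ := by
  rw [discKernel, norm_inv, norm_mul, norm_pow, Complex.norm_real,
    Real.norm_of_nonneg Real.pi_pos.le]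

theorem discKernel_conj (z w : ℂ) : conj (discKernel z w) = discKernel w z := by
  simp [discKernel, mul_comm]

/-- The positive dyadic kernel attached to a lens. -/
def lensKernel (s : ℝ) (i : GridIndex) (z w : ℂ) : ℝ≥0∞ :=
  (gridLens s i).indicator 1 z * (gridLens s i).indicator 1 w / volume (gridLens s i)

theorem measurableSet_gridLens (s : ℝ) (i : GridIndex) : MeasurableSet (gridLens s i) :=
  measurableSet_lens _ _

theorem volume_gridLens_ne_zero (s : ℝ) (i : GridIndex) : volume (gridLens s i) ≠ 0 := by
  have h := le_volume_lens (norm_gridCenter s i.1 (i.2 : ℤ)) (gridRadius_pos i.1)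
    (by linarith [gridRadius_lt_half i.1])
  intro h0
  have h' : volume (lens (gridCenter s i.1 (i.2 : ℤ)) (gridRadius i.1)) = 0 := h0
  rw [h', nonpos_iff_eq_zero, ENNReal.ofReal_eq_zero] at h
  have := gridRadius_pos i.1
  have : 0 < Real.pi * gridRadius i.1 ^ 2 / 16 := by positivity
  linarith

theorem volume_gridLens_le (s : ℝ) (i : GridIndex) :
    volume (gridLens s i) ≤ ENNReal.ofReal (Real.pi * gridRadius i.1 ^ 2) :=
  volume_lens_le _ (gridRadius_pos _).le

theorem volume_gridLens_ne_top (s : ℝ) (i : GridIndex) : volume (gridLens s i) ≠ ∞ :=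
  ne_top_of_le_ne_top ENNReal.ofReal_ne_top (volume_gridLens_le s i)

/-- The modulus of the Bergman kernel of the disc is dominated by positive dyadic kernels. -/
theorem enorm_discKernel_le {z w : ℂ} (hz : z ∈ disc) (hw : w ∈ disc) :
    ‖discKernel z w‖ₑ ≤ 10 ^ 5 * (1 + ∑' i, lensKernel 0 i z w + ∑' i, lensKernel (1 / 3) i z w) := by
  rw [mem_disc] at hz hw
  set d := ‖1 - z * conj w‖ with hd
  have h1 := one_sub_norm_le (z := z) hw
  have h2 := norm_sub_le_norm_one_sub hz hw
  rw [← hd] at h1 h2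
  have hd0 : 0 < d := by linarith
  have hπ := Real.pi_gt_three
  have hK : ‖discKernel z w‖ₑ = ENNReal.ofReal ((Real.pi * d ^ 2)⁻¹) := by
    rw [← ofReal_norm, norm_discKernel]
  by_cases hbig : 1 / (16 * 8 ^ (0 + 1)) < d
  · have h3 : (Real.pi * d ^ 2)⁻¹ ≤ 10 ^ 5 := by
      rw [inv_le_comm₀ (by positivity) (by norm_num)]
      nlinarith
    calc ‖discKernel z w‖ₑ ≤ 10 ^ 5 * 1 := by
          rw [hK, mul_one]
          exact (ENNReal.ofReal_le_ofReal h3).trans (by norm_num)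
      _ ≤ _ := by
          gcongr
          rw [add_assoc]; exact le_self_add
  · have hex : ∃ n : ℕ, 1 / (16 * 8 ^ (n + 1)) < d := by
      obtain ⟨n, hn⟩ := exists_pow_lt_of_lt_one hd0 (by norm_num : (1 / 8 : ℝ) < 1)
      refine ⟨n, lt_of_le_of_lt ?_ hn⟩
      rw [div_pow, one_pow]
      apply one_div_le_one_div_of_le (by positivity)
      rw [pow_succ]
      nlinarith [pow_pos (by norm_num : (0 : ℝ) < 8) n]
    classical
    -- The generation just before the first failure is the finest whose lenses can be guaranteed to
    -- hold both points, so their radius is comparable to d.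
    let n₀ := Nat.find hex
    have hn₀ : 1 / (16 * 8 ^ (n₀ + 1)) < d := Nat.find_spec hex
    have hn₁ : n₀ ≠ 0 := fun h => hbig (by rw [h] at hn₀; exact hn₀)
    obtain ⟨k, hk⟩ := Nat.exists_eq_succ_of_ne_zero hn₁
    have hk1 : d ≤ 1 / (16 * 8 ^ (k + 1)) :=
      not_lt.mp (Nat.find_min hex (show k < n₀ by omega))
    obtain ⟨s, hs, a, hza, hwa⟩ := exists_mem_gridLens hz hw h1 h2 hk1
    have hker : ‖discKernel z w‖ₑ ≤ 10 ^ 5 * lensKernel s ⟨k, a⟩ z w := by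
      rw [lensKernel, indicator_of_mem hza, indicator_of_mem hwa, hK, Pi.one_apply, Pi.one_apply,
        one_mul, ← mul_div_assoc, mul_one, ENNReal.le_div_iff_mul_le
          (Or.inl (volume_gridLens_ne_zero _ _)) (Or.inl (volume_gridLens_ne_top _ _))]
      refine (mul_le_mul_right (volume_gridLens_le _ _) _).trans ?_
      rw [← ENNReal.ofReal_mul (by positivity)]
      refine (ENNReal.ofReal_le_ofReal (?_ : _ ≤ (10 ^ 5 : ℝ))).trans (by norm_num)
      change (Real.pi * d ^ 2)⁻¹ * (Real.pi * gridRadius k ^ 2) ≤ 10 ^ 5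
      -- Since k + 1 violates the scale condition, the radius is at most 3/8 · 256π · d = 96π d. The
      -- constant 10⁵ then covers 316².
      have hr : gridRadius k ≤ 316 * d := by
        rw [hk] at hn₀
        have h3 : cell k = 2 * Real.pi * 128 * (1 / (16 * 8 ^ (k + 1 + 1))) := by
          unfold cell; rw [pow_succ (8 : ℝ) (k + 1)]; field_simp; norm_num
        have := gridRadius_le k
        rw [h3] at this
        have h4 : (0 : ℝ) < 1 / (16 * 8 ^ (k + 1 + 1)) := by positivity
        have h5 : 1 / (16 * 8 ^ (k + 1 + 1)) < d := hn₀
        generalize (1 : ℝ) / (16 * 8 ^ (k + 1 + 1)) = ε at *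
        nlinarith [mul_lt_mul_of_pos_right Real.pi_lt_d2 h4]
      have hr0 := gridRadius_pos k
      rw [mul_inv, mul_mul_mul_comm, inv_mul_cancel₀ (by positivity), one_mul, inv_mul_le_iff₀ (by positivity)]
      nlinarith
    refine hker.trans ?_
    gcongr
    rcases hs with rfl | rfl
    · exact (ENNReal.le_tsum (⟨k, a⟩ : GridIndex)).trans (le_add_self.trans le_self_add)
    · exact (ENNReal.le_tsum (⟨k, a⟩ : GridIndex)).trans le_add_self

/-! ### Positive forms and the one-variable weighted estimate -/

/-- `N` bounds the positive bilinear form with kernel `k` on `L^p(u) × L^q(v)`. -/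
def IsFormBound {X : Type*} [MeasurableSpace X] (m : Measure X) (k : X → X → ℝ≥0∞) (p q : ℝ)
    (u v : X → ℝ≥0∞) (N : ℝ≥0∞) : Prop :=
  ∀ f g : X → ℝ≥0∞, Measurable f → Measurable g →
    ∫⁻ z, ∫⁻ w, k z w * f w * g z ∂m ∂m ≤
      N * ((∫⁻ x, f x ^ p * u x ∂m) ^ (1 / p) * (∫⁻ x, g x ^ q * v x ∂m) ^ (1 / q))

/-- The sparse form over a grid of lenses. -/
def lensForm (s : ℝ) (f g : ℂ → ℝ≥0∞) : ℝ≥0∞ :=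
  ∑' i, (∫⁻ x in gridLens s i, f x) * (∫⁻ x in gridLens s i, g x) / volume (gridLens s i)

theorem lensForm_comm (s : ℝ) (f g : ℂ → ℝ≥0∞) : lensForm s f g = lensForm s g f := by
  simp only [lensForm, mul_comm]

theorem gridLens_subset_disc (s : ℝ) (i : GridIndex) : gridLens s i ⊆ disc := inter_subset_right

theorem setLIntegral_disc_indicator (s : ℝ) (i : GridIndex) (f : ℂ → ℝ≥0∞) :
    ∫⁻ x in disc, (gridLens s i).indicator f x = ∫⁻ x in gridLens s i, f x := by
  rw [lintegral_indicator (measurableSet_gridLens s i),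
    Measure.restrict_restrict (measurableSet_gridLens s i),
    inter_eq_left.mpr (gridLens_subset_disc s i)]

theorem lintegral_tsum_lensKernel (s : ℝ) {f g : ℂ → ℝ≥0∞} (hf : Measurable f)
    (hg : Measurable g) :
    ∫⁻ z in disc, ∫⁻ w in disc, (∑' i, lensKernel s i z w) * (f w * g z) = lensForm s f g := by
  have hS := measurableSet_gridLens s
  have h1 : ∀ z w, (∑' i, lensKernel s i z w) * (f w * g z) =
      ∑' i, (gridLens s i).indicator f w *
        ((gridLens s i).indicator g z / volume (gridLens s i)) := by
    intro z w
    rw [← ENNReal.tsum_mul_right]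
    congr 1
    ext i
    unfold lensKernel
    by_cases hz : z ∈ gridLens s i <;> by_cases hw : w ∈ gridLens s i <;>
      simp [hz, hw, div_eq_mul_inv]; ring
  simp_rw [h1]
  have h2 : ∀ z, ∫⁻ w in disc, ∑' i, (gridLens s i).indicator f w *
        ((gridLens s i).indicator g z / volume (gridLens s i)) =
      ∑' i, (∫⁻ x in gridLens s i, f x) *
        ((gridLens s i).indicator g z / volume (gridLens s i)) := by
    intro z
    rw [lintegral_tsum fun i => ((hf.indicator (hS i)).mul_const _).aemeasurable]
    congr 1
    ext i
    rw [lintegral_mul_const _ (hf.indicator (hS i)), setLIntegral_disc_indicator]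
  simp_rw [h2]
  rw [lintegral_tsum fun i => (((hg.indicator (hS i)).div_const _).const_mul _).aemeasurable]
  unfold lensForm
  congr 1
  ext i
  rw [lintegral_const_mul _ ((hg.indicator (hS i)).div_const _)]
  simp only [div_eq_mul_inv]
  rw [lintegral_mul_const _ (hg.indicator (hS i)), setLIntegral_disc_indicator]
  ring

theorem lintegral_lintegral_form_add {m : Measure ℂ} [SFinite m] {k₁ k₂ : ℂ × ℂ → ℝ≥0∞}
    (hk₂ : Measurable k₂) {f g : ℂ → ℝ≥0∞} (hf : Measurable f)
    (hg : Measurable g) :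
    ∫⁻ z, ∫⁻ w, (f w * g z + k₁ (z, w) * (f w * g z) + k₂ (z, w) * (f w * g z)) ∂m ∂m =
      (∫⁻ x, f x ∂m) * (∫⁻ x, g x ∂m) + ∫⁻ z, ∫⁻ w, k₁ (z, w) * (f w * g z) ∂m ∂m +
        ∫⁻ z, ∫⁻ w, k₂ (z, w) * (f w * g z) ∂m ∂m := by
  have hfg : Measurable fun x : ℂ × ℂ => f x.2 * g x.1 :=
    (hf.comp measurable_snd).mul (hg.comp measurable_fst)
  have h1 : Measurable fun x : ℂ × ℂ => k₂ x * (f x.2 * g x.1) := hk₂.mul hfg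
  have e0 : ∀ z, Measurable fun w => f w * g z := fun z => hf.mul_const _
  have e1 : ∀ z, Measurable fun w => k₂ (z, w) * (f w * g z) := fun z =>
    h1.comp measurable_prodMk_left
  have h2 : Measurable fun z => ∫⁻ w, k₂ (z, w) * (f w * g z) ∂m := h1.lintegral_prod_right'
  have h3 : ∀ z, ∫⁻ w, (f w * g z + k₁ (z, w) * (f w * g z) + k₂ (z, w) * (f w * g z)) ∂m =
      (∫⁻ w, f w ∂m) * g z + ∫⁻ w, k₁ (z, w) * (f w * g z) ∂m +
        ∫⁻ w, k₂ (z, w) * (f w * g z) ∂m := by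
    intro z
    rw [lintegral_add_right _ (e1 z), lintegral_add_left (e0 z), lintegral_mul_const _ hf]
  simp_rw [h3]
  rw [lintegral_add_right _ h2, lintegral_add_left (hg.const_mul _), lintegral_const_mul _ hg]

theorem measurable_tsum_lensKernel (s : ℝ) :
    Measurable fun x : ℂ × ℂ => ∑' i, lensKernel s i x.1 x.2 := by
  refine Measurable.tsum fun i => ?_
  exact ((((measurable_const (a := (1 : ℝ≥0∞))).indicator (measurableSet_gridLens s i)).comp
    measurable_fst).mul (((measurable_const (a := (1 : ℝ≥0∞))).indicator
      (measurableSet_gridLens s i)).comp measurable_snd)).div_const _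

theorem lintegral_discKernel_le {f g : ℂ → ℝ≥0∞} (hf : Measurable f) (hg : Measurable g) :
    ∫⁻ z in disc, ∫⁻ w in disc, ‖discKernel z w‖ₑ * f w * g z ≤
      10 ^ 5 * ((∫⁻ x in disc, f x) * (∫⁻ x in disc, g x) + lensForm 0 f g +
        lensForm (1 / 3) f g) := by
  rw [← lintegral_tsum_lensKernel 0 hf hg, ← lintegral_tsum_lensKernel (1 / 3) hf hg,
    ← lintegral_lintegral_form_add (k₁ := fun x => ∑' i, lensKernel 0 i x.1 x.2)
      (measurable_tsum_lensKernel (1 / 3)) hf hg, ← lintegral_const_mul' _ _ (by norm_num)]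
  refine setLIntegral_mono' measurableSet_disc fun z hz => ?_
  rw [← lintegral_const_mul' _ _ (by norm_num)]
  refine setLIntegral_mono' measurableSet_disc fun w hw => ?_
  rw [mul_assoc]
  refine (mul_le_mul_left (enorm_discKernel_le hz hw) _).trans (le_of_eq ?_)
  ring

/-- As q = 1 + 1/(p-1), this power is at most e. It absorbs the p-1 applications of the maximal
bound and keeps the final constant absolute. -/
theorem rpow_sub_one_le_three {p q : ℝ} (hpq : p.HolderConjugate q) :
    ENNReal.ofReal q ^ (p - 1) ≤ 3 := by
  have hp1 : 0 < p - 1 := sub_pos.mpr hpq.lt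
  have hq : q = 1 / (p - 1) + 1 := by
    have := hpq.mul_eq_add
    field_simp; linarith
  rw [ENNReal.ofReal_rpow_of_pos hpq.symm.pos]
  refine (ENNReal.ofReal_le_ofReal (?_ : _ ≤ (3 : ℝ))).trans (by norm_num)
  calc q ^ (p - 1) ≤ Real.exp (1 / (p - 1)) ^ (p - 1) := by
        apply Real.rpow_le_rpow hpq.symm.pos.le _ hp1.le
        rw [hq]; exact Real.add_one_le_exp _
    _ = Real.exp 1 := by rw [← Real.exp_mul]; congr 1; field_simp
    _ ≤ 3 := by linarith [Real.exp_one_lt_d9]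

/-- The sparse estimate with the tops of the lenses as disjoint pieces. The constant is 48 = 16 · 3:
area ratio of lens to top, times the bound for q^{p-1}; the remaining factor p is enlarged to pq. -/
theorem lensForm_le (s : ℝ) {p q : ℝ} (hpq : p.HolderConjugate q) (hp2 : 2 ≤ p)
    {u v : ℂ → ℝ≥0∞} (hv : Measurable v) (hv0 : ∀ x, v x ≠ 0) (hvt : ∀ x, v x ≠ ∞)
    (huv : ∀ x, u x = v x ^ (1 - p)) {B : ℝ≥0∞} (hB : B ≠ ∞)
    (hBS : ∀ ζ r, ‖ζ‖ = 1 → 0 < r → r < 1 / 2 →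
      (∫⁻ x in lens ζ r, u x) * (∫⁻ x in lens ζ r, v x) ^ (p - 1) ≤ B * volume (lens ζ r) ^ p)
    {f g : ℂ → ℝ≥0∞} (hf : Measurable f) (hg : Measurable g) :
    lensForm s f g ≤ 48 * ENNReal.ofReal (p * q) * B *
      ((∫⁻ x in disc, f x ^ p * u x) ^ (1 / p) * (∫⁻ x in disc, g x ^ q * v x) ^ (1 / q)) := by
  have hS := measurableSet_gridLens s
  have hres : ∀ i, (volume.restrict disc).restrict (gridLens s i) =
      volume.restrict (gridLens s i) := fun i => by
    rw [Measure.restrict_restrict (hS i), inter_eq_left.mpr (gridLens_subset_disc s i)]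
  have hvol : ∀ i, (volume.restrict disc) (gridLens s i) = volume (gridLens s i) := fun i => by
    rw [Measure.restrict_apply (hS i), inter_eq_left.mpr (gridLens_subset_disc s i)]
  have htop : ∀ i, gridTop s i ⊆ gridLens s i := fun i => inter_subset_left
  have hmt : ∀ i, MeasurableSet (gridTop s i) := fun i => measurableSet_lensTop _ _
  unfold lensForm
  rw [ENNReal.tsum_eq_iSup_sum]
  refine iSup_le fun F => ?_
  have := (isLaminar_gridLens s).sum_mul_div_le hS hmt htop (pairwise_disjoint_gridTop s)
    (m := volume.restrict disc) (κ := 16) (fun i => by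
      rw [hvol, Measure.restrict_apply (hmt i),
        inter_eq_left.mpr ((htop i).trans (gridLens_subset_disc s i))]
      exact volume_lens_le_lensTop (norm_gridCenter _ _ _) (gridRadius_pos _)
        (by linarith [gridRadius_lt_half i.1]))
    (fun i => by rw [hvol]; exact volume_gridLens_ne_zero s i)
    (fun i => by rw [hvol]; exact volume_gridLens_ne_top s i) hpq hp2 hv hv0 hvt hB
    (fun i => by
      rw [hvol, hres]
      simp_rw [← huv]
      exact hBS _ _ (norm_gridCenter _ _ _) (gridRadius_pos _) (gridRadius_lt_half _)) hf hg F
  simp_rw [hvol, hres, ← huv] at this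
  refine this.trans ?_
  gcongr 1
  calc 16 * B * (ENNReal.ofReal q ^ (p - 1) * ENNReal.ofReal p)
      ≤ 16 * B * (3 * ENNReal.ofReal (p * q)) := by
        gcongr
        · exact rpow_sub_one_le_three hpq
        · nlinarith [hpq.pos, hpq.symm.lt]
    _ = _ := by ring

/-- Hölder, after inserting 1 = u^{1/p} v^{1/q}. -/
theorem lintegral_le_mul_rpow {X : Type*} [MeasurableSpace X] {m : Measure X} {p q : ℝ}
    (hpq : p.HolderConjugate q) {u v : X → ℝ≥0∞} (hv : Measurable v) (hv0 : ∀ x, v x ≠ 0)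
    (hvt : ∀ x, v x ≠ ∞) (huv : ∀ x, u x = v x ^ (1 - p)) {f : X → ℝ≥0∞} (hf : Measurable f) :
    ∫⁻ x, f x ∂m ≤ (∫⁻ x, f x ^ p * u x ∂m) ^ (1 / p) * (∫⁻ x, v x ∂m) ^ (1 / q) := by
  have hp0 := hpq.pos
  have hq0 := hpq.symm.pos
  have hqp := hpq.mul_eq_add
  have hu : Measurable u := by
    rw [show u = fun x => v x ^ (1 - p) from funext huv]; exact hv.pow_const _
  have h := ENNReal.lintegral_mul_le_Lp_mul_Lq m hpq (f := fun x => f x * u x ^ (1 / p))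
    (g := fun x => v x ^ (1 / q)) (hf.mul (hu.pow_const _)).aemeasurable
    (hv.pow_const _).aemeasurable
  calc ∫⁻ x, f x ∂m = ∫⁻ x, ((fun x => f x * u x ^ (1 / p)) * fun x => v x ^ (1 / q)) x ∂m := by
        refine lintegral_congr fun x => ?_
        simp only [Pi.mul_apply]
        rw [huv, ← ENNReal.rpow_mul, mul_assoc, ← ENNReal.rpow_add _ _ (hv0 x) (hvt x)]
        rw [show (1 - p) * (1 / p) + 1 / q = 0 by field_simp; linarith, ENNReal.rpow_zero, mul_one]
    _ ≤ _ := h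
    _ = _ := by
        congr 2
        · refine lintegral_congr fun x => ?_
          rw [ENNReal.mul_rpow_of_nonneg _ _ hp0.le, ← ENNReal.rpow_mul, one_div_mul_cancel hp0.ne',
            ENNReal.rpow_one]
        · refine lintegral_congr fun x => ?_
          rw [← ENNReal.rpow_mul, one_div_mul_cancel hq0.ne', ENNReal.rpow_one]

/-- The one-variable weighted estimate for the positive Bergman operator of the disc. -/
theorem isFormBound_disc {p q : ℝ} (hpq : p.HolderConjugate q)
    {u v : ℂ → ℝ≥0∞} (hv : Measurable v) (hv0 : ∀ x, v x ≠ 0) (hvt : ∀ x, v x ≠ ∞)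
    (huv : ∀ x, u x = v x ^ (1 - p)) {A B : ℝ≥0∞} (hB : B ≠ ∞)
    (hA : (∫⁻ x in disc, u x) * (∫⁻ x in disc, v x) ^ (p - 1) ≤ A * volume disc ^ p)
    (hBS : ∀ ζ r, ‖ζ‖ = 1 → 0 < r → r < 1 / 2 →
      (∫⁻ x in lens ζ r, u x) * (∫⁻ x in lens ζ r, v x) ^ (p - 1) ≤ B * volume (lens ζ r) ^ p) :
    IsFormBound (volume.restrict disc) (fun z w => ‖discKernel z w‖ₑ) p q u v
      (10 ^ 7 * (A ^ (1 / p) + ENNReal.ofReal (p * q) * B ^ max 1 (1 / (p - 1)))) := by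
  intro f g hf hg
  have hp0 := hpq.pos
  have hq0 := hpq.symm.pos
  have hqp := hpq.mul_eq_add
  have hp1 : 0 < p - 1 := sub_pos.mpr hpq.lt
  have hq1 : 0 < q - 1 := sub_pos.mpr hpq.symm.lt
  have hqe : q - 1 = 1 / (p - 1) := by field_simp; linarith
  have hu : Measurable u := by
    rw [show u = fun x => v x ^ (1 - p) from funext huv]; exact hv.pow_const _
  have hvu : ∀ x, v x = u x ^ (1 - q) := fun x => by
    rw [huv, ← ENNReal.rpow_mul, show (1 - p) * (1 - q) = 1 by linarith, ENNReal.rpow_one]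
  have hu0 : ∀ x, u x ≠ 0 := fun x => by simp [huv, ENNReal.rpow_eq_zero_iff, hv0 x, hvt x]
  have hut : ∀ x, u x ≠ ∞ := fun x => by
    rw [huv]; exact ENNReal.rpow_ne_top_of_ne_zero (hv0 x) (hvt x)
  set N := (∫⁻ x in disc, f x ^ p * u x) ^ (1 / p) * (∫⁻ x in disc, g x ^ q * v x) ^ (1 / q)
    with hN
  have hform : ∀ s, lensForm s f g ≤
      48 * ENNReal.ofReal (p * q) * B ^ max 1 (1 / (p - 1)) * N := by
    intro s
    rcases le_total 2 p with hp2 | hp2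
    · have hm : max 1 (1 / (p - 1)) = 1 := by
        apply max_eq_left
        rw [div_le_one hp1]; linarith
      rw [hm, ENNReal.rpow_one]
      exact lensForm_le s hpq hp2 hv hv0 hvt huv hB hBS hf hg
    · have hm : max 1 (1 / (p - 1)) = q - 1 := by
        rw [hqe]
        apply max_eq_right
        rw [le_div_iff₀ hp1]; linarith
      have hq2 : 2 ≤ q := by
        have : 1 ≤ q - 1 := by rw [hqe, le_div_iff₀ hp1]; linarith
        linarith
      -- For p ≤ 2 the roles of (f, p, u) and (g, q, v) are exchanged. The characteristic for the
      -- exchanged pair is the old one to the power q - 1 = 1/(p-1), which accounts for the exponent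
      -- in the theorem.
      rw [hm, lensForm_comm, hN, mul_comm p q, mul_comm (_ ^ (1 / p))]
      refine lensForm_le s hpq.symm hq2 hu hu0 hut hvu
        (ENNReal.rpow_ne_top_of_nonneg hq1.le hB) (fun ζ r h1 h2 h3 => ?_) hg hf
      have h := ENNReal.rpow_le_rpow (hBS ζ r h1 h2 h3) hq1.le
      rw [ENNReal.mul_rpow_of_nonneg _ _ hq1.le, ENNReal.mul_rpow_of_nonneg _ _ hq1.le,
        ← ENNReal.rpow_mul, ← ENNReal.rpow_mul, show (p - 1) * (q - 1) = 1 by linarith,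
        show p * (q - 1) = q by linarith, ENNReal.rpow_one] at h
      rwa [mul_comm (∫⁻ x in lens ζ r, v x)]
  -- This is the contribution of the constant part of the kernel. It involves averages over the
  -- whole disc only, without the factor pq, and 4 is an upper bound for the area π.
  have hdisc : (∫⁻ x in disc, f x) * (∫⁻ x in disc, g x) ≤ 4 * A ^ (1 / p) * N := by
    have h1 := lintegral_le_mul_rpow (m := volume.restrict disc) hpq hv hv0 hvt huv hf
    have h2 := lintegral_le_mul_rpow (m := volume.restrict disc) hpq.symm hu hu0 hut hvu hg
    have h3 : (∫⁻ x in disc, u x) ^ (1 / p) * (∫⁻ x in disc, v x) ^ (1 / q) ≤ 4 * A ^ (1 / p) := by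
      have h := ENNReal.rpow_le_rpow hA (one_div_pos.mpr hp0).le
      rw [ENNReal.mul_rpow_of_nonneg _ _ (one_div_pos.mpr hp0).le,
        ENNReal.mul_rpow_of_nonneg _ _ (one_div_pos.mpr hp0).le,
        ← ENNReal.rpow_mul, ← ENNReal.rpow_mul, mul_one_div_cancel hp0.ne', ENNReal.rpow_one,
        show (p - 1) * (1 / p) = 1 / q by field_simp; linarith] at h
      refine h.trans ?_
      rw [mul_comm]
      gcongr
      rw [disc, volume_ball_eq _ zero_le_one]
      refine (ENNReal.ofReal_le_ofReal (?_ : _ ≤ (4 : ℝ))).trans (by norm_num)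
      linarith [Real.pi_lt_d2]
    calc _ ≤ ((∫⁻ x in disc, f x ^ p * u x) ^ (1 / p) * (∫⁻ x in disc, v x) ^ (1 / q)) *
          ((∫⁻ x in disc, g x ^ q * v x) ^ (1 / q) * (∫⁻ x in disc, u x) ^ (1 / p)) := by gcongr
      _ = ((∫⁻ x in disc, u x) ^ (1 / p) * (∫⁻ x in disc, v x) ^ (1 / q)) * N := by
          rw [hN]; ring
      _ ≤ _ := by gcongr
  refine (lintegral_discKernel_le hf hg).trans ?_
  calc _ ≤ 10 ^ 5 * (4 * A ^ (1 / p) * N + 48 * ENNReal.ofReal (p * q) * B ^ max 1 (1 / (p - 1)) * N +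
        48 * ENNReal.ofReal (p * q) * B ^ max 1 (1 / (p - 1)) * N) := by
        gcongr
        · exact hform 0
        · exact hform (1 / 3)
    _ = 10 ^ 5 * (4 * A ^ (1 / p) + 96 * (ENNReal.ofReal (p * q) * B ^ max 1 (1 / (p - 1)))) * N := by
        ring
    _ ≤ 10 ^ 5 * (100 * A ^ (1 / p) + 100 * (ENNReal.ofReal (p * q) * B ^ max 1 (1 / (p - 1)))) * N := by
        gcongr <;> norm_num
    _ = _ := by ring

/-! ### Tensor products and duality for bounds of positive forms -/

section Form

variable {X Y : Type*} [MeasurableSpace X] [MeasurableSpace Y]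

/-- With the second coordinates frozen, the first form is bounded by the product of the slice norms
F and G. The second form is then applied to F and G themselves. Positivity permits every exchange of
integrals, and the product weights make the iterated norms the norms on the product. -/
theorem IsFormBound.prod {m₁ : Measure X} {m₂ : Measure Y} [SFinite m₁] [SFinite m₂]
    {k₁ : X → X → ℝ≥0∞} {k₂ : Y → Y → ℝ≥0∞} (hk₁ : Measurable fun x : X × X => k₁ x.1 x.2)
    (hk₂ : Measurable fun x : Y × Y => k₂ x.1 x.2) {p q : ℝ} (hpq : p.HolderConjugate q)
    {u₁ v₁ : X → ℝ≥0∞} {u₂ v₂ : Y → ℝ≥0∞} (hu₁ : Measurable u₁) (hv₁ : Measurable v₁)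
    (hu₂ : Measurable u₂) (hv₂ : Measurable v₂)
    {N₁ N₂ : ℝ≥0∞} (h₁ : IsFormBound m₁ k₁ p q u₁ v₁ N₁) (h₂ : IsFormBound m₂ k₂ p q u₂ v₂ N₂) :
    IsFormBound (m₁.prod m₂) (fun z w => k₁ z.1 w.1 * k₂ z.2 w.2) p q
      (fun x => u₁ x.1 * u₂ x.2) (fun x => v₁ x.1 * v₂ x.2) (N₁ * N₂) := by
  intro f g hf hg
  set F : Y → ℝ≥0∞ := fun y => (∫⁻ x, f (x, y) ^ p * u₁ x ∂m₁) ^ (1 / p) with hF_def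
  set G : Y → ℝ≥0∞ := fun y => (∫⁻ x, g (x, y) ^ q * v₁ x ∂m₁) ^ (1 / q) with hG_def
  have hF : Measurable F := by
    refine Measurable.pow_const (Measurable.lintegral_prod_left'
      (f := fun z : X × Y => f z ^ p * u₁ z.1) ?_) _
    exact (hf.pow_const _).mul (hu₁.comp measurable_fst)
  have hG : Measurable G := by
    refine Measurable.pow_const (Measurable.lintegral_prod_left'
      (f := fun z : X × Y => g z ^ q * v₁ z.1) ?_) _
    exact (hg.pow_const _).mul (hv₁.comp measurable_fst)
  have hint : ∀ {r : ℝ}, 0 < r → ∀ {φ : X × Y → ℝ≥0∞} {ω₁ : X → ℝ≥0∞} {ω₂ : Y → ℝ≥0∞},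
      Measurable φ → Measurable ω₁ → Measurable ω₂ →
      ∫⁻ y, ((∫⁻ x, φ (x, y) ^ r * ω₁ x ∂m₁) ^ (1 / r)) ^ r * ω₂ y ∂m₂ =
        ∫⁻ z, φ z ^ r * (ω₁ z.1 * ω₂ z.2) ∂(m₁.prod m₂) := by
    intro r hr φ ω₁ ω₂ hφ hω₁ hω₂
    have hm : Measurable fun z : X × Y => φ z ^ r * (ω₁ z.1 * ω₂ z.2) := (hφ.pow_const _).mul
      ((hω₁.comp measurable_fst).mul (hω₂.comp measurable_snd))
    have hm' : ∀ y, Measurable fun x => φ (x, y) ^ r * ω₁ x := fun y =>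
      ((hφ.comp measurable_prodMk_right).pow_const _).mul hω₁
    rw [lintegral_prod_symm' _ hm]
    refine lintegral_congr fun y => ?_
    rw [← ENNReal.rpow_mul, one_div_mul_cancel hr.ne', ENNReal.rpow_one,
      ← lintegral_mul_const _ (hm' y)]
    refine lintegral_congr fun x => ?_
    ring
  have hK : Measurable fun t : (X × Y) × (X × Y) =>
      k₁ t.1.1 t.2.1 * k₂ t.1.2 t.2.2 * f t.2 * g t.1 := by
    have e1 : Measurable fun t : (X × Y) × (X × Y) => k₁ t.1.1 t.2.1 := hk₁.comp
      ((measurable_fst.comp measurable_fst).prodMk (measurable_fst.comp measurable_snd))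
    have e2 : Measurable fun t : (X × Y) × (X × Y) => k₂ t.1.2 t.2.2 := hk₂.comp
      ((measurable_snd.comp measurable_fst).prodMk (measurable_snd.comp measurable_snd))
    exact ((e1.mul e2).mul (hf.comp measurable_snd)).mul (hg.comp measurable_fst)
  have hKs : ∀ z₁ z₂, Measurable fun w : X × Y => k₁ z₁ w.1 * k₂ z₂ w.2 * f w * g (z₁, z₂) :=
    fun z₁ z₂ => hK.comp (measurable_prodMk_left (x := (z₁, z₂)))
  calc ∫⁻ z, ∫⁻ w, k₁ z.1 w.1 * k₂ z.2 w.2 * f w * g z ∂(m₁.prod m₂) ∂(m₁.prod m₂)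
      = ∫⁻ z₂, ∫⁻ z₁, ∫⁻ w₂, ∫⁻ w₁, k₁ z₁ w₁ * k₂ z₂ w₂ * f (w₁, w₂) * g (z₁, z₂)
          ∂m₁ ∂m₂ ∂m₁ ∂m₂ := by
        rw [lintegral_prod_symm' _ hK.lintegral_prod_right']
        refine lintegral_congr fun z₂ => lintegral_congr fun z₁ => ?_
        exact lintegral_prod_symm' _ (hKs z₁ z₂)
    _ = ∫⁻ z₂, ∫⁻ w₂, ∫⁻ z₁, ∫⁻ w₁, k₁ z₁ w₁ * k₂ z₂ w₂ * f (w₁, w₂) * g (z₁, z₂)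
          ∂m₁ ∂m₁ ∂m₂ ∂m₂ := by
        refine lintegral_congr fun z₂ => ?_
        refine lintegral_lintegral_swap (Measurable.aemeasurable ?_)
        refine Measurable.lintegral_prod_right' (f := fun t : (X × Y) × X =>
          k₁ t.1.1 t.2 * k₂ z₂ t.1.2 * f (t.2, t.1.2) * g (t.1.1, z₂)) ?_
        exact hK.comp (((measurable_fst.comp measurable_fst).prodMk measurable_const).prodMk
          (measurable_snd.prodMk (measurable_snd.comp measurable_fst)))
    _ ≤ ∫⁻ z₂, ∫⁻ w₂, N₁ * (k₂ z₂ w₂ * F w₂ * G z₂) ∂m₂ ∂m₂ := by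
        refine lintegral_mono fun z₂ => lintegral_mono fun w₂ => ?_
        have hf' : Measurable fun x => f (x, w₂) := hf.comp measurable_prodMk_right
        have hg' : Measurable fun x => g (x, z₂) := hg.comp measurable_prodMk_right
        have hkm : Measurable fun t : X × X => k₁ t.1 t.2 * f (t.2, w₂) * g (t.1, z₂) :=
          (hk₁.mul (hf'.comp measurable_snd)).mul (hg'.comp measurable_fst)
        have hkm' : ∀ z, Measurable fun w => k₁ z w * f (w, w₂) * g (z, z₂) := fun z =>
          hkm.comp measurable_prodMk_left
        calc _ = k₂ z₂ w₂ * ∫⁻ z₁, ∫⁻ w₁, k₁ z₁ w₁ * f (w₁, w₂) * g (z₁, z₂) ∂m₁ ∂m₁ := by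
              rw [← lintegral_const_mul _ hkm.lintegral_prod_right']
              refine lintegral_congr fun z₁ => ?_
              rw [← lintegral_const_mul _ (hkm' z₁)]
              refine lintegral_congr fun w₁ => ?_
              ring
          _ ≤ k₂ z₂ w₂ * (N₁ * (F w₂ * G z₂)) := by
              gcongr
              exact h₁ _ _ hf' hg'
          _ = _ := by ring
    _ = N₁ * ∫⁻ z₂, ∫⁻ w₂, k₂ z₂ w₂ * F w₂ * G z₂ ∂m₂ ∂m₂ := by
        have hkm : Measurable fun t : Y × Y => k₂ t.1 t.2 * F t.2 * G t.1 :=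
          (hk₂.mul (hF.comp measurable_snd)).mul (hG.comp measurable_fst)
        have hkm' : ∀ z, Measurable fun w => k₂ z w * F w * G z := fun z =>
          hkm.comp measurable_prodMk_left
        rw [← lintegral_const_mul _ hkm.lintegral_prod_right']
        refine lintegral_congr fun z₂ => ?_
        rw [← lintegral_const_mul _ (hkm' z₂)]
    _ ≤ N₁ * (N₂ * ((∫⁻ y, F y ^ p * u₂ y ∂m₂) ^ (1 / p) *
          (∫⁻ y, G y ^ q * v₂ y ∂m₂) ^ (1 / q))) := by
        gcongr
        exact h₂ _ _ hF hG
    _ = _ := by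
        rw [hF_def, hG_def, hint hpq.pos hf hu₁ hu₂, hint hpq.symm.pos hg hv₁ hv₂]
        ring

/-- Duality between `L^p(u)` and `L^q(v)`. -/
theorem lintegral_rpow_le_of_forall_form_le {m : Measure X} [SigmaFinite m] {p q : ℝ}
    (hpq : p.HolderConjugate q) {u v : X → ℝ≥0∞} (hu : Measurable u) (hu0 : ∀ x, u x ≠ 0)
    (hut : ∀ x, u x ≠ ∞) (hvu : ∀ x, v x = u x ^ (1 - q)) {h : X → ℝ≥0∞} (hh : Measurable h)
    {N : ℝ≥0∞}
    (H : ∀ g : X → ℝ≥0∞, Measurable g → ∫⁻ x, h x * g x ∂m ≤ N * (∫⁻ x, g x ^ q * v x ∂m) ^ (1 / q)) :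
    (∫⁻ x, h x ^ p * u x ∂m) ^ (1 / p) ≤ N := by
  have hp0 := hpq.pos
  have hq0 := hpq.symm.pos
  have hqp := hpq.mul_eq_add
  have hp1 : 0 < p - 1 := sub_pos.mpr hpq.lt
  set μ := m.withDensity u with hμ
  have : SigmaFinite μ := SigmaFinite.withDensity_of_ne_top (ae_of_all _ hut)
  set hn : ℕ → X → ℝ≥0∞ := fun n => (spanningSets μ n).indicator fun x => min (h x) n with hhn
  have hnm : ∀ n, Measurable (hn n) := fun n =>
    (hh.min measurable_const).indicator (measurableSet_spanningSets μ n)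
  -- The function h is cut off in height and to sets of finite measure, so that its norm is finite
  -- and can be cancelled after testing on the extremal function `hn n x ^ (p - 1) * u x`.
  have hnle : ∀ n x, hn n x ≤ h x := fun n x =>
    (indicator_le_self' (fun _ _ => zero_le) x).trans (min_le_left _ _)
  have hfin : ∀ n, ∫⁻ x, hn n x ^ p ∂μ ≠ ∞ := by
    intro n
    have : ∀ x, hn n x ^ p ≤ (spanningSets μ n).indicator (fun _ => (n : ℝ≥0∞) ^ p) x := by
      intro x
      by_cases hx : x ∈ spanningSets μ n
      · simp only [hhn, indicator_of_mem hx]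
        exact ENNReal.rpow_le_rpow (min_le_right _ _) hp0.le
      · simp [hhn, hx, hp0]
    refine ne_top_of_le_ne_top ?_ (lintegral_mono this)
    rw [lintegral_indicator_const (measurableSet_spanningSets μ n)]
    exact ENNReal.mul_ne_top (ENNReal.rpow_ne_top_of_nonneg hp0.le (by simp))
      (measure_spanningSets_lt_top μ n).ne
  have hbd : ∀ n, (∫⁻ x, hn n x ^ p ∂μ) ^ (1 / p) ≤ N := by
    intro n
    refine rpow_le_of_le_mul_rpow hpq (hfin n) ?_
    have h1 := H (fun x => hn n x ^ (p - 1) * u x) (((hnm n).pow_const _).mul hu)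
    have h2 : ∫⁻ x, hn n x ^ p ∂μ ≤ ∫⁻ x, h x * (hn n x ^ (p - 1) * u x) ∂m := by
      rw [hμ, lintegral_withDensity_eq_lintegral_mul _ hu ((hnm n).pow_const _)]
      refine lintegral_mono fun x => ?_
      simp only [Pi.mul_apply]
      calc u x * hn n x ^ p = hn n x * (hn n x ^ (p - 1) * u x) := by
            rw [← mul_assoc, ← rpow_one_add hp1.le, add_sub_cancel, mul_comm]
        _ ≤ _ := by gcongr; exact hnle n x
    have h3 : ∫⁻ x, (hn n x ^ (p - 1) * u x) ^ q * v x ∂m = ∫⁻ x, hn n x ^ p ∂μ := by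
      rw [hμ, lintegral_withDensity_eq_lintegral_mul _ hu ((hnm n).pow_const _)]
      refine lintegral_congr fun x => ?_
      simp only [Pi.mul_apply]
      rw [ENNReal.mul_rpow_of_nonneg _ _ hq0.le, ← ENNReal.rpow_mul, mul_assoc, hvu,
        ← ENNReal.rpow_add _ _ (hu0 x) (hut x), add_sub_cancel, ENNReal.rpow_one, mul_comm]
      congr 2; linarith
    rw [h3] at h1
    exact h2.trans h1
  have hlim : ∫⁻ x, h x ^ p * u x ∂m = ⨆ n, ∫⁻ x, hn n x ^ p ∂μ := by
    rw [← lintegral_iSup fun n => (hnm n).pow_const _]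
    · have e1 : ∀ x, ⨆ n, hn n x ^ p = h x ^ p := by
        intro x
        apply le_antisymm (iSup_le fun n => ENNReal.rpow_le_rpow (hnle n x) hp0.le)
        have e2 : ∀ b < h x, ∃ n, b < hn n x := by
          intro b hb
          obtain ⟨n₁, hn₁⟩ : ∃ n : ℕ, b < n := ENNReal.exists_nat_gt hb.ne_top
          have hx : x ∈ ⋃ i, spanningSets μ i := by rw [iUnion_spanningSets]; trivial
          obtain ⟨n₂, hn₂⟩ := mem_iUnion.mp hx
          refine ⟨max n₁ n₂, ?_⟩
          have : x ∈ spanningSets μ (max n₁ n₂) := monotone_spanningSets μ (le_max_right _ _) hn₂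
          simp only [hhn, indicator_of_mem this]
          exact lt_min hb (hn₁.trans_le (by exact_mod_cast le_max_left _ _))
        have e3 : h x ≤ ⨆ n, hn n x := le_of_forall_lt fun b hb => by
          obtain ⟨n, hn'⟩ := e2 b hb
          exact hn'.trans_le (le_iSup (fun n => hn n x) n)
        calc h x ^ p ≤ (⨆ n, hn n x) ^ p := ENNReal.rpow_le_rpow e3 hp0.le
          _ = _ := (ENNReal.orderIsoRpow p hp0).map_iSup _
      simp_rw [e1]
      rw [hμ, lintegral_withDensity_eq_lintegral_mul _ hu (hh.pow_const _)]
      simp only [Pi.mul_apply, mul_comm]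
    · intro i j hij x
      refine ENNReal.rpow_le_rpow ?_ hp0.le
      have hs := monotone_spanningSets μ hij
      simp only [hhn]
      by_cases hx : x ∈ spanningSets μ i
      · rw [indicator_of_mem hx, indicator_of_mem (hs hx)]
        exact min_le_min le_rfl (by exact_mod_cast hij)
      · rw [indicator_of_notMem hx]; exact zero_le
  rw [hlim]
  have : (⨆ n, ∫⁻ x, hn n x ^ p ∂μ) ≤ N ^ p := iSup_le fun n => by
    have := ENNReal.rpow_le_rpow (hbd n) hp0.le
    rwa [← ENNReal.rpow_mul, one_div_mul_cancel hp0.ne', ENNReal.rpow_one] at this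
  refine (ENNReal.rpow_le_rpow this (one_div_pos.mpr hp0).le).trans (le_of_eq ?_)
  rw [← ENNReal.rpow_mul, mul_one_div_cancel hp0.ne', ENNReal.rpow_one]

theorem IsFormBound.lintegral_rpow_le {m : Measure X} [SigmaFinite m] {k : X → X → ℝ≥0∞}
    (hk : Measurable fun x : X × X => k x.1 x.2) {p q : ℝ} (hpq : p.HolderConjugate q)
    {u v : X → ℝ≥0∞} (hu : Measurable u) (hu0 : ∀ x, u x ≠ 0)
    (hut : ∀ x, u x ≠ ∞) (hvu : ∀ x, v x = u x ^ (1 - q)) {N : ℝ≥0∞}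
    (h : IsFormBound m k p q u v N) {f : X → ℝ≥0∞} (hf : Measurable f) :
    (∫⁻ z, (∫⁻ w, k z w * f w ∂m) ^ p * u z ∂m) ^ (1 / p) ≤
      N * (∫⁻ x, f x ^ p * u x ∂m) ^ (1 / p) := by
  have hkf : Measurable fun t : X × X => k t.1 t.2 * f t.2 := hk.mul (hf.comp measurable_snd)
  refine lintegral_rpow_le_of_forall_form_le hpq hu hu0 hut hvu hkf.lintegral_prod_right'
    fun g hg => ?_
  refine le_trans (le_of_eq ?_) ((h f g hf hg).trans (le_of_eq (mul_assoc _ _ _).symm))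
  refine lintegral_congr fun z => ?_
  have hkf' : Measurable fun w => k z w * f w := hkf.comp measurable_prodMk_left
  rw [lintegral_mul_const _ hkf']

end Form

/-! ### The Hartogs triangle as the image of a bidisc -/

/-- The coordinates `(t₁, t₂) ↦ (t₁ t₂, t₂)`, extended by the identity to `t₂ = 0`. -/
def hartogsEquiv : ℂ × ℂ ≃ᵐ ℂ × ℂ where
  toFun t := (if t.2 = 0 then t.1 else t.1 * t.2, t.2)
  invFun z := (if z.2 = 0 then z.1 else z.1 / z.2, z.2)
  left_inv t := by
    by_cases h : t.2 = 0
    · simp [h, Prod.ext_iff]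
    · simp [h]
  right_inv t := by
    by_cases h : t.2 = 0
    · simp [h, Prod.ext_iff]
    · simp [h]
  measurable_toFun := (Measurable.ite (measurable_snd (measurableSet_singleton 0)) measurable_fst
    (measurable_fst.mul measurable_snd)).prodMk measurable_snd
  measurable_invFun := (Measurable.ite (measurable_snd (measurableSet_singleton 0)) measurable_fst
    (measurable_fst.div measurable_snd)).prodMk measurable_snd

theorem hartogsEquiv_apply {t : ℂ × ℂ} (h : t.2 ≠ 0) : hartogsEquiv t = (t.1 * t.2, t.2) := by
  change (if t.2 = 0 then t.1 else t.1 * t.2, t.2) = _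
  simp [h]

theorem hartogsEquiv_snd (t : ℂ × ℂ) : (hartogsEquiv t).2 = t.2 := rfl

theorem hartogsEquiv_fst_div {t : ℂ × ℂ} (h : t.2 ≠ 0) :
    (hartogsEquiv t).1 / (hartogsEquiv t).2 = t.1 := by
  rw [hartogsEquiv_apply h]; field_simp

theorem lintegral_comp_mul_right {a : ℂ} (ha : a ≠ 0) {F : ℂ → ℝ≥0∞} (hF : Measurable F) :
    ∫⁻ t, F (t * a) * ‖a‖ₑ ^ 2 = ∫⁻ z, F z := by
  have hdet : LinearMap.det (Algebra.lmul ℝ ℂ a) = ‖a‖ ^ 2 := by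
    rw [← Complex.normSq_eq_norm_sq, ← Algebra.norm_complex_apply]; rfl
  have hn : 0 < ‖a‖ := norm_pos_iff.mpr ha
  have hmap := Measure.map_linearMap_addHaar_eq_smul_addHaar (volume : Measure ℂ)
    (f := Algebra.lmul ℝ ℂ a) (by rw [hdet]; positivity)
  have hm : Measurable (fun t : ℂ => t * a) := measurable_mul_const a
  have hc : Measurable fun t => F (t * a) := hF.comp hm
  have hl : ∫⁻ t, F (t * a) = ∫⁻ z, F z ∂(volume.map fun t : ℂ => t * a) :=
    (lintegral_map hF hm).symm
  rw [lintegral_mul_const _ hc, hl]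
  have : (fun t : ℂ => t * a) = ⇑(Algebra.lmul ℝ ℂ a) := by
    ext t; simp [mul_comm]
  rw [this, hmap, lintegral_smul_measure, hdet, smul_eq_mul, mul_right_comm,
    ← ofReal_norm, ← ENNReal.ofReal_pow hn.le, ← ENNReal.ofReal_mul (abs_nonneg _),
    abs_of_pos (by positivity), inv_mul_cancel₀ (by positivity), ENNReal.ofReal_one, one_mul]

theorem measurable_enorm_snd : Measurable fun t : ℂ × ℂ => ‖t.2‖ₑ := measurable_snd.enorm

theorem ae_ne_zero : ∀ᵐ y : ℂ, y ≠ 0 := by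
  rw [ae_iff]; simp

theorem ae_snd_ne_zero : ∀ᵐ t : ℂ × ℂ, t.2 ≠ 0 := by
  have : (volume : Measure (ℂ × ℂ)) = (volume : Measure ℂ).prod volume := rfl
  have h := Measure.quasiMeasurePreserving_snd (μ := (volume : Measure ℂ)) (ν := (volume : Measure ℂ))
  rw [this]
  exact h.ae ae_ne_zero

/-- On each slice t₂ = y ≠ 0 the map is multiplication by y, with real Jacobian |y|², and the
exceptional slice is null. -/
theorem measurePreserving_hartogsEquiv :
    MeasurePreserving hartogsEquiv (volume.withDensity fun t : ℂ × ℂ => ‖t.2‖ₑ ^ 2) volume := by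
  refine ⟨hartogsEquiv.measurable, ?_⟩
  ext A hA
  have hind : Measurable (A.indicator (1 : ℂ × ℂ → ℝ≥0∞)) := measurable_one.indicator hA
  rw [hartogsEquiv.map_apply, ← lintegral_indicator_one (hartogsEquiv.measurable hA),
    lintegral_withDensity_eq_lintegral_mul _ (measurable_enorm_snd.pow_const 2)
      (measurable_one.indicator (hartogsEquiv.measurable hA)), ← lintegral_indicator_one hA,
    Measure.volume_eq_prod, lintegral_prod_symm' _ ((measurable_enorm_snd.pow_const 2).mul
      (measurable_one.indicator (hartogsEquiv.measurable hA))), lintegral_prod_symm' _ hind]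
  refine lintegral_congr_ae ?_
  filter_upwards [ae_ne_zero] with y hy
  have hi : Measurable fun x : ℂ => A.indicator (1 : ℂ × ℂ → ℝ≥0∞) (x, y) :=
    hind.comp measurable_prodMk_right
  rw [← lintegral_comp_mul_right hy hi]
  refine lintegral_congr fun x => ?_
  simp only [Pi.mul_apply]
  rw [mul_comm]
  congr 1
  simp only [← hartogsEquiv_apply (t := (x, y)) hy]
  rfl

/-- Lebesgue measure on the bidisc. -/
def bidisc : Measure (ℂ × ℂ) := (volume.restrict disc).prod (volume.restrict disc)

instance : SFinite bidisc := by unfold bidisc; infer_instance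

instance : IsFiniteMeasure (volume.restrict disc) := by
  unfold disc; exact isFiniteMeasure_restrict.mpr measure_ball_lt_top.ne

instance : IsFiniteMeasure bidisc := by unfold bidisc; infer_instance

theorem bidisc_eq : bidisc = volume.restrict (disc ×ˢ disc) := by
  rw [bidisc, Measure.prod_restrict]; rfl

theorem isOpen_hartogs : IsOpen hartogs :=
  (isOpen_lt (continuous_fst.norm) continuous_snd.norm).inter
    (isOpen_lt continuous_snd.norm continuous_const)

theorem measurableSet_hartogs : MeasurableSet hartogs := isOpen_hartogs.measurableSet

theorem mem_hartogs {z : ℂ × ℂ} : z ∈ hartogs ↔ ‖z.1‖ < ‖z.2‖ ∧ ‖z.2‖ < 1 := Iff.rfl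

theorem hartogsEquiv_mem_iff {t : ℂ × ℂ} (h : t.2 ≠ 0) :
    hartogsEquiv t ∈ hartogs ↔ t.1 ∈ disc ∧ t.2 ∈ disc := by
  rw [hartogsEquiv_apply h, mem_hartogs, mem_disc, mem_disc, norm_mul]
  have := norm_pos_iff.mpr h
  simp only
  rw [mul_lt_iff_lt_one_left this]

theorem snd_ne_zero_of_mem_hartogs {z : ℂ × ℂ} (h : z ∈ hartogs) : z.2 ≠ 0 := by
  intro h0
  have := h.1
  rw [h0, norm_zero] at this
  exact absurd this (norm_nonneg _).not_gt

theorem preimage_hartogs_ae : hartogsEquiv ⁻¹' hartogs =ᵐ[volume] (disc ×ˢ disc : Set (ℂ × ℂ)) := by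
  filter_upwards [ae_snd_ne_zero] with t ht
  exact propext (hartogsEquiv_mem_iff ht)

theorem measurePreserving_hartogs : MeasurePreserving hartogsEquiv
    (bidisc.withDensity fun t : ℂ × ℂ => ‖t.2‖ₑ ^ 2) (volume.restrict hartogs) := by
  have h := measurePreserving_hartogsEquiv.restrict_preimage measurableSet_hartogs
  rwa [restrict_withDensity (hartogsEquiv.measurable measurableSet_hartogs),
    Measure.restrict_congr_set preimage_hartogs_ae, ← bidisc_eq] at h

theorem ae_bidisc_snd_ne_zero : ∀ᵐ t ∂bidisc, t.2 ≠ 0 := by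
  rw [bidisc_eq]; exact ae_restrict_of_ae ae_snd_ne_zero

theorem ae_bidisc_mem : ∀ᵐ t ∂bidisc, t.1 ∈ disc ∧ t.2 ∈ disc := by
  rw [bidisc_eq]
  filter_upwards [ae_restrict_mem (measurableSet_disc.prod measurableSet_disc)] with t ht using ht

theorem ae_hartogs_iff {P : ℂ × ℂ → Prop} :
    (∀ᵐ z ∂volume.restrict hartogs, P z) ↔ ∀ᵐ t ∂bidisc, P (hartogsEquiv t) := by
  rw [← measurePreserving_hartogs.map_eq, hartogsEquiv.measurableEmbedding.ae_map_iff]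
  rw [ae_withDensity_iff (measurable_enorm_snd.pow_const 2)]
  refine Filter.eventually_congr ?_
  filter_upwards [ae_bidisc_snd_ne_zero] with t ht
  simp [ht]

theorem setLIntegral_hartogs (F : ℂ × ℂ → ℝ≥0∞) :
    ∫⁻ z in hartogs, F z = ∫⁻ t, ‖t.2‖ₑ ^ 2 * F (hartogsEquiv t) ∂bidisc := by
  rw [← measurePreserving_hartogs.lintegral_comp_emb hartogsEquiv.measurableEmbedding,
    lintegral_withDensity_eq_lintegral_mul_non_measurable _ (measurable_enorm_snd.pow_const 2)
      (ae_of_all _ fun t => by simp)]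
  rfl

theorem enorm_sq_eq_coe (t : ℂ × ℂ) : ‖t.2‖ₑ ^ 2 = ((‖t.2‖₊ ^ 2 : ℝ≥0) : ℝ≥0∞) := by
  rw [ENNReal.coe_pow]; rfl

theorem setIntegral_hartogs (F : ℂ × ℂ → ℂ) :
    ∫ z in hartogs, F z = ∫ t, ((‖t.2‖ : ℂ)) ^ 2 * F (hartogsEquiv t) ∂bidisc := by
  rw [← measurePreserving_hartogs.integral_comp hartogsEquiv.measurableEmbedding]
  simp_rw [enorm_sq_eq_coe]
  rw [integral_withDensity_eq_integral_smul (by fun_prop)]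
  refine integral_congr_ae (ae_of_all _ fun t => ?_)
  simp only [NNReal.smul_def, Complex.real_smul]
  push_cast
  rfl

theorem integrableOn_hartogs_iff (F : ℂ × ℂ → ℂ) :
    IntegrableOn F hartogs ↔
      Integrable (fun t => ((‖t.2‖ : ℂ)) ^ 2 * F (hartogsEquiv t)) bidisc := by
  rw [IntegrableOn, ← measurePreserving_hartogs.integrable_comp_emb
    hartogsEquiv.measurableEmbedding]
  simp_rw [enorm_sq_eq_coe]
  rw [integrable_withDensity_iff_integrable_smul (by fun_prop)]
  refine integrable_congr (ae_of_all _ fun t => ?_)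
  simp only [NNReal.smul_def, Complex.real_smul, Function.comp]
  push_cast
  rfl

theorem bidisc_absolutelyContinuous :
    bidisc ≪ bidisc.withDensity fun t : ℂ × ℂ => ‖t.2‖ₑ ^ 2 := by
  refine withDensity_absolutelyContinuous' (measurable_enorm_snd.pow_const 2).aemeasurable ?_
  filter_upwards [ae_bidisc_snd_ne_zero] with t ht
  simp [ht]

theorem aestronglyMeasurable_comp_hartogsEquiv {E : Type*} [TopologicalSpace E] {F : ℂ × ℂ → E}
    (hF : AEStronglyMeasurable F (volume.restrict hartogs)) :
    AEStronglyMeasurable (fun t => F (hartogsEquiv t)) bidisc :=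
  (hF.comp_measurePreserving measurePreserving_hartogs).mono_ac bidisc_absolutelyContinuous

/-- The Jacobian |t₂|² cancels the density |w₂|⁻², so averages against du become plain Lebesgue
averages in the bidisc coordinates. -/
theorem measurePreserving_measureU :
    MeasurePreserving hartogsEquiv volume measureU := by
  refine ⟨hartogsEquiv.measurable, ?_⟩
  ext A hA
  have hm : Measurable fun w : ℂ × ℂ => ENNReal.ofReal (‖w.2‖ ^ (-2 : ℝ)) := by fun_prop
  have hc : Measurable fun t => ENNReal.ofReal (‖(hartogsEquiv t).2‖ ^ (-2 : ℝ)) :=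
    hm.comp hartogsEquiv.measurable
  rw [hartogsEquiv.map_apply, measureU, withDensity_apply _ hA,
    ← (measurePreserving_hartogsEquiv.restrict_preimage hA).lintegral_comp hm,
    restrict_withDensity (hartogsEquiv.measurable hA),
    lintegral_withDensity_eq_lintegral_mul _ (measurable_enorm_snd.pow_const 2)
      hc, ← setLIntegral_one]
  refine lintegral_congr_ae ?_
  filter_upwards [ae_restrict_of_ae ae_snd_ne_zero] with t ht
  have hn := norm_pos_iff.mpr ht
  simp only [Pi.mul_apply, hartogsEquiv_snd]
  rw [← ofReal_norm, ← ENNReal.ofReal_pow hn.le, ← ENNReal.ofReal_mul (by positivity),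
    ← Real.rpow_natCast, ← Real.rpow_add hn]
  norm_num

/-! ### Weights in bidisc coordinates -/

/-- `W₁`, `W₂` are everywhere positive and finite measurable versions of the weights `μ₁` and
`|t|^{2-p} μ₂` on the disc. -/
structure IsWeightVersion (p : ℝ) (μ₁ μ₂ : ℂ → ℝ) (W₁ W₂ : ℂ → ℝ≥0∞) : Prop where
  meas₁ : Measurable W₁
  meas₂ : Measurable W₂
  ne_zero₁ : ∀ x, W₁ x ≠ 0
  ne_zero₂ : ∀ x, W₂ x ≠ 0
  ne_top₁ : ∀ x, W₁ x ≠ ∞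
  ne_top₂ : ∀ x, W₂ x ≠ ∞
  ae_eq₁ : ∀ᵐ t ∂volume.restrict disc, 0 < μ₁ t ∧ W₁ t = ENNReal.ofReal (μ₁ t)
  ae_eq₂ : ∀ᵐ t ∂volume.restrict disc, 0 < μ₂ t ∧ W₂ t = ENNReal.ofReal (‖t‖ ^ (2 - p) * μ₂ t)

theorem volume_disc_ne_zero : volume disc ≠ 0 := (Metric.measure_ball_pos volume 0 one_pos).ne'

theorem ae_disc_ne_zero : ∀ᵐ t ∂volume.restrict disc, t ≠ (0 : ℂ) :=
  ae_restrict_of_ae ae_ne_zero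

instance : (ae (volume.restrict disc)).NeBot := by
  rw [ae_neBot, Ne, Measure.restrict_eq_zero]; exact volume_disc_ne_zero

/-- The factors are not assumed measurable; only the product is, through local integrability. Almost
every slice of the product is measurable, and on a slice where the frozen factor is positive one may
divide by it. -/
theorem IsProductWeight.aemeasurable {μ : ℂ × ℂ → ℝ} {μ₁ μ₂ : ℂ → ℝ} (h : IsProductWeight μ μ₁ μ₂) :
    AEMeasurable μ₁ (volume.restrict disc) ∧ AEMeasurable μ₂ (volume.restrict disc) := by
  have h1 := aestronglyMeasurable_comp_hartogsEquiv h.locallyIntegrable.aestronglyMeasurable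
  have h2 : AEStronglyMeasurable (fun t : ℂ × ℂ => μ₁ t.1 * μ₂ t.2) bidisc := by
    refine h1.congr ?_
    filter_upwards [ae_bidisc_snd_ne_zero, ae_bidisc_mem] with t ht hm
    rw [h.eq_mul _ ((hartogsEquiv_mem_iff ht).mpr hm), hartogsEquiv_fst_div ht, hartogsEquiv_snd]
  constructor
  · have h3 : AEStronglyMeasurable (fun t : ℂ × ℂ => μ₁ t.2 * μ₂ t.1)
      ((volume.restrict disc).prod (volume.restrict disc)) := h2.prod_swap
    obtain ⟨x, hx, hpos⟩ := (h3.prodMk_left.and h.pos₂).exists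
    refine (hx.aemeasurable.mul_const (μ₂ x)⁻¹).congr (ae_of_all _ fun t => ?_)
    simp only
    field_simp
  · obtain ⟨x, hx, hpos⟩ := (AEStronglyMeasurable.prodMk_left (μ := volume.restrict disc)
      (ν := volume.restrict disc) h2 |>.and h.pos₁).exists
    refine (hx.aemeasurable.mul_const (μ₁ x)⁻¹).congr (ae_of_all _ fun t => ?_)
    simp only
    field_simp

theorem exists_positive_version {X : Type*} [MeasurableSpace X] {m : Measure X} {f : X → ℝ}
    (hf : AEMeasurable f m) (hpos : ∀ᵐ x ∂m, 0 < f x) :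
    ∃ W : X → ℝ≥0∞, Measurable W ∧ (∀ x, W x ≠ 0) ∧ (∀ x, W x ≠ ∞) ∧
      ∀ᵐ x ∂m, W x = ENNReal.ofReal (f x) := by
  classical
  refine ⟨fun x => if 0 < hf.mk f x then ENNReal.ofReal (hf.mk f x) else 1, ?_, ?_, ?_, ?_⟩
  · exact Measurable.ite (measurableSet_lt measurable_const hf.measurable_mk)
      hf.measurable_mk.ennreal_ofReal measurable_const
  · intro x
    simp only
    split_ifs with h
    · simpa using h
    · exact one_ne_zero
  · intro x
    simp only
    split_ifs with h <;> simp
  · filter_upwards [hf.ae_eq_mk, hpos] with x hx hp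
    rw [← hx, if_pos hp]

theorem IsProductWeight.exists_isWeightVersion {μ : ℂ × ℂ → ℝ} {μ₁ μ₂ : ℂ → ℝ}
    (h : IsProductWeight μ μ₁ μ₂) (p : ℝ) : ∃ W₁ W₂, IsWeightVersion p μ₁ μ₂ W₁ W₂ := by
  obtain ⟨W₁, hm₁, h0₁, ht₁, he₁⟩ := exists_positive_version h.aemeasurable.1 h.pos₁
  have hf₂ : AEMeasurable (fun t => ‖t‖ ^ (2 - p) * μ₂ t) (volume.restrict disc) :=
    (by fun_prop : Measurable fun t : ℂ => ‖t‖ ^ (2 - p)).aemeasurable.mul h.aemeasurable.2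
  obtain ⟨W₂, hm₂, h0₂, ht₂, he₂⟩ := exists_positive_version hf₂ (by
    filter_upwards [h.pos₂, ae_disc_ne_zero] with t ht h0
    have := norm_pos_iff.mpr h0
    positivity)
  refine ⟨W₁, W₂, hm₁, hm₂, h0₁, h0₂, ht₁, ht₂, ?_, ?_⟩
  · filter_upwards [h.pos₁, he₁] with t h1 h2 using ⟨h1, h2⟩
  · filter_upwards [h.pos₂, he₂] with t h1 h2 using ⟨h1, h2⟩

theorem ae_bidisc_of_ae {P Q : ℂ → Prop} (hP : ∀ᵐ t ∂volume.restrict disc, P t)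
    (hQ : ∀ᵐ t ∂volume.restrict disc, Q t) : ∀ᵐ t ∂bidisc, P t.1 ∧ Q t.2 := by
  have h1 := (Measure.quasiMeasurePreserving_fst (μ := volume.restrict disc)
    (ν := volume.restrict disc)).ae hP
  have h2 := (Measure.quasiMeasurePreserving_snd (μ := volume.restrict disc)
    (ν := volume.restrict disc)).ae hQ
  exact h1.and h2

/-- The measure `μ dV` in bidisc coordinates. -/
theorem measurePreserving_weightedVolume {p : ℝ} {μ : ℂ × ℂ → ℝ} {μ₁ μ₂ : ℂ → ℝ}
    (h : IsProductWeight μ μ₁ μ₂) {W₁ W₂ : ℂ → ℝ≥0∞} (hW : IsWeightVersion p μ₁ μ₂ W₁ W₂) :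
    MeasurePreserving hartogsEquiv
      (bidisc.withDensity fun t => ‖t.2‖ₑ ^ p * (W₁ t.1 * W₂ t.2)) (weightedVolume hartogs μ) := by
  refine ⟨hartogsEquiv.measurable, ?_⟩
  have hμ : AEMeasurable (fun z => ENNReal.ofReal (μ z)) (volume.restrict hartogs) :=
    h.locallyIntegrable.aestronglyMeasurable.aemeasurable.ennreal_ofReal
  ext A hA
  have hA' := hartogsEquiv.measurable hA
  rw [hartogsEquiv.map_apply, weightedVolume, withDensity_apply _ hA, withDensity_apply _ hA',
    ← lintegral_indicator hA, ← lintegral_indicator hA', setLIntegral_hartogs]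
  refine lintegral_congr_ae ?_
  filter_upwards [ae_bidisc_snd_ne_zero, ae_bidisc_mem,
    ae_bidisc_of_ae hW.ae_eq₁ hW.ae_eq₂] with t ht hm he
  by_cases hmem : hartogsEquiv t ∈ A
  · rw [indicator_of_mem hmem, indicator_of_mem (show t ∈ hartogsEquiv ⁻¹' A from hmem),
      h.eq_mul _ ((hartogsEquiv_mem_iff ht).mpr hm), hartogsEquiv_fst_div ht, hartogsEquiv_snd,
      he.1.2, he.2.2]
    have hn := norm_pos_iff.mpr ht
    rw [← ofReal_norm, ENNReal.ofReal_rpow_of_pos hn, ← ENNReal.ofReal_pow hn.le,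
      ← ENNReal.ofReal_mul he.1.1.le, ← ENNReal.ofReal_mul (by positivity),
      ← ENNReal.ofReal_mul (by positivity)]
    congr 1
    have : ‖t.2‖ ^ 2 = ‖t.2‖ ^ p * ‖t.2‖ ^ (2 - p) := by
      rw [← Real.rpow_add hn, ← Real.rpow_natCast]; norm_num
    rw [this]; ring
  · rw [indicator_of_notMem hmem, indicator_of_notMem (show t ∉ hartogsEquiv ⁻¹' A from hmem), mul_zero]

/-- The factor |t₂|^p is attached to the function rather than to the weight, because it is t₂ f on
which the bidisc operator acts. -/
theorem lintegral_weightedVolume {p : ℝ} (hp : 0 ≤ p) {μ : ℂ × ℂ → ℝ} {μ₁ μ₂ : ℂ → ℝ}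
    (h : IsProductWeight μ μ₁ μ₂) {W₁ W₂ : ℂ → ℝ≥0∞} (hW : IsWeightVersion p μ₁ μ₂ W₁ W₂)
    (F : ℂ × ℂ → ℝ≥0∞) :
    ∫⁻ z, F z ^ p ∂weightedVolume hartogs μ =
      ∫⁻ t, (‖t.2‖ₑ * F (hartogsEquiv t)) ^ p * (W₁ t.1 * W₂ t.2) ∂bidisc := by
  have hm : Measurable fun t : ℂ × ℂ => ‖t.2‖ₑ ^ p * (W₁ t.1 * W₂ t.2) :=
    (measurable_enorm_snd.pow_const p).mul
      ((hW.meas₁.comp measurable_fst).mul (hW.meas₂.comp measurable_snd))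
  rw [← (measurePreserving_weightedVolume h hW).lintegral_comp_emb
    hartogsEquiv.measurableEmbedding,
    lintegral_withDensity_eq_lintegral_mul_non_measurable _ hm (ae_of_all _ fun t =>
      ENNReal.mul_lt_top (ENNReal.rpow_lt_top_of_nonneg hp enorm_ne_top)
        (ENNReal.mul_lt_top (hW.ne_top₁ _).lt_top (hW.ne_top₂ _).lt_top))]
  refine lintegral_congr fun t => ?_
  simp only [Pi.mul_apply]
  rw [ENNReal.mul_rpow_of_nonneg _ _ hp]
  ring

theorem eLpNorm_weightedVolume {p : ℝ} (hp : 0 < p) {μ : ℂ × ℂ → ℝ} {μ₁ μ₂ : ℂ → ℝ}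
    (h : IsProductWeight μ μ₁ μ₂) {W₁ W₂ : ℂ → ℝ≥0∞} (hW : IsWeightVersion p μ₁ μ₂ W₁ W₂)
    (f : ℂ × ℂ → ℂ) :
    eLpNorm f (ENNReal.ofReal p) (weightedVolume hartogs μ) =
      (∫⁻ t, (‖t.2‖ₑ * ‖f (hartogsEquiv t)‖ₑ) ^ p * (W₁ t.1 * W₂ t.2) ∂bidisc) ^ (1 / p) := by
  rw [eLpNorm_eq_lintegral_rpow_enorm_toReal (by simpa using hp) (by simp),
    ENNReal.toReal_ofReal hp.le, lintegral_weightedVolume hp.le h hW]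

/-! ### Averages -/

/-- `⟨W⟩_U ⟨W^{1-q}⟩_U^{p-1}`. -/
def weightProd (p q : ℝ) (W : ℂ → ℝ≥0∞) (U : Set ℂ) : ℝ≥0∞ :=
  (⨍⁻ x in U, W x ∂volume) * (⨍⁻ x in U, W x ^ (1 - q) ∂volume) ^ (p - 1)

theorem neg_conjExp_div {p q : ℝ} (hpq : p.HolderConjugate q) :
    conjExp p = q ∧ -conjExp p / p = 1 - q := by
  have hp0 := hpq.pos
  have hp1 : 0 < p - 1 := sub_pos.mpr hpq.lt
  have hqp := hpq.mul_eq_add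
  have h1 : conjExp p = q := by unfold conjExp; field_simp; linarith
  refine ⟨h1, ?_⟩
  rw [h1]; field_simp; linarith

theorem enorm_eq_ofReal_of_pos {x : ℝ} (hx : 0 < x) : ‖x‖ₑ = ENNReal.ofReal x :=
  Real.enorm_of_nonneg hx.le

theorem discProd₁_eq {p q : ℝ} (hpq : p.HolderConjugate q) {μ₁ μ₂ : ℂ → ℝ} {W₁ W₂ : ℂ → ℝ≥0∞}
    (hW : IsWeightVersion p μ₁ μ₂ W₁ W₂) {U : Set ℂ} (hU : U ⊆ disc) :
    discProd₁ p μ₁ U = weightProd p q W₁ U := by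
  have h := ae_restrict_of_ae_restrict_of_subset hU hW.ae_eq₁
  unfold discProd₁ avgProd weightProd
  congr 1
  · refine laverage_congr ?_
    filter_upwards [h] with t ht
    rw [ht.2, enorm_eq_ofReal_of_pos ht.1]
  · congr 1
    refine laverage_congr ?_
    filter_upwards [h] with t ht
    rw [ht.2, dualWeight₁, (neg_conjExp_div hpq).2, enorm_eq_ofReal_of_pos
      (Real.rpow_pos_of_pos ht.1 _), ENNReal.ofReal_rpow_of_pos ht.1]

/-- The exponent identity (2-p)(1-q) = 2-q: after the change of coordinates the second pair of
weights is again an ordinary dual pair W, W^{1-q}. -/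
theorem norm_sq_mul_dualWeight₂ {p q : ℝ} (hpq : p.HolderConjugate q) {μ₂ : ℂ → ℝ} {t : ℂ}
    (ht : t ≠ 0) (hμ : 0 < μ₂ t) :
    ‖t‖ ^ 2 * dualWeight₂ p μ₂ t = (‖t‖ ^ (2 - p) * μ₂ t) ^ (1 - q) := by
  have hn := norm_pos_iff.mpr ht
  have hqp := hpq.mul_eq_add
  rw [dualWeight₂, (neg_conjExp_div hpq).2, (neg_conjExp_div hpq).1,
    Real.mul_rpow (by positivity) hμ.le, ← mul_assoc, ← Real.rpow_mul hn.le,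
    ← Real.rpow_natCast, ← Real.rpow_add hn]
  congr 2
  push_cast
  linarith

theorem discProd₂_eq {p q : ℝ} (hpq : p.HolderConjugate q) {μ₁ μ₂ : ℂ → ℝ} {W₁ W₂ : ℂ → ℝ≥0∞}
    (hW : IsWeightVersion p μ₁ μ₂ W₁ W₂) {U : Set ℂ} (hU : U ⊆ disc) :
    discProd₂ p μ₂ U = weightProd p q W₂ U := by
  have h := ae_restrict_of_ae_restrict_of_subset hU (hW.ae_eq₂.and ae_disc_ne_zero)
  unfold discProd₂ avgProd weightProd
  congr 1
  · refine laverage_congr ?_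
    filter_upwards [h] with t ht
    have hn := norm_pos_iff.mpr ht.2
    have := ht.1.1
    rw [ht.1.2, enorm_eq_ofReal_of_pos (by positivity)]
  · congr 1
    refine laverage_congr ?_
    filter_upwards [h] with t ht
    have hn := norm_pos_iff.mpr ht.2
    have := ht.1.1
    rw [ht.1.2, norm_sq_mul_dualWeight₂ hpq ht.2 ht.1.1, enorm_eq_ofReal_of_pos
      (by positivity), ENNReal.ofReal_rpow_of_pos (by positivity)]

theorem laverage_prod_mul {U₁ U₂ : Set ℂ} {f g : ℂ → ℝ≥0∞} (hf : Measurable f) (hg : Measurable g)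
    (h1 : volume U₁ ≠ ∞) (h2 : volume U₂ ≠ ∞) :
    ⨍⁻ t in U₁ ×ˢ U₂, f t.1 * g t.2 ∂volume = (⨍⁻ x in U₁, f x ∂volume) * ⨍⁻ x in U₂, g x ∂volume := by
  rw [setLAverage_eq, setLAverage_eq, setLAverage_eq, Measure.volume_eq_prod,
    ← Measure.prod_restrict, lintegral_prod_mul hf.aemeasurable hg.aemeasurable,
    Measure.prod_prod]
  rw [ENNReal.div_eq_inv_mul, ENNReal.mul_inv (Or.inr h2) (Or.inl h1)]
  simp only [div_eq_mul_inv]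
  ring

theorem setLAverage_measureU {U V : Set (ℂ × ℂ)} (hU : MeasurableSet U)
    (hUV : hartogsEquiv ⁻¹' U =ᵐ[volume] V) (F : ℂ × ℂ → ℝ≥0∞) :
    ⨍⁻ x in U, F x ∂measureU = ⨍⁻ t in V, F (hartogsEquiv t) ∂volume := by
  have h := measurePreserving_measureU.restrict_preimage hU
  rw [setLAverage_eq, setLAverage_eq, ← h.lintegral_comp_emb hartogsEquiv.measurableEmbedding,
    ← measurePreserving_measureU.measure_preimage hU.nullMeasurableSet,
    Measure.restrict_congr_set hUV, measure_congr hUV]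

/-- Averages of tensor products over product sets are products of averages, once du has been carried
to Lebesgue measure. Stated for a set whose preimage is a product only up to a null set, since the
slice t₂ = 0 is lost. -/
theorem hartogsProd_eq {p q : ℝ} (hpq : p.HolderConjugate q) {μ : ℂ × ℂ → ℝ} {μ₁ μ₂ : ℂ → ℝ}
    (hμ : IsProductWeight μ μ₁ μ₂) {W₁ W₂ : ℂ → ℝ≥0∞} (hW : IsWeightVersion p μ₁ μ₂ W₁ W₂)
    {U : Set (ℂ × ℂ)} (hU : MeasurableSet U) {U₁ U₂ : Set ℂ} (hU₁ : U₁ ⊆ disc) (hU₂ : U₂ ⊆ disc)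
    (hUU : hartogsEquiv ⁻¹' U =ᵐ[volume] (U₁ ×ˢ U₂ : Set (ℂ × ℂ))) :
    hartogsProd p μ U = weightProd p q W₁ U₁ * weightProd p q W₂ U₂ := by
  have hfin : volume disc ≠ ∞ := measure_ball_lt_top.ne
  have h1 : volume U₁ ≠ ∞ := measure_ne_top_of_subset hU₁ hfin
  have h2 : volume U₂ ≠ ∞ := measure_ne_top_of_subset hU₂ hfin
  have hae : ∀ᵐ t ∂volume.restrict (U₁ ×ˢ U₂), t.2 ≠ 0 ∧ (t.1 ∈ disc ∧ t.2 ∈ disc) ∧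
      (0 < μ₁ t.1 ∧ W₁ t.1 = ENNReal.ofReal (μ₁ t.1)) ∧
      (0 < μ₂ t.2 ∧ W₂ t.2 = ENNReal.ofReal (‖t.2‖ ^ (2 - p) * μ₂ t.2)) := by
    refine ae_restrict_of_ae_restrict_of_subset (prod_mono hU₁ hU₂) ?_
    rw [← bidisc_eq]
    filter_upwards [ae_bidisc_snd_ne_zero, ae_bidisc_mem,
      ae_bidisc_of_ae hW.ae_eq₁ hW.ae_eq₂] with t h1 h2 h3 using ⟨h1, h2, h3⟩
  have hqp := hpq.mul_eq_add
  unfold hartogsProd avgProd weightProd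
  rw [setLAverage_measureU hU hUU, setLAverage_measureU hU hUU, mul_mul_mul_comm,
    ← ENNReal.mul_rpow_of_nonneg _ _ (sub_pos.mpr hpq.lt).le,
    ← laverage_prod_mul hW.meas₁ hW.meas₂ h1 h2,
    ← laverage_prod_mul (hW.meas₁.pow_const _) (hW.meas₂.pow_const _) h1 h2]
  congr 1
  · refine laverage_congr ?_
    filter_upwards [hae] with t ⟨h0, hm, he₁, he₂⟩
    have hn := norm_pos_iff.mpr h0
    have e1 := he₁.1
    have e2 := he₂.1
    rw [hμ.eq_mul _ ((hartogsEquiv_mem_iff h0).mpr hm), hartogsEquiv_fst_div h0, hartogsEquiv_snd,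
      enorm_eq_ofReal_of_pos (by positivity), he₁.2, he₂.2, ← ENNReal.ofReal_mul e1.le]
    congr 1; ring
  · congr 1
    refine laverage_congr ?_
    filter_upwards [hae] with t ⟨h0, hm, he₁, he₂⟩
    have hn := norm_pos_iff.mpr h0
    have e1 := he₁.1
    have e2 := he₂.1
    have e3 : ‖t.2‖ ^ 2 * dualWeight p μ (hartogsEquiv t) =
        μ₁ t.1 ^ (1 - q) * (‖t.2‖ ^ 2 * dualWeight₂ p μ₂ t.2) := by
      rw [dualWeight, dualWeight₂, (neg_conjExp_div hpq).2, hμ.eq_mul _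
        ((hartogsEquiv_mem_iff h0).mpr hm), hartogsEquiv_fst_div h0, hartogsEquiv_snd,
        Real.mul_rpow e1.le e2.le]
      ring
    rw [hartogsEquiv_snd, e3, norm_sq_mul_dualWeight₂ hpq h0 e2, enorm_eq_ofReal_of_pos
      (by positivity), he₁.2, he₂.2, ENNReal.ofReal_rpow_of_pos e1, ENNReal.ofReal_rpow_of_pos
      (by positivity), ← ENNReal.ofReal_mul (by positivity)]

theorem measurableSet_inducedTent (z₁ z₂ : ℂ) : MeasurableSet (inducedTent z₁ z₂) :=
  measurableSet_hartogs.inter (((measurable_fst.div measurable_snd) (measurableSet_tent z₁)).inter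
    (measurable_snd (measurableSet_tent z₂)))

theorem preimage_inducedTent_ae (z₁ z₂ : ℂ) : hartogsEquiv ⁻¹' (inducedTent z₁ z₂) =ᵐ[volume]
    (tent z₁ ×ˢ tent z₂ : Set (ℂ × ℂ)) := by
  filter_upwards [ae_snd_ne_zero] with t ht
  refine propext ?_
  change (hartogsEquiv t ∈ hartogs ∧ (hartogsEquiv t).1 / (hartogsEquiv t).2 ∈ tent z₁ ∧
    (hartogsEquiv t).2 ∈ tent z₂) ↔ t.1 ∈ tent z₁ ∧ t.2 ∈ tent z₂
  rw [hartogsEquiv_fst_div ht, hartogsEquiv_mem_iff ht, hartogsEquiv_snd]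
  exact ⟨fun h => h.2, fun h => ⟨⟨tent_subset_disc _ h.1, tent_subset_disc _ h.2⟩, h⟩⟩

theorem hartogsProd_inducedTent {p q : ℝ} (hpq : p.HolderConjugate q) {μ : ℂ × ℂ → ℝ}
    {μ₁ μ₂ : ℂ → ℝ} (hμ : IsProductWeight μ μ₁ μ₂) {W₁ W₂ : ℂ → ℝ≥0∞}
    (hW : IsWeightVersion p μ₁ μ₂ W₁ W₂) (z₁ z₂ : ℂ) :
    hartogsProd p μ (inducedTent z₁ z₂) =
      weightProd p q W₁ (tent z₁) * weightProd p q W₂ (tent z₂) :=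
  hartogsProd_eq hpq hμ hW (measurableSet_inducedTent z₁ z₂) (tent_subset_disc _)
    (tent_subset_disc _) (preimage_inducedTent_ae z₁ z₂)

theorem char00_eq {p q : ℝ} (hpq : p.HolderConjugate q) {μ : ℂ × ℂ → ℝ}
    {μ₁ μ₂ : ℂ → ℝ} (hμ : IsProductWeight μ μ₁ μ₂) {W₁ W₂ : ℂ → ℝ≥0∞}
    (hW : IsWeightVersion p μ₁ μ₂ W₁ W₂) :
    char00 p μ = weightProd p q W₁ disc * weightProd p q W₂ disc :=
  hartogsProd_eq hpq hμ hW measurableSet_hartogs subset_rfl subset_rfl preimage_hartogs_ae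

/-! ### The reproducing property of the Bergman kernel of the disc -/

theorem polarCoord_symm_eq_circleMap (p : ℝ × ℝ) :
    Complex.polarCoord.symm p = circleMap 0 p.1 p.2 := by
  rw [Complex.polarCoord_symm_apply, circleMap, zero_add, Complex.exp_mul_I, Complex.ofReal_cos,
    Complex.ofReal_sin]

theorem integral_eq_integral_circleMap {f : ℂ → ℂ} (hm : Measurable f) (hf : Integrable f) :
    ∫ s, f s = ∫ r in Ioi (0 : ℝ), ∫ θ in Ioo (-Real.pi) Real.pi, r • f (circleMap 0 r θ) := by
  have hc : Measurable fun p : ℝ × ℝ => circleMap 0 p.1 p.2 := by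
    apply Continuous.measurable
    unfold circleMap
    fun_prop
  have hi : IntegrableOn (fun p : ℝ × ℝ => p.1 • f (circleMap 0 p.1 p.2))
      (Ioi (0 : ℝ) ×ˢ Ioo (-Real.pi) Real.pi) (volume.prod volume) := by
    refine ⟨(measurable_fst.smul (hm.comp hc)).aestronglyMeasurable, ?_⟩
    have h := Complex.lintegral_comp_polarCoord_symm fun s => ‖f s‖ₑ
    have h2 := hf.2
    rw [hasFiniteIntegral_iff_enorm] at h2 ⊢
    refine lt_of_eq_of_lt ?_ h2
    rw [← h, polarCoord_target]
    refine setLIntegral_congr_fun (measurableSet_Ioi.prod measurableSet_Ioo) fun p hp => ?_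
    simp only [polarCoord_symm_eq_circleMap, smul_eq_mul]
    rw [enorm_smul, Real.enorm_of_nonneg (le_of_lt hp.1)]
  rw [← Complex.integral_comp_polarCoord_symm, polarCoord_target]
  simp_rw [polarCoord_symm_eq_circleMap]
  exact setIntegral_prod _ hi

/-- On |s| = r one has s̄ = r²/s, so the kernel becomes s²/(π(s - tr²)²). With dθ = ds/(is) the
integral is Cauchy's formula for the derivative of s h(s) at tr². -/
theorem setIntegral_circleMap {h : ℂ → ℂ} {t : ℂ} {r : ℝ} (hr : 0 < r) (hr1 : r < 1)
    (ht : t ∈ disc) (hh : DifferentiableOn ℂ h disc) :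
    ∫ θ in Ioo (-Real.pi) Real.pi, discKernel t (circleMap 0 r θ) * h (circleMap 0 r θ) =
      2 * (h (t * r ^ 2) + t * r ^ 2 * deriv h (t * r ^ 2)) := by
  rw [mem_disc] at ht
  have hb : ‖t * (r : ℂ) ^ 2‖ < r := by
    rw [norm_mul, norm_pow, Complex.norm_real, Real.norm_of_nonneg hr.le]
    nlinarith [norm_nonneg t, mul_pos hr hr]
  have hsub : Metric.closedBall (0 : ℂ) r ⊆ disc := Metric.closedBall_subset_ball hr1
  have hmem : t * (r : ℂ) ^ 2 ∈ disc := by rw [mem_disc]; linarith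
  have hopen : IsOpen disc := Metric.isOpen_ball
  have hc := Complex.two_pi_I_inv_smul_circleIntegral_sub_sq_inv_smul_of_differentiable
    hopen hsub (f := fun s => s * h s) (differentiableOn_id.mul hh)
    (show t * (r : ℂ) ^ 2 ∈ Metric.ball (0 : ℂ) r by simpa using hb)
  have hd : deriv (fun s => s * h s) (t * r ^ 2) = h (t * r ^ 2) + t * r ^ 2 * deriv h (t * r ^ 2) := by
    have h1 := (hh.differentiableAt (hopen.mem_nhds hmem)).hasDerivAt
    have h2 := (hasDerivAt_id _).mul h1
    simpa [Pi.mul_def] using h2.deriv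
  rw [← hd, ← hc, circleIntegral, smul_eq_mul]
  have hper : Function.Periodic (fun θ : ℝ =>
      discKernel t (circleMap 0 r θ) * h (circleMap 0 r θ)) (2 * Real.pi) := fun θ => by
    simp only [periodic_circleMap 0 r θ]
  rw [← integral_Ioc_eq_integral_Ioo, ← intervalIntegral.integral_of_le (by linarith [Real.pi_pos])]
  have hs := hper.intervalIntegral_add_eq (-Real.pi) 0
  rw [show -Real.pi + 2 * Real.pi = Real.pi by ring, zero_add] at hs
  rw [hs, ← mul_assoc, ← intervalIntegral.integral_const_mul]
  refine intervalIntegral.integral_congr fun θ _ => ?_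
  simp only [deriv_circleMap, smul_eq_mul, discKernel]
  set s := circleMap 0 r θ with hs_def
  have hs0 : s ≠ 0 := circleMap_ne_center hr.ne'
  have hns : ‖s‖ = r := by rw [hs_def]; simp [abs_of_pos hr]
  have hss : conj s = r ^ 2 / s := by
    rw [eq_div_iff hs0, mul_comm, Complex.mul_conj, Complex.normSq_eq_norm_sq, hns]; push_cast; rfl
  have hne : s - t * (r : ℂ) ^ 2 ≠ 0 := by
    intro h0
    rw [sub_eq_zero] at h0
    rw [← h0, hns] at hb
    exact lt_irrefl _ hb
  have hπ : (Real.pi : ℂ) ≠ 0 := by exact_mod_cast Real.pi_ne_zero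
  have h3 : (1 - t * conj s) = (s - t * r ^ 2) / s := by rw [hss]; field_simp
  rw [h3]
  field_simp

theorem integrableOn_discKernel_mul {t : ℂ} (ht : t ∈ disc) {h : ℂ → ℂ} (hi : IntegrableOn h disc) :
    IntegrableOn (fun s => discKernel t s * h s) disc := by
  refine Integrable.bdd_mul (c := (Real.pi * (1 - ‖t‖) ^ 2)⁻¹) hi
    (measurable_discKernel.comp measurable_prodMk_left).aestronglyMeasurable ?_
  filter_upwards [ae_restrict_mem measurableSet_disc] with s hs
  rw [mem_disc] at hs ht
  have h1 := one_sub_norm_le (z := t) hs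
  have h2 : 0 < 1 - ‖t‖ := by linarith
  have := Real.pi_pos
  rw [norm_discKernel]
  gcongr

/-- The Bergman kernel of the disc reproduces integrable holomorphic functions. -/
theorem setIntegral_discKernel_mul {h : ℂ → ℂ} (hh : DifferentiableOn ℂ h disc)
    (hi : IntegrableOn h disc) {t : ℂ} (ht : t ∈ disc) :
    ∫ s in disc, discKernel t s * h s = h t := by
  have hopen : IsOpen disc := Metric.isOpen_ball
  set G : ℂ → ℂ := disc.indicator fun s => discKernel t s * h s with hG
  have hGi : Integrable G :=
    (integrable_indicator_iff measurableSet_disc).mpr (integrableOn_discKernel_mul ht hi)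
  have ht' := ht
  rw [mem_disc] at ht'
  have hhm : Measurable (disc.indicator h) := by
    classical
    have := hh.continuousOn.measurable_piecewise (g := fun _ => (0 : ℂ)) continuousOn_const
      measurableSet_disc
    rw [← piecewise_eq_indicator]; exact this
  have hGm : Measurable G := by
    have h1 : G = fun s => discKernel t s * disc.indicator h s := by
      ext s
      by_cases hs : s ∈ disc <;> simp [hG, hs]
    rw [h1]
    exact (measurable_discKernel.comp measurable_prodMk_left).mul hhm
  rw [← integral_indicator measurableSet_disc, integral_eq_integral_circleMap hGm hGi]
  have hinner : ∀ r ∈ Ioi (0 : ℝ), (∫ θ in Ioo (-Real.pi) Real.pi, r • G (circleMap 0 r θ)) =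
      (Ioo (0 : ℝ) 1).indicator
        (fun r => 2 * r * (h (t * r ^ 2) + t * r ^ 2 * deriv h (t * r ^ 2))) r := by
    intro r hr
    rw [mem_Ioi] at hr
    have hn : ∀ θ, ‖circleMap 0 r θ‖ = r := fun θ => by simp [abs_of_pos hr]
    by_cases hr1 : r < 1
    · have hm : ∀ θ, circleMap 0 r θ ∈ disc := fun θ => by rw [mem_disc, hn]; exact hr1
      rw [indicator_of_mem (show r ∈ Ioo (0 : ℝ) 1 from ⟨hr, hr1⟩), integral_smul]
      simp_rw [hG, indicator_of_mem (hm _)]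
      rw [setIntegral_circleMap hr hr1 ht hh, Complex.real_smul]
      ring
    · have hm : ∀ θ, circleMap 0 r θ ∉ disc := fun θ => by rw [mem_disc, hn]; exact hr1
      rw [indicator_of_notMem (fun h => hr1 h.2)]
      simp_rw [hG, indicator_of_notMem (hm _)]
      simp
  rw [setIntegral_congr_fun measurableSet_Ioi hinner, setIntegral_indicator measurableSet_Ioo,
    inter_eq_self_of_subset_right Ioo_subset_Ioi_self, ← integral_Ioc_eq_integral_Ioo,
    ← intervalIntegral.integral_of_le zero_le_one]
  have hmem : ∀ r ∈ uIcc (0 : ℝ) 1, t * (r : ℂ) ^ 2 ∈ disc := by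
    intro r hr
    rw [uIcc_of_le zero_le_one] at hr
    rw [mem_disc, norm_mul, norm_pow, Complex.norm_real, Real.norm_of_nonneg hr.1]
    nlinarith [norm_nonneg t, hr.1, hr.2, mul_nonneg hr.1 (sub_nonneg.mpr hr.2)]
  have hcont : ContinuousOn (fun r : ℝ => t * (r : ℂ) ^ 2) (uIcc 0 1) := by fun_prop
  -- The radial integrand is exactly the derivative of r² h(tr²), which equals h(t) at r = 1 and
  -- vanishes at r = 0.
  have hFTC := intervalIntegral.integral_eq_sub_of_hasDerivAt (a := (0 : ℝ)) (b := 1)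
    (f := fun r : ℝ => (r : ℂ) ^ 2 * h (t * r ^ 2))
    (f' := fun r : ℝ => 2 * r * (h (t * r ^ 2) + t * r ^ 2 * deriv h (t * r ^ 2))) ?_ ?_
  · rw [hFTC]; simp
  · intro r hr
    have h1 := (hh.differentiableAt (hopen.mem_nhds (hmem r hr))).hasDerivAt
    have h2 : HasDerivAt (fun r : ℝ => (r : ℂ) ^ 2) (2 * r) r := by
      refine ((hasDerivAt_id r).ofReal_comp.pow 2).congr_deriv ?_
      simp
    have h3 := h1.comp_of_eq r (h2.const_mul t) rfl
    have h4 := h2.mul h3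
    refine h4.congr_deriv ?_
    simp only [Function.comp]
    ring
  · refine ContinuousOn.intervalIntegrable ?_
    have hd : ContinuousOn (deriv h) disc := (hh.deriv hopen).continuousOn
    have c1 : ContinuousOn (fun r : ℝ => h (t * (r : ℂ) ^ 2)) (uIcc 0 1) :=
      hh.continuousOn.comp hcont hmem
    have c2 : ContinuousOn (fun r : ℝ => deriv h (t * (r : ℂ) ^ 2)) (uIcc 0 1) :=
      hd.comp hcont hmem
    exact (by fun_prop : ContinuousOn (fun r : ℝ => (2 * r : ℂ)) (uIcc 0 1)).mul
      (c1.add (hcont.mul c2))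

theorem discKernel_zero (s : ℂ) : discKernel 0 s = (Real.pi : ℂ)⁻¹ := by simp [discKernel]

/-! ### Removable singularities in the square integrable setting -/

/-- The sub-mean value property of the modulus of a holomorphic function. -/
theorem enorm_mul_le_setLIntegral_ball {h : ℂ → ℂ} {c : ℂ} {r : ℝ} (hr : 0 < r)
    {U : Set ℂ} (hh : DifferentiableOn ℂ h U) (hU : Metric.closedBall c r ⊆ U) :
    ENNReal.ofReal (Real.pi * r ^ 2) * ‖h c‖ₑ ≤ ∫⁻ s in Metric.ball c r, ‖h s‖ₑ := by
  have hmaps : ∀ s ∈ Metric.closedBall (0 : ℂ) 1, c + s * r ∈ Metric.closedBall c r := by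
    intro s hs
    rw [mem_closedBall_zero_iff] at hs
    rw [Metric.mem_closedBall, dist_eq_norm, add_sub_cancel_left, norm_mul, Complex.norm_real,
      Real.norm_of_nonneg hr.le]
    nlinarith
  have hcomp : DifferentiableOn ℂ (fun s : ℂ => h (c + s * r)) (Metric.closedBall 0 1) :=
    hh.comp (by fun_prop) fun s hs => hU (hmaps s hs)
  have hi : IntegrableOn (fun s : ℂ => h (c + s * r)) disc :=
    (hcomp.continuousOn.integrableOn_compact (isCompact_closedBall _ _)).mono_set
      Metric.ball_subset_closedBall
  -- At t = 0 the kernel is the constant 1/π, so the reproducing formula is the area mean value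
  -- property.
  have hrep := setIntegral_discKernel_mul (hcomp.mono Metric.ball_subset_closedBall) hi
    (t := 0) (by rw [mem_disc]; simp)
  simp only [zero_mul, add_zero, discKernel_zero] at hrep
  rw [integral_const_mul] at hrep
  have hle : ENNReal.ofReal Real.pi * ‖h c‖ₑ ≤ ∫⁻ s in disc, ‖h (c + s * r)‖ₑ := by
    refine le_trans (le_of_eq ?_) (enorm_integral_le_lintegral_enorm _)
    rw [← hrep, enorm_mul, ← mul_assoc, ← enorm_eq_ofReal_of_pos Real.pi_pos, enorm_inv
      (by exact_mod_cast Real.pi_ne_zero), ← ofReal_norm, ← ofReal_norm, Complex.norm_real,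
      ENNReal.mul_inv_cancel, one_mul]
    · simp [Real.pi_pos.ne']
    · simp
  have hball : MeasurableSet (Metric.ball c r) := measurableSet_ball
  classical
  have hFm : Measurable ((Metric.ball c r).indicator fun s => ‖h s‖ₑ) := by
    have h1 := ((hh.continuousOn.mono
      (Metric.ball_subset_closedBall.trans hU)).enorm).measurable_piecewise
      (g := fun _ => (0 : ℝ≥0∞)) continuousOn_const hball
    rw [← piecewise_eq_indicator]; exact h1
  have hF2 : Measurable fun s : ℂ => (Metric.ball c r).indicator (fun s => ‖h s‖ₑ) (c + s) :=
    hFm.comp (measurable_const_add c)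
  have hr0 : (r : ℂ) ≠ 0 := by exact_mod_cast hr.ne'
  have hscale := lintegral_comp_mul_right hr0 hF2
  rw [lintegral_add_left_eq_self (μ := (volume : Measure ℂ))
    ((Metric.ball c r).indicator fun s => ‖h s‖ₑ) c, lintegral_indicator hball,
    lintegral_mul_const' _ _ (by simp)] at hscale
  rw [← hscale, mul_comm Real.pi, ENNReal.ofReal_mul (by positivity), mul_assoc, mul_comm,
    ENNReal.ofReal_pow hr.le]
  have hrn : ‖(r : ℂ)‖ₑ = ENNReal.ofReal r := by
    rw [← ofReal_norm, Complex.norm_real, Real.norm_of_nonneg hr.le]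
  rw [hrn]
  gcongr
  refine hle.trans (le_of_eq ?_)
  rw [← lintegral_indicator measurableSet_disc]
  refine lintegral_congr fun s => ?_
  have hiff : c + s * r ∈ Metric.ball c r ↔ s ∈ disc := by
    rw [Metric.mem_ball, dist_eq_norm, add_sub_cancel_left, norm_mul, Complex.norm_real,
      Real.norm_of_nonneg hr.le, mem_disc]
    exact mul_lt_iff_lt_one_left hr
  by_cases hs : s ∈ disc
  · rw [indicator_of_mem hs, indicator_of_mem (hiff.mpr hs)]
  · rw [indicator_of_notMem hs, indicator_of_notMem (fun h => hs (hiff.mp h))]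

/-- The mean value inequality on the disc of radius |s|/2 about s, followed by Cauchy-Schwarz,
bounds |s h(s)| by a constant times the L² norm of h near the origin, which tends to zero by
absolute continuity. This excludes even a simple pole. -/
theorem isLittleO_inv_of_setLIntegral_sq {h : ℂ → ℂ} (hh : DifferentiableOn ℂ h (disc \ {0}))
    (h2 : ∫⁻ s in disc, ‖h s‖ₑ ^ (2 : ℝ) ≠ ∞) :
    h =o[nhdsWithin 0 {0}ᶜ] fun s => s⁻¹ := by
  have hsmall : ∀ ε : ℝ≥0∞, ε ≠ 0 → ∃ ρ : ℝ, 0 < ρ ∧ ρ < 1 ∧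
      ∫⁻ s in Metric.ball 0 ρ, ‖h s‖ₑ ^ (2 : ℝ) < ε := by
    intro ε hε
    have hlim : Filter.Tendsto (fun n : ℕ => (volume.restrict disc) (Metric.ball (0 : ℂ) (1 / (n + 2))))
        Filter.atTop (nhds 0) := by
      have h0 : Filter.Tendsto (fun n : ℕ => ENNReal.ofReal (Real.pi * (1 / ((n : ℝ) + 2)) ^ 2))
          Filter.atTop (nhds 0) := by
        rw [← ENNReal.ofReal_zero]
        refine (ENNReal.continuous_ofReal.tendsto _).comp ?_
        have h1 : Filter.Tendsto (fun n : ℕ => 1 / ((n : ℝ) + 2)) Filter.atTop (nhds 0) := by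
          refine Filter.Tendsto.const_div_atTop ?_ 1
          exact Filter.tendsto_atTop_add_const_right _ _ tendsto_natCast_atTop_atTop
        simpa using (h1.pow 2).const_mul Real.pi
      refine tendsto_of_tendsto_of_tendsto_of_le_of_le tendsto_const_nhds h0 (fun _ => zero_le) ?_
      intro n
      refine (Measure.restrict_apply_le _ _).trans ?_
      rw [volume_ball_eq _ (by positivity)]
    have := tendsto_setLIntegral_zero (μ := volume.restrict disc) h2 hlim
    obtain ⟨n, hn⟩ := (this.eventually_lt_const (pos_iff_ne_zero.mpr hε)).exists
    have hlt : 1 / ((n : ℝ) + 2) < 1 := by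
      rw [div_lt_one (by positivity)]; linarith [(Nat.cast_nonneg n : (0 : ℝ) ≤ n)]
    refine ⟨1 / (n + 2), by positivity, hlt, ?_⟩
    rwa [Measure.restrict_restrict measurableSet_ball,
      inter_eq_self_of_subset_left (show _ ⊆ disc from Metric.ball_subset_ball hlt.le)] at hn
  rw [Asymptotics.isLittleO_iff]
  intro c hc
  -- The value c²/2 is small enough because the final comparison reduces to 2 ≤ π.
  obtain ⟨ρ, hρ, hρ1, hint⟩ := hsmall (ENNReal.ofReal (c ^ 2 / 2)) (by simp; positivity)
  have hnear : Metric.ball (0 : ℂ) (ρ / 2) ∈ nhdsWithin (0 : ℂ) {0}ᶜ :=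
    mem_nhdsWithin_of_mem_nhds (Metric.ball_mem_nhds _ (by positivity))
  filter_upwards [hnear, self_mem_nhdsWithin] with s hs hs0
  rw [mem_ball_zero_iff] at hs
  have hs0' : s ≠ 0 := hs0
  have hn := norm_pos_iff.mpr hs0'
  set r := ‖s‖ / 2 with hr
  have hr0 : 0 < r := by positivity
  have hsub : Metric.closedBall s r ⊆ disc \ {0} := by
    intro x hx
    rw [Metric.mem_closedBall, dist_eq_norm] at hx
    refine ⟨?_, ?_⟩
    · rw [mem_disc]
      have := norm_le_norm_add_norm_sub s x
      rw [norm_sub_rev] at this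
      linarith
    · rintro rfl
      rw [zero_sub, norm_neg] at hx
      linarith
  have hsub2 : Metric.ball s r ⊆ Metric.ball 0 ρ := by
    intro x hx
    rw [Metric.mem_ball, dist_eq_norm] at hx
    rw [mem_ball_zero_iff]
    have := norm_le_norm_add_norm_sub s x
    rw [norm_sub_rev] at this
    linarith
  have hmv := enorm_mul_le_setLIntegral_ball hr0 hh hsub
  have hmeas : AEMeasurable (fun x => ‖h x‖ₑ) (volume.restrict (Metric.ball s r)) :=
    ((hh.continuousOn.mono (Metric.ball_subset_closedBall.trans hsub)).aemeasurable
      measurableSet_ball).enorm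
  have hcs := ENNReal.lintegral_mul_le_Lp_mul_Lq (volume.restrict (Metric.ball s r))
    Real.HolderConjugate.two_two hmeas (aemeasurable_const (b := (1 : ℝ≥0∞)))
  simp only [Pi.mul_apply, mul_one, ENNReal.one_rpow, lintegral_const, one_mul,
    Measure.restrict_apply_univ, volume_ball_eq _ hr0.le] at hcs
  have hI : ∫⁻ x in Metric.ball s r, ‖h x‖ₑ ^ (2 : ℝ) ≤ ENNReal.ofReal (c ^ 2 / 2) :=
    (lintegral_mono_set hsub2).trans hint.le
  have hfin := hmv.trans (hcs.trans (mul_le_mul_left (ENNReal.rpow_le_rpow hI (by norm_num)) _))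
  rw [ENNReal.ofReal_rpow_of_nonneg (by positivity) (by norm_num),
    ENNReal.ofReal_rpow_of_nonneg (by positivity) (by norm_num), ← ENNReal.ofReal_mul (by positivity),
    ← ofReal_norm, ← ENNReal.ofReal_mul (by positivity),
    ENNReal.ofReal_le_ofReal_iff (by positivity), ← Real.sqrt_eq_rpow, ← Real.sqrt_eq_rpow,
    ← Real.sqrt_mul (by positivity)] at hfin
  have hπ := Real.pi_gt_three
  have h3 : Real.pi * r ^ 2 * ‖h s‖ ≤ Real.pi * r ^ 2 * (c * ‖s⁻¹‖) := by
    refine hfin.trans ?_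
    rw [norm_inv]
    apply Real.sqrt_le_iff.mpr
    refine ⟨by positivity, ?_⟩
    have hsr : ‖s‖ = 2 * r := by rw [hr]; ring
    rw [hsr]
    have : (Real.pi * r ^ 2 * (c * (2 * r)⁻¹)) ^ 2 = Real.pi ^ 2 * r ^ 2 * c ^ 2 / 4 := by
      field_simp; ring
    rw [this]
    have h4 : 0 ≤ Real.pi * r ^ 2 * c ^ 2 := by positivity
    nlinarith
  exact le_of_mul_le_mul_left h3 (by positivity)

/-- The Bergman kernel of the disc reproduces square integrable holomorphic functions on the
punctured disc. -/
theorem setIntegral_discKernel_mul_of_punctured {h : ℂ → ℂ}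
    (hh : DifferentiableOn ℂ h (disc \ {0})) (h2 : ∫⁻ s in disc, ‖h s‖ₑ ^ (2 : ℝ) ≠ ∞)
    (hi : IntegrableOn h disc) {t : ℂ} (ht : t ∈ disc) (ht0 : t ≠ 0) :
    ∫ s in disc, discKernel t s * h s = h t := by
  have hopen : IsOpen disc := Metric.isOpen_ball
  have hnhds : disc ∈ nhds (0 : ℂ) := hopen.mem_nhds (by rw [mem_disc]; simp)
  have ho : (fun z => h z - h 0) =o[nhdsWithin 0 {0}ᶜ] fun z => (z - 0)⁻¹ := by
    simp only [sub_zero]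
    refine (isLittleO_inv_of_setLIntegral_sq hh h2).sub ?_
    refine (Asymptotics.isLittleO_const_left (c := h 0)).mpr (Or.inr ?_)
    exact tendsto_norm_inv_nhdsNE_zero_atTop
  have hd := Complex.differentiableOn_update_limUnder_of_isLittleO hnhds hh ho
  set H := Function.update h 0 ((nhdsWithin 0 {0}ᶜ).limUnder h) with hH
  have hae : H =ᵐ[volume.restrict disc] h := by
    filter_upwards [ae_disc_ne_zero] with s hs
    rw [hH, Function.update_of_ne hs]
  have hrep := setIntegral_discKernel_mul hd (hi.congr hae.symm) ht
  rw [hH, Function.update_of_ne ht0, ← hH] at hrep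
  rw [← hrep]
  refine integral_congr_ae ?_
  filter_upwards [hae] with s hs
  rw [hs]

/-! ### The Bergman projection in bidisc coordinates -/

theorem norm_discKernel_le {δ : ℝ} (hδ : 0 < δ) {t s : ℂ} (ht : ‖t‖ ≤ 1 - δ) (hs : s ∈ disc) :
    ‖discKernel t s‖ ≤ (δ ^ 2)⁻¹ := by
  rw [mem_disc] at hs
  have h1 := one_sub_norm_le (z := t) hs
  have hπ := Real.pi_gt_three
  have h2 : δ ≤ ‖1 - t * conj s‖ := by linarith
  rw [norm_discKernel]
  refine inv_anti₀ (by positivity) ?_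
  have := pow_le_pow_left₀ hδ.le h2 2
  nlinarith [pow_pos hδ 2]

theorem hasDerivAt_discKernel {t s : ℂ} (ht : t ∈ disc) (hs : s ∈ disc) :
    HasDerivAt (fun t => discKernel t s)
      (2 * conj s * ((Real.pi : ℂ) * (1 - t * conj s) ^ 3)⁻¹) t := by
  rw [mem_disc] at hs ht
  have h1 := one_sub_norm_le (z := t) hs
  have h2 : (1 - t * conj s) ≠ 0 := by
    rw [← norm_pos_iff]; linarith
  have hπ : (Real.pi : ℂ) ≠ 0 := by exact_mod_cast Real.pi_ne_zero
  have h3 : HasDerivAt (fun t : ℂ => 1 - t * conj s) (-conj s) t := by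
    simpa using ((hasDerivAt_id t).mul_const (conj s)).const_sub 1
  have h4 := ((h3.fun_pow 2).const_mul (Real.pi : ℂ)).fun_inv (mul_ne_zero hπ (pow_ne_zero 2 h2))
  refine h4.congr_deriv ?_
  field_simp
  push_cast
  ring

theorem norm_discKernel_deriv_le {δ : ℝ} (hδ : 0 < δ) {t s : ℂ} (ht : ‖t‖ ≤ 1 - δ) (hs : s ∈ disc) :
    ‖2 * conj s * ((Real.pi : ℂ) * (1 - t * conj s) ^ 3)⁻¹‖ ≤ (δ ^ 3)⁻¹ := by
  rw [mem_disc] at hs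
  have h1 := one_sub_norm_le (z := t) hs
  have hπ := Real.pi_gt_three
  have h2 : δ ≤ ‖1 - t * conj s‖ := by linarith
  have h3 := pow_le_pow_left₀ hδ.le h2 3
  have h4 : (Real.pi * ‖1 - t * conj s‖ ^ 3)⁻¹ ≤ (2 * δ ^ 3)⁻¹ := by
    refine inv_anti₀ (by positivity) ?_
    nlinarith [pow_pos hδ 3]
  rw [norm_mul, norm_mul, norm_inv, norm_mul, norm_pow, RCLike.norm_conj, Complex.norm_real,
    Real.norm_of_nonneg Real.pi_pos.le, Complex.norm_ofNat]
  calc 2 * ‖s‖ * (Real.pi * ‖1 - t * conj s‖ ^ 3)⁻¹ ≤ 2 * 1 * (2 * δ ^ 3)⁻¹ := by gcongr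
    _ = (δ ^ 3)⁻¹ := by field_simp

/-- The Bergman kernel of the bidisc. -/
def bidiscKernel (t s : ℂ × ℂ) : ℂ := discKernel t.1 s.1 * discKernel t.2 s.2

/-- The Bergman projection of the bidisc. -/
def bidiscOp (g : ℂ × ℂ → ℂ) (t : ℂ × ℂ) : ℂ := ∫ s, bidiscKernel t s * g s ∂bidisc

theorem measurable_discKernel_left (t : ℂ) : Measurable fun s => discKernel t s := by
  have h : Measurable fun s : ℂ => (Real.pi : ℂ) * (1 - t * conj s) ^ 2 := by
    apply Continuous.measurable; fun_prop
  exact h.inv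

theorem measurable_bidiscKernel :
    Measurable fun x : (ℂ × ℂ) × (ℂ × ℂ) => bidiscKernel x.1 x.2 := by
  have h1 : Measurable fun x : (ℂ × ℂ) × (ℂ × ℂ) =>
      (Real.pi : ℂ) * (1 - x.1.1 * conj x.2.1) ^ 2 := by
    apply Continuous.measurable; fun_prop
  have h2 : Measurable fun x : (ℂ × ℂ) × (ℂ × ℂ) =>
      (Real.pi : ℂ) * (1 - x.1.2 * conj x.2.2) ^ 2 := by
    apply Continuous.measurable; fun_prop
  exact h1.inv.mul h2.inv

theorem measurable_bidiscKernel_left (t : ℂ × ℂ) : Measurable fun s => bidiscKernel t s := by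
  have h1 : Measurable fun s : ℂ × ℂ => (Real.pi : ℂ) * (1 - t.1 * conj s.1) ^ 2 := by
    apply Continuous.measurable; fun_prop
  have h2 : Measurable fun s : ℂ × ℂ => (Real.pi : ℂ) * (1 - t.2 * conj s.2) ^ 2 := by
    apply Continuous.measurable; fun_prop
  exact h1.inv.mul h2.inv

theorem bidiscKernel_conj (t s : ℂ × ℂ) : conj (bidiscKernel t s) = bidiscKernel s t := by
  simp [bidiscKernel, discKernel_conj]

theorem exists_norm_bidiscKernel_le {t : ℂ × ℂ} (ht : t ∈ disc ×ˢ disc) :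
    ∃ C : ℝ, ∀ᵐ s ∂bidisc, ‖bidiscKernel t s‖ ≤ C := by
  have h1 := mem_disc.mp ht.1
  have h2 := mem_disc.mp ht.2
  refine ⟨((1 - ‖t.1‖) ^ 2)⁻¹ * ((1 - ‖t.2‖) ^ 2)⁻¹, ?_⟩
  filter_upwards [ae_bidisc_mem] with s hs
  rw [bidiscKernel, norm_mul]
  gcongr
  · exact norm_discKernel_le (by linarith) (by linarith) hs.1
  · exact norm_discKernel_le (by linarith) (by linarith) hs.2

theorem integrable_bidiscKernel_mul {g : ℂ × ℂ → ℂ} (hg : Integrable g bidisc) {t : ℂ × ℂ}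
    (ht : t ∈ disc ×ˢ disc) : Integrable (fun s => bidiscKernel t s * g s) bidisc := by
  obtain ⟨C, hC⟩ := exists_norm_bidiscKernel_le ht
  exact hg.bdd_mul (measurable_bidiscKernel_left t).aestronglyMeasurable hC

/-- Differentiation under the integral sign: while both coordinates of t keep distance δ from the
circle, the kernel has derivative bounded uniformly in s. -/
theorem differentiableOn_bidiscOp {g : ℂ × ℂ → ℂ} (hg : Integrable g bidisc) :
    DifferentiableOn ℂ (bidiscOp g) (disc ×ˢ disc) := by
  intro t₀ ht₀
  have h1 := mem_disc.mp ht₀.1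
  have h2 := mem_disc.mp ht₀.2
  set m := max ‖t₀.1‖ ‖t₀.2‖ with hm
  have hm1 : m < 1 := max_lt h1 h2
  set δ := (1 - m) / 2 with hδ
  have hδ0 : 0 < δ := by rw [hδ]; linarith
  have hball : ∀ t ∈ Metric.ball t₀ δ, ‖t.1‖ ≤ 1 - δ ∧ ‖t.2‖ ≤ 1 - δ := by
    intro t ht
    rw [Metric.mem_ball, dist_eq_norm] at ht
    have a1 : ‖t.1 - t₀.1‖ < δ := (norm_fst_le (t - t₀)).trans_lt ht
    have a2 : ‖t.2 - t₀.2‖ < δ := (norm_snd_le (t - t₀)).trans_lt ht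
    have b1 := norm_le_norm_add_norm_sub t₀.1 t.1
    have b2 := norm_le_norm_add_norm_sub t₀.2 t.2
    have c1 := le_max_left ‖t₀.1‖ ‖t₀.2‖
    have c2 := le_max_right ‖t₀.1‖ ‖t₀.2‖
    rw [norm_sub_rev] at b1 b2
    constructor <;> linarith
  let k' : ℂ → ℂ → ℂ := fun t s => 2 * conj s * ((Real.pi : ℂ) * (1 - t * conj s) ^ 3)⁻¹
  have hk'm : ∀ t, Measurable (k' t) := by
    intro t
    have a1 : Measurable fun s : ℂ => 2 * conj s := by
      apply Continuous.measurable; fun_prop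
    have a2 : Measurable fun s : ℂ => (Real.pi : ℂ) * (1 - t * conj s) ^ 3 := by
      apply Continuous.measurable; fun_prop
    exact a1.mul a2.inv
  let F' : ℂ × ℂ → ℂ × ℂ → (ℂ × ℂ →L[ℂ] ℂ) := fun t s =>
    (discKernel t.1 s.1 * k' t.2 s.2 * g s) • ContinuousLinearMap.snd ℂ ℂ ℂ +
      (discKernel t.2 s.2 * k' t.1 s.1 * g s) • ContinuousLinearMap.fst ℂ ℂ ℂ
  have key := hasFDerivAt_integral_of_dominated_of_fderiv_le (𝕜 := ℂ) (μ := bidisc)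
    (F := fun t s => bidiscKernel t s * g s) (F' := F') (x₀ := t₀) (s := Metric.ball t₀ δ)
    (bound := fun s => (2 * ((δ ^ 2)⁻¹ * (δ ^ 3)⁻¹)) * ‖g s‖) (Metric.ball_mem_nhds t₀ hδ0)
    (Filter.Eventually.of_forall fun t =>
      (measurable_bidiscKernel_left t).aestronglyMeasurable.mul hg.1)
    (integrable_bidiscKernel_mul hg ht₀) ?_ ?_ (hg.norm.const_mul _) ?_
  · exact key.differentiableAt.differentiableWithinAt
  · refine AEStronglyMeasurable.add ?_ ?_
    · refine AEStronglyMeasurable.smul_const (AEStronglyMeasurable.mul ?_ hg.1) _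
      have b1 : Measurable fun s : ℂ × ℂ => discKernel t₀.1 s.1 :=
        (measurable_discKernel_left t₀.1).comp measurable_fst
      have b2 : Measurable fun s : ℂ × ℂ => k' t₀.2 s.2 := (hk'm t₀.2).comp measurable_snd
      exact (b1.mul b2).aestronglyMeasurable
    · refine AEStronglyMeasurable.smul_const (AEStronglyMeasurable.mul ?_ hg.1) _
      have b1 : Measurable fun s : ℂ × ℂ => discKernel t₀.2 s.2 :=
        (measurable_discKernel_left t₀.2).comp measurable_snd
      have b2 : Measurable fun s : ℂ × ℂ => k' t₀.1 s.1 := (hk'm t₀.1).comp measurable_fst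
      exact (b1.mul b2).aestronglyMeasurable
  · filter_upwards [ae_bidisc_mem] with s hs t ht
    obtain ⟨a1, a2⟩ := hball t ht
    refine (norm_add_le _ _).trans ?_
    have e : ∀ a b : ℂ, ‖a * b * g s‖ = ‖a‖ * ‖b‖ * ‖g s‖ := fun a b => by
      rw [norm_mul, norm_mul]
    rw [norm_smul, norm_smul, e, e]
    have b1 := norm_discKernel_le hδ0 a1 hs.1
    have b2 := norm_discKernel_le hδ0 a2 hs.2
    have b3 : ‖k' t.1 s.1‖ ≤ (δ ^ 3)⁻¹ := norm_discKernel_deriv_le hδ0 a1 hs.1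
    have b4 : ‖k' t.2 s.2‖ ≤ (δ ^ 3)⁻¹ := norm_discKernel_deriv_le hδ0 a2 hs.2
    have b5 := ContinuousLinearMap.norm_fst_le ℂ ℂ ℂ
    have b6 := ContinuousLinearMap.norm_snd_le ℂ ℂ ℂ
    change ‖discKernel t.1 s.1‖ * ‖k' t.2 s.2‖ * ‖g s‖ * _ +
      ‖discKernel t.2 s.2‖ * ‖k' t.1 s.1‖ * ‖g s‖ * _ ≤ _
    clear_value k'
    calc _ ≤ (δ ^ 2)⁻¹ * (δ ^ 3)⁻¹ * ‖g s‖ * 1 + (δ ^ 2)⁻¹ * (δ ^ 3)⁻¹ * ‖g s‖ * 1 := by gcongr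
      _ = _ := by ring
  · filter_upwards [ae_bidisc_mem] with s hs t ht
    obtain ⟨a1, a2⟩ := hball t ht
    have c1 : t.1 ∈ disc := by rw [mem_disc]; linarith
    have c2 : t.2 ∈ disc := by rw [mem_disc]; linarith
    have d1 : HasFDerivAt (fun t : ℂ × ℂ => discKernel t.1 s.1)
        (k' t.1 s.1 • ContinuousLinearMap.fst ℂ ℂ ℂ) t :=
      (hasDerivAt_discKernel c1 hs.1).comp_hasFDerivAt t hasFDerivAt_fst
    have d2 : HasFDerivAt (fun t : ℂ × ℂ => discKernel t.2 s.2)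
        (k' t.2 s.2 • ContinuousLinearMap.snd ℂ ℂ ℂ) t :=
      (hasDerivAt_discKernel c2 hs.2).comp_hasFDerivAt t hasFDerivAt_snd
    refine ((d1.mul d2).mul_const (g s)).congr_fderiv ?_
    ext <;> simp [F', k'] <;> ring

/-- The unweighted case p = 2 of the estimates above. Controlling the modulus of the kernel, and not
merely the operator, yields the absolute convergence needed to apply Fubini for self-adjointness. -/
theorem exists_isFormBound_bidiscKernel : ∃ N : ℝ≥0∞, N ≠ ∞ ∧
    IsFormBound bidisc (fun t s => ‖bidiscKernel t s‖ₑ) 2 2 1 1 N := by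
  have hpq := Real.HolderConjugate.two_two
  have h1 : ∀ U : Set ℂ, (∫⁻ _ in U, (1 : ℝ≥0∞)) * (∫⁻ _ in U, (1 : ℝ≥0∞)) ^ ((2 : ℝ) - 1) ≤
      1 * volume U ^ (2 : ℝ) := by
    intro U
    rw [setLIntegral_one, one_mul, show (2 : ℝ) - 1 = 1 by norm_num, ENNReal.rpow_one,
      ENNReal.rpow_ofNat, sq]
  have h := isFormBound_disc hpq (u := fun _ => 1) (v := fun _ => 1) measurable_const (by simp) (by simp)
    (by simp) (A := 1) (B := 1) (by simp) (h1 disc) (fun ζ r _ _ _ => h1 (lens ζ r))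
  have h2 := IsFormBound.prod measurable_discKernel.enorm measurable_discKernel.enorm hpq
    measurable_const measurable_const measurable_const measurable_const h h
  set N₀ : ℝ≥0∞ := 10 ^ 7 * ((1 : ℝ≥0∞) ^ (1 / (2 : ℝ)) + ENNReal.ofReal (2 * 2) *
    (1 : ℝ≥0∞) ^ max (1 : ℝ) (1 / (2 - 1))) with hN₀
  refine ⟨N₀ * N₀, ?_, ?_⟩
  rotate_left
  · have e : (1 : ℂ × ℂ → ℝ≥0∞) = fun _ => 1 * 1 := by funext x; simp
    have e' : (fun t s => ‖bidiscKernel t s‖ₑ) =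
        fun z w => ‖discKernel z.1 w.1‖ₑ * ‖discKernel z.2 w.2‖ₑ := by
      funext t s
      rw [bidiscKernel, enorm_mul]
    rw [e, e']
    exact h2
  · simp [hN₀, ENNReal.mul_eq_top]

theorem memLp_two_iff {X : Type*} [MeasurableSpace X] {m : Measure X} {f : X → ℂ} :
    MemLp f 2 m ↔ AEStronglyMeasurable f m ∧ ∫⁻ x, ‖f x‖ₑ ^ (2 : ℝ) ∂m < ∞ := by
  rw [MemLp, eLpNorm_lt_top_iff_lintegral_rpow_enorm_lt_top (by norm_num) (by norm_num)]
  simp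

theorem IsFormBound.of_aemeasurable {X : Type*} [MeasurableSpace X] {m : Measure X}
    {k : X → X → ℝ≥0∞} {p q : ℝ} {u v : X → ℝ≥0∞} {N : ℝ≥0∞} (h : IsFormBound m k p q u v N)
    {f g : X → ℝ≥0∞} (hf : AEMeasurable f m) (hg : AEMeasurable g m) :
    ∫⁻ z, ∫⁻ w, k z w * f w * g z ∂m ∂m ≤
      N * ((∫⁻ x, f x ^ p * u x ∂m) ^ (1 / p) * (∫⁻ x, g x ^ q * v x ∂m) ^ (1 / q)) := by
  have h1 := h _ _ hf.measurable_mk hg.measurable_mk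
  have e1 : ∫⁻ z, ∫⁻ w, k z w * f w * g z ∂m ∂m =
      ∫⁻ z, ∫⁻ w, k z w * hf.mk f w * hg.mk g z ∂m ∂m := by
    refine lintegral_congr_ae ?_
    filter_upwards [hg.ae_eq_mk] with z hz
    refine lintegral_congr_ae ?_
    filter_upwards [hf.ae_eq_mk] with w hw
    rw [hz, hw]
  have e2 : ∫⁻ x, f x ^ p * u x ∂m = ∫⁻ x, hf.mk f x ^ p * u x ∂m :=
    lintegral_congr_ae (by filter_upwards [hf.ae_eq_mk] with w hw; rw [hw])
  have e3 : ∫⁻ x, g x ^ q * v x ∂m = ∫⁻ x, hg.mk g x ^ q * v x ∂m :=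
    lintegral_congr_ae (by filter_upwards [hg.ae_eq_mk] with w hw; rw [hw])
  rw [e1, e2, e3]
  exact h1

theorem IsFormBound.lintegral_rpow_le_of_aemeasurable {X : Type*} [MeasurableSpace X]
    {m : Measure X} [SigmaFinite m] {k : X → X → ℝ≥0∞}
    (hk : Measurable fun x : X × X => k x.1 x.2) {p q : ℝ} (hpq : p.HolderConjugate q)
    {u v : X → ℝ≥0∞} (hu : Measurable u) (hu0 : ∀ x, u x ≠ 0)
    (hut : ∀ x, u x ≠ ∞) (hvu : ∀ x, v x = u x ^ (1 - q)) {N : ℝ≥0∞}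
    (h : IsFormBound m k p q u v N) {f : X → ℝ≥0∞} (hf : AEMeasurable f m) :
    (∫⁻ z, (∫⁻ w, k z w * f w ∂m) ^ p * u z ∂m) ^ (1 / p) ≤
      N * (∫⁻ x, f x ^ p * u x ∂m) ^ (1 / p) := by
  have h1 := h.lintegral_rpow_le hk hpq hu hu0 hut hvu hf.measurable_mk
  have e2 : ∫⁻ x, f x ^ p * u x ∂m = ∫⁻ x, hf.mk f x ^ p * u x ∂m :=
    lintegral_congr_ae (by filter_upwards [hf.ae_eq_mk] with w hw; rw [hw])
  have e1 : ∀ z, ∫⁻ w, k z w * f w ∂m = ∫⁻ w, k z w * hf.mk f w ∂m := fun z =>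
    lintegral_congr_ae (by filter_upwards [hf.ae_eq_mk] with w hw; rw [hw])
  simp_rw [e1]
  rw [e2]
  exact h1

theorem aestronglyMeasurable_bidiscOp {g : ℂ × ℂ → ℂ} (hg : Integrable g bidisc) :
    AEStronglyMeasurable (bidiscOp g) bidisc := by
  rw [bidisc_eq]
  exact (differentiableOn_bidiscOp hg).continuousOn.aestronglyMeasurable
    (measurableSet_disc.prod measurableSet_disc)

theorem memLp_bidiscOp {g : ℂ × ℂ → ℂ} (hg : MemLp g 2 bidisc) : MemLp (bidiscOp g) 2 bidisc := by
  obtain ⟨N, hN, hform⟩ := exists_isFormBound_bidiscKernel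
  rw [memLp_two_iff]
  refine ⟨aestronglyMeasurable_bidiscOp (hg.integrable (by norm_num)), ?_⟩
  have h := hform.lintegral_rpow_le_of_aemeasurable measurable_bidiscKernel.enorm
    Real.HolderConjugate.two_two measurable_one (by simp) (by simp) (by simp) hg.1.enorm
  simp only [Pi.one_apply, mul_one] at h
  have h2 : ∫⁻ x, ‖bidiscOp g x‖ₑ ^ (2 : ℝ) ∂bidisc ≤
      ∫⁻ z, (∫⁻ w, ‖bidiscKernel z w‖ₑ * ‖g w‖ₑ ∂bidisc) ^ (2 : ℝ) ∂bidisc := by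
    refine lintegral_mono fun z => ENNReal.rpow_le_rpow ?_ (by norm_num)
    refine (enorm_integral_le_lintegral_enorm _).trans (le_of_eq ?_)
    simp_rw [enorm_mul]
  refine h2.trans_lt ?_
  have h3 : N * (∫⁻ x, ‖g x‖ₑ ^ (2 : ℝ) ∂bidisc) ^ (1 / (2 : ℝ)) < ∞ :=
    ENNReal.mul_lt_top hN.lt_top (ENNReal.rpow_lt_top_of_nonneg (by norm_num)
      (memLp_two_iff.mp hg).2.ne)
  exact (ENNReal.rpow_lt_top_iff_of_pos (by norm_num)).mp (h.trans_lt h3)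

theorem integrable_prod_bidiscKernel {g h : ℂ × ℂ → ℂ} (hg : MemLp g 2 bidisc)
    (hh : MemLp h 2 bidisc) :
    Integrable (fun x : (ℂ × ℂ) × (ℂ × ℂ) => bidiscKernel x.1 x.2 * g x.2 * conj (h x.1))
      (bidisc.prod bidisc) := by
  obtain ⟨N, hN, hform⟩ := exists_isFormBound_bidiscKernel
  have hm : AEStronglyMeasurable
      (fun x : (ℂ × ℂ) × (ℂ × ℂ) => bidiscKernel x.1 x.2 * g x.2 * conj (h x.1))
      (bidisc.prod bidisc) :=
    (measurable_bidiscKernel.aestronglyMeasurable.mul hg.1.comp_snd).mul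
      (Complex.continuous_conj.comp_aestronglyMeasurable hh.1.comp_fst)
  refine ⟨hm, ?_⟩
  rw [hasFiniteIntegral_iff_enorm, lintegral_prod _ hm.enorm]
  have h1 := hform.of_aemeasurable hg.1.enorm hh.1.enorm
  simp only [Pi.one_apply, mul_one] at h1
  refine lt_of_le_of_lt (le_of_eq ?_) (h1.trans_lt (ENNReal.mul_lt_top hN.lt_top
    (ENNReal.mul_lt_top ?_ ?_)))
  · refine lintegral_congr fun t => lintegral_congr fun s => ?_
    rw [enorm_mul, enorm_mul, RCLike.enorm_conj]
  · exact ENNReal.rpow_lt_top_of_nonneg (by norm_num) (memLp_two_iff.mp hg).2.ne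
  · exact ENNReal.rpow_lt_top_of_nonneg (by norm_num) (memLp_two_iff.mp hh).2.ne

/-- Fubini and the Hermitian symmetry of the kernel. -/
theorem integral_bidiscOp_mul_conj {g h : ℂ × ℂ → ℂ} (hg : MemLp g 2 bidisc)
    (hh : MemLp h 2 bidisc) :
    ∫ t, bidiscOp g t * conj (h t) ∂bidisc = ∫ t, g t * conj (bidiscOp h t) ∂bidisc := by
  have hi := integrable_prod_bidiscKernel hg hh
  have hswap := integral_integral_swap (f := fun t s => bidiscKernel t s * g s * conj (h t)) hi
  have e1 : ∀ t, bidiscOp g t * conj (h t) =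
      ∫ s, bidiscKernel t s * g s * conj (h t) ∂bidisc := fun t => by
    rw [bidiscOp, integral_mul_const]
  have e2 : ∀ s, g s * conj (bidiscOp h s) =
      ∫ t, bidiscKernel t s * g s * conj (h t) ∂bidisc := fun s => by
    rw [bidiscOp, ← integral_conj, ← integral_const_mul]
    refine integral_congr_ae (ae_of_all _ fun t => ?_)
    simp only [map_mul, bidiscKernel_conj]
    ring
  simp_rw [e1, e2]
  exact hswap

theorem integrable_sq_of_memLp {X : Type*} [MeasurableSpace X] {m : Measure X} {f : X → ℂ}
    (hf : MemLp f 2 m) : Integrable (fun x => ‖f x‖ ^ 2) m :=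
  (memLp_two_iff_integrable_sq_norm hf.1).mp hf

theorem lintegral_sq_ne_top_of_integrable {X : Type*} [MeasurableSpace X] {m : Measure X} {f : X → ℂ}
    (hf : Integrable (fun x => ‖f x‖ ^ 2) m) : ∫⁻ x, ‖f x‖ₑ ^ (2 : ℝ) ∂m ≠ ∞ := by
  have h := hf.2
  rw [hasFiniteIntegral_iff_enorm] at h
  refine ne_of_lt (lt_of_eq_of_lt ?_ h)
  refine lintegral_congr fun x => ?_
  rw [ENNReal.rpow_ofNat, enorm_pow, enorm_norm]

/-- The Bergman kernel of the bidisc reproduces square integrable functions which are holomorphic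
in the first variable and holomorphic outside of the origin in the second one. -/
theorem ae_bidiscOp_eq_self {g : ℂ × ℂ → ℂ} (hg : MemLp g 2 bidisc)
    (h1 : ∀ t ∈ disc, t ≠ 0 → DifferentiableOn ℂ (fun s => g (s, t)) disc)
    (h2 : ∀ t ∈ disc, DifferentiableOn ℂ (fun s => g (t, s)) (disc \ {0})) :
    ∀ᵐ t ∂bidisc, bidiscOp g t = g t := by
  have hi : Integrable g bidisc := hg.integrable (by norm_num)
  have hi2 := integrable_sq_of_memLp hg
  have a1 : ∀ᵐ s ∂volume.restrict disc, IntegrableOn (fun t => g (s, t)) disc :=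
    Integrable.prod_right_ae (μ := volume.restrict disc) (ν := volume.restrict disc) hi
  have a2 : ∀ᵐ s ∂volume.restrict disc, IntegrableOn (fun t => ‖g (s, t)‖ ^ 2) disc :=
    Integrable.prod_right_ae (μ := volume.restrict disc) (ν := volume.restrict disc) hi2
  have a3 : ∀ᵐ t ∂volume.restrict disc, IntegrableOn (fun s => g (s, t)) disc :=
    Integrable.prod_left_ae (μ := volume.restrict disc) (ν := volume.restrict disc) hi
  have a4 := (Measure.quasiMeasurePreserving_snd (μ := volume.restrict disc)
    (ν := volume.restrict disc)).ae a3
  filter_upwards [ae_bidisc_mem, ae_bidisc_snd_ne_zero, a4] with t ht ht0 hti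
  have hk := integrable_bidiscKernel_mul hi (t := t) ⟨ht.1, ht.2⟩
  rw [bidiscOp, bidisc, integral_prod _ hk, ← setIntegral_discKernel_mul (h1 t.2 ht.2 ht0) hti ht.1]
  refine integral_congr_ae ?_
  filter_upwards [a1, a2, ae_restrict_mem measurableSet_disc] with s hs1 hs2 hs3
  rw [← setIntegral_discKernel_mul_of_punctured (h2 s hs3) (lintegral_sq_ne_top_of_integrable hs2)
    hs1 ht.2 ht0, ← integral_const_mul]
  refine integral_congr_ae (ae_of_all _ fun x => ?_)
  simp only [bidiscKernel]
  ring

/-! ### The Bergman kernel of the Hartogs triangle -/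

/-- The Bergman kernel of the Hartogs triangle. -/
def hartogsKernel (z w : ℂ × ℂ) : ℂ :=
  (z.2 * conj w.2)⁻¹ * bidiscKernel (z.1 / z.2, z.2) (w.1 / w.2, w.2)

theorem fst_div_mem_disc {z : ℂ × ℂ} (hz : z ∈ hartogs) : (z.1 / z.2, z.2) ∈ disc ×ˢ disc := by
  have h0 := norm_pos_iff.mpr (snd_ne_zero_of_mem_hartogs hz)
  refine ⟨?_, mem_disc.mpr hz.2⟩
  rw [mem_disc, norm_div, div_lt_one h0]
  exact hz.1

/-- Dividing the Jacobian |s₂|² by the conjugate of s₂ leaves s₂. This is the pointwise form of the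
conjugacy between the projections of ℍ and of the bidisc under f ↦ t₂ f. -/
theorem norm_sq_mul_hartogsKernel (z : ℂ × ℂ) {s : ℂ × ℂ} (hs : s.2 ≠ 0) (a : ℂ) :
    (‖s.2‖ : ℂ) ^ 2 * (hartogsKernel z (hartogsEquiv s) * a) =
      z.2⁻¹ * (bidiscKernel (z.1 / z.2, z.2) s * (s.2 * a)) := by
  have hc : conj s.2 ≠ 0 := by simpa using hs
  rw [hartogsKernel, hartogsEquiv_fst_div hs, hartogsEquiv_snd, ← Complex.ofReal_pow,
    ← Complex.normSq_eq_norm_sq, Complex.normSq_eq_conj_mul_self, mul_inv]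
  field_simp

theorem integrableOn_hartogsKernel_iff {z : ℂ × ℂ} (hz : z ∈ hartogs) (f : ℂ × ℂ → ℂ) :
    IntegrableOn (fun w => hartogsKernel z w * f w) hartogs ↔
      Integrable (fun s => bidiscKernel (z.1 / z.2, z.2) s * (s.2 * f (hartogsEquiv s))) bidisc := by
  have hz0 := snd_ne_zero_of_mem_hartogs hz
  rw [integrableOn_hartogs_iff, ← integrable_const_mul_iff (IsUnit.mk0 _ (inv_ne_zero hz0))
    (fun s => bidiscKernel (z.1 / z.2, z.2) s * (s.2 * f (hartogsEquiv s)))]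
  refine integrable_congr ?_
  filter_upwards [ae_bidisc_snd_ne_zero] with s hs
  exact norm_sq_mul_hartogsKernel z hs _

theorem setIntegral_hartogsKernel_mul (z : ℂ × ℂ) (f : ℂ × ℂ → ℂ) :
    ∫ w in hartogs, hartogsKernel z w * f w =
      z.2⁻¹ * bidiscOp (fun s => s.2 * f (hartogsEquiv s)) (z.1 / z.2, z.2) := by
  rw [setIntegral_hartogs, bidiscOp, ← integral_const_mul]
  refine integral_congr_ae ?_
  filter_upwards [ae_bidisc_snd_ne_zero] with s hs
  exact norm_sq_mul_hartogsKernel z hs _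

theorem memLp_two_hartogs_iff {f : ℂ × ℂ → ℂ} (hf : AEStronglyMeasurable f (volume.restrict hartogs)) :
    MemLp f 2 (volume.restrict hartogs) ↔ MemLp (fun s => s.2 * f (hartogsEquiv s)) 2 bidisc := by
  rw [memLp_two_iff, memLp_two_iff, setLIntegral_hartogs]
  have h : AEStronglyMeasurable (fun s : ℂ × ℂ => s.2 * f (hartogsEquiv s)) bidisc :=
    measurable_snd.aestronglyMeasurable.mul (aestronglyMeasurable_comp_hartogsEquiv hf)
  simp only [hf, h, true_and]
  simp_rw [enorm_mul, ENNReal.rpow_ofNat, mul_pow]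

theorem measure_hartogs_lt_top : volume hartogs < ∞ := by
  refine lt_of_le_of_lt (measure_mono (t := Metric.ball 0 1) fun z hz => ?_) measure_ball_lt_top
  rw [mem_ball_zero_iff, Prod.norm_def]
  exact max_lt (hz.1.trans hz.2) hz.2

instance : IsFiniteMeasure (volume.restrict hartogs) :=
  isFiniteMeasure_restrict.mpr measure_hartogs_lt_top.ne

theorem memBergman_aestronglyMeasurable {h : ℂ × ℂ → ℂ} (hh : DifferentiableOn ℂ h hartogs) :
    AEStronglyMeasurable h (volume.restrict hartogs) :=
  hh.continuousOn.aestronglyMeasurable measurableSet_hartogs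

theorem memBergman_hartogsKernel {f : ℂ × ℂ → ℂ} (hf : MemLp f 2 (volume.restrict hartogs)) :
    MemBergman hartogs fun z => ∫ w in hartogs, hartogsKernel z w * f w := by
  have hg := (memLp_two_hartogs_iff hf.1).mp hf
  have hd : DifferentiableOn ℂ (fun z => ∫ w in hartogs, hartogsKernel z w * f w) hartogs := by
    simp_rw [setIntegral_hartogsKernel_mul]
    have hs : DifferentiableOn ℂ (fun z : ℂ × ℂ => z.2⁻¹) hartogs := fun z hz =>
      (differentiableAt_snd.inv (snd_ne_zero_of_mem_hartogs hz)).differentiableWithinAt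
    have hc : DifferentiableOn ℂ (fun z : ℂ × ℂ => (z.1 * z.2⁻¹, z.2)) hartogs := fun z hz =>
      ((differentiableAt_fst.mul (differentiableAt_snd.inv
        (snd_ne_zero_of_mem_hartogs hz))).prodMk differentiableAt_snd).differentiableWithinAt
    exact hs.mul ((differentiableOn_bidiscOp (hg.integrable (by norm_num))).comp hc
      fun z hz => fst_div_mem_disc hz)
  refine ⟨hd, (memLp_two_hartogs_iff (memBergman_aestronglyMeasurable hd)).mpr ?_⟩
  refine (memLp_bidiscOp hg).ae_eq ?_
  filter_upwards [ae_bidisc_snd_ne_zero] with t ht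
  rw [setIntegral_hartogsKernel_mul, hartogsEquiv_fst_div ht, hartogsEquiv_snd, ← mul_assoc,
    mul_inv_cancel₀ ht, one_mul]

theorem setIntegral_hartogs_mul_conj (a b : ℂ × ℂ → ℂ) :
    ∫ z in hartogs, a z * conj (b z) =
      ∫ t, (t.2 * a (hartogsEquiv t)) * conj (t.2 * b (hartogsEquiv t)) ∂bidisc := by
  rw [setIntegral_hartogs]
  refine integral_congr_ae (ae_of_all _ fun t => ?_)
  simp only [map_mul]
  rw [← Complex.ofReal_pow, ← Complex.normSq_eq_norm_sq, Complex.normSq_eq_conj_mul_self]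
  ring

theorem integrable_mul_conj {X : Type*} [MeasurableSpace X] {m : Measure X} {a b : X → ℂ}
    (ha : MemLp a 2 m) (hb : MemLp b 2 m) : Integrable (fun x => a x * conj (b x)) m :=
  ha.integrable_mul (q := 2) hb.star

/-- For fixed t₂ ≠ 0 the slice in t₁ is holomorphic on the whole disc, but for fixed t₁ the slice in
t₂ is holomorphic only off the origin. Square integrability repairs the second slice. -/
theorem ae_bidiscOp_eq_of_memBergman {h : ℂ × ℂ → ℂ} (hh : MemBergman hartogs h) :
    ∀ᵐ t ∂bidisc, bidiscOp (fun s => s.2 * h (hartogsEquiv s)) t = t.2 * h (hartogsEquiv t) := by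
  refine ae_bidiscOp_eq_self ((memLp_two_hartogs_iff hh.2.1).mp hh.2) ?_ ?_
  · intro t ht ht0
    refine DifferentiableOn.const_mul ?_ t
    simp_rw [fun s : ℂ => hartogsEquiv_apply (t := (s, t)) ht0]
    refine hh.1.comp (by fun_prop) fun s hs => ?_
    have := (hartogsEquiv_mem_iff (t := (s, t)) ht0).mpr ⟨hs, ht⟩
    rwa [hartogsEquiv_apply (t := (s, t)) ht0] at this
  · intro t ht
    have : DifferentiableOn ℂ (fun s : ℂ => s * h (t * s, s)) (disc \ {0}) := by
      refine differentiableOn_id.mul (hh.1.comp (by fun_prop) fun s hs => ?_)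
      have := (hartogsEquiv_mem_iff (t := (t, s)) hs.2).mpr ⟨ht, hs.1⟩
      rwa [hartogsEquiv_apply (t := (t, s)) hs.2] at this
    refine this.congr fun s hs => ?_
    rw [hartogsEquiv_apply (t := (t, s)) hs.2]

theorem isBergmanKernel_hartogsKernel : IsBergmanKernel hartogs hartogsKernel := by
  intro f hf
  have hg := (memLp_two_hartogs_iff hf.1).mp hf
  refine ⟨fun z hz => (integrableOn_hartogsKernel_iff hz f).mpr
    (integrable_bidiscKernel_mul (hg.integrable (by norm_num)) (fst_div_mem_disc hz)),
    memBergman_hartogsKernel hf, fun h hh => ?_⟩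
  have hP := memBergman_hartogsKernel hf
  have hh' := (memLp_two_hartogs_iff hh.2.1).mp hh.2
  simp_rw [sub_mul]
  rw [integral_sub (integrable_mul_conj hf hh.2) (integrable_mul_conj hP.2 hh.2), sub_eq_zero,
    setIntegral_hartogs_mul_conj, setIntegral_hartogs_mul_conj]
  -- Orthogonality: h is replaced by its own projection, and self-adjointness then moves the
  -- operator onto f.
  have e1 : ∫ t, t.2 * f (hartogsEquiv t) * conj (t.2 * h (hartogsEquiv t)) ∂bidisc =
      ∫ t, t.2 * f (hartogsEquiv t) *
        conj (bidiscOp (fun s => s.2 * h (hartogsEquiv s)) t) ∂bidisc := by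
    refine integral_congr_ae ?_
    filter_upwards [ae_bidiscOp_eq_of_memBergman hh] with t ht
    rw [ht]
  rw [e1, ← integral_bidiscOp_mul_conj hg hh']
  refine integral_congr_ae ?_
  filter_upwards [ae_bidisc_snd_ne_zero] with t ht
  rw [setIntegral_hartogsKernel_mul, hartogsEquiv_fst_div ht, hartogsEquiv_snd, ← mul_assoc t.2,
    mul_inv_cancel₀ ht, one_mul]

/-- The difference of two projections is a Bergman function orthogonal to itself, hence zero almost
everywhere. Continuity on an open set gives equality at every point, which is needed to compare
kernels at a fixed z. -/
theorem IsBergmanProjection.eqOn {f g₁ g₂ : ℂ × ℂ → ℂ} (hf : MemLp f 2 (volume.restrict hartogs))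
    (h₁ : IsBergmanProjection hartogs f g₁) (h₂ : IsBergmanProjection hartogs f g₂) :
    EqOn g₁ g₂ hartogs := by
  have hd : MemBergman hartogs fun z => g₁ z - g₂ z := ⟨h₁.1.1.sub h₂.1.1, h₁.1.2.sub h₂.1.2⟩
  have e1 := h₁.2 _ hd
  have e2 := h₂.2 _ hd
  have e3 : ∫ z in hartogs, (g₁ z - g₂ z) * conj (g₁ z - g₂ z) = 0 := by
    have i1 := integrable_mul_conj (hf.sub h₁.1.2) hd.2
    have i2 := integrable_mul_conj (hf.sub h₂.1.2) hd.2
    have := integral_sub i2 i1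
    simp only [Pi.sub_apply] at this
    rw [e1, e2, sub_zero] at this
    rw [← this]
    refine integral_congr_ae (ae_of_all _ fun z => ?_)
    simp only
    ring
  have e4 : ∫ z in hartogs, ‖g₁ z - g₂ z‖ ^ 2 = 0 := by
    have : ∀ z, (g₁ z - g₂ z) * conj (g₁ z - g₂ z) = ((‖g₁ z - g₂ z‖ ^ 2 : ℝ) : ℂ) := fun z => by
      rw [Complex.mul_conj, Complex.normSq_eq_norm_sq]
    simp_rw [this] at e3
    exact Complex.ofReal_eq_zero.mp ((integral_ofReal (𝕜 := ℂ)
      (f := fun z => ‖g₁ z - g₂ z‖ ^ 2)).symm.trans e3)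
  rw [integral_eq_zero_iff_of_nonneg (fun z => by positivity)
    (integrable_sq_of_memLp hd.2)] at e4
  refine Measure.eqOn_open_of_ae_eq (μ := volume) ?_ isOpen_hartogs h₁.1.1.continuousOn h₂.1.1.continuousOn
  filter_upwards [e4] with z hz
  simpa [sub_eq_zero] using hz

/-- The Bergman kernel of the Hartogs triangle, almost everywhere in the second variable. -/
theorem ae_bergmanKernel_eq {z : ℂ × ℂ} (hz : z ∈ hartogs) :
    ∀ᵐ w ∂volume.restrict hartogs, bergmanKernel hartogs z w = hartogsKernel z w := by
  have hex : ∃ K, IsBergmanKernel hartogs K := ⟨_, isBergmanKernel_hartogsKernel⟩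
  have hK : IsBergmanKernel hartogs (bergmanKernel hartogs) := by
    rw [bergmanKernel, dif_pos hex]
    exact hex.choose_spec
  have hone : MemLp (fun _ : ℂ × ℂ => (1 : ℂ)) 2 (volume.restrict hartogs) := memLp_const 1
  have i1 := (hK _ hone).1 z hz
  have i2 := (isBergmanKernel_hartogsKernel _ hone).1 z hz
  simp only [mul_one] at i1 i2
  have h0 : (fun w => bergmanKernel hartogs z w - hartogsKernel z w) =ᵐ[volume.restrict hartogs] 0 := by
    -- Projecting indicator functions shows that the two kernels have the same integral over every
    -- measurable set.
    refine Integrable.ae_eq_zero_of_forall_setIntegral_eq_zero (i1.sub i2) fun A hA _ => ?_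
    have hind : MemLp (A.indicator fun _ : ℂ × ℂ => (1 : ℂ)) 2 (volume.restrict hartogs) :=
      hone.indicator hA
    have heq := IsBergmanProjection.eqOn hind (hK _ hind).2
      (isBergmanKernel_hartogsKernel _ hind).2 hz
    have e : ∀ k : ℂ × ℂ → ℂ, ∫ w in hartogs, k w * A.indicator (fun _ => (1 : ℂ)) w =
        ∫ w in A, k w ∂volume.restrict hartogs := fun k => by
      rw [← integral_indicator hA]
      refine integral_congr_ae (ae_of_all _ fun w => ?_)
      by_cases hw : w ∈ A <;> simp [hw]
    simp only [e] at heq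
    rw [integral_sub (μ := (volume.restrict hartogs).restrict A) (Integrable.restrict i1) (Integrable.restrict i2), heq, sub_self]
  filter_upwards [h0] with w hw
  simpa [sub_eq_zero] using hw

/-! ### Factorization of the characteristics -/

/-- The supremum of `weightProd` over all tents. -/
def tentChar (p q : ℝ) (W : ℂ → ℝ≥0∞) : ℝ≥0∞ := ⨆ z ∈ disc, weightProd p q W (tent z)

/-- The supremum of `weightProd` over the small tents. -/
def smallTentChar (p q : ℝ) (W : ℂ → ℝ≥0∞) : ℝ≥0∞ :=
  ⨆ z ∈ disc, ⨆ _ : 1 / 2 < ‖z‖, weightProd p q W (tent z)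

theorem weightProd_mul_rpow {p q : ℝ} (hpq : p.HolderConjugate q) (W : ℂ → ℝ≥0∞) {U : Set ℂ}
    (h0 : volume U ≠ 0) (ht : volume U ≠ ∞) :
    (∫⁻ x in U, W x) * (∫⁻ x in U, W x ^ (1 - q)) ^ (p - 1) = weightProd p q W U * volume U ^ p := by
  have hp1 : 0 < p - 1 := sub_pos.mpr hpq.lt
  have e1 : ∀ f : ℂ → ℝ≥0∞, (⨍⁻ x in U, f x ∂volume) * volume U = ∫⁻ x in U, f x := fun f => by
    rw [setLAverage_eq, ENNReal.div_mul_cancel h0 ht]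
  have e2 : volume U ^ p = volume U * volume U ^ (p - 1) := by
    conv_rhs => rw [← ENNReal.rpow_one (volume U), ENNReal.rpow_one (volume U)]
    nth_rewrite 2 [← ENNReal.rpow_one (volume U)]
    rw [← ENNReal.rpow_add _ _ h0 ht]
    congr 1; ring
  rw [← e1 W, ← e1 fun x => W x ^ (1 - q), ENNReal.mul_rpow_of_nonneg _ _ hp1.le, weightProd, e2]
  ring

theorem tent_zero : tent 0 = disc := if_pos rfl

theorem volume_tent_ne_zero {z : ℂ} (hz : z ∈ disc) : volume (tent z) ≠ 0 := by
  by_cases h0 : z = 0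
  · rw [h0, tent_zero]; exact volume_disc_ne_zero
  · rw [tent_of_ne_zero h0]
    have hn := norm_pos_iff.mpr h0
    rw [mem_disc] at hz
    have h := le_volume_lens (ζ := z / ‖z‖) (r := 1 - ‖z‖) (by
      rw [norm_div, Complex.norm_real, norm_norm, div_self hn.ne']) (by linarith) (by linarith)
    refine (lt_of_lt_of_le ?_ h).ne'
    rw [ENNReal.ofReal_pos]
    have : 0 < 1 - ‖z‖ := by linarith
    have := Real.pi_pos
    positivity

theorem volume_tent_ne_top (z : ℂ) : volume (tent z) ≠ ∞ :=
  measure_ne_top_of_subset (tent_subset_disc z) measure_ball_lt_top.ne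

theorem weightProd_ne_zero {p q : ℝ} (hpq : p.HolderConjugate q) {W : ℂ → ℝ≥0∞} (hW : Measurable W)
    (h0 : ∀ x, W x ≠ 0) (ht : ∀ x, W x ≠ ∞) {U : Set ℂ} (hU : volume U ≠ 0) (hUt : volume U ≠ ∞) :
    weightProd p q W U ≠ 0 := by
  have hp1 : 0 < p - 1 := sub_pos.mpr hpq.lt
  have key : ∀ f : ℂ → ℝ≥0∞, Measurable f → (∀ x, f x ≠ 0) → ⨍⁻ x in U, f x ∂volume ≠ 0 := by
    intro f hf hf0
    rw [setLAverage_eq]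
    refine ENNReal.div_ne_zero.mpr ⟨setLIntegral_ne_zero hf hf0 hU, hUt⟩
  refine mul_ne_zero (key _ hW h0) ?_
  rw [Ne, ENNReal.rpow_eq_zero_iff_of_pos hp1]
  refine key _ (hW.pow_const _) fun x => ?_
  simp [ENNReal.rpow_eq_zero_iff, h0, ht]

theorem weightProd_disc_le_tentChar (p q : ℝ) (W : ℂ → ℝ≥0∞) :
    weightProd p q W disc ≤ tentChar p q W := by
  rw [← tent_zero]
  exact le_iSup₂_of_le (f := fun z (_ : z ∈ disc) => weightProd p q W (tent z)) 0
    (by rw [mem_disc]; simp) le_rfl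

theorem smallTentChar_le_tentChar (p q : ℝ) (W : ℂ → ℝ≥0∞) :
    smallTentChar p q W ≤ tentChar p q W :=
  iSup₂_mono fun _ _ => iSup_le fun _ => le_rfl

section Factor

variable {p q : ℝ} {μ : ℂ × ℂ → ℝ} {μ₁ μ₂ : ℂ → ℝ} {W₁ W₂ : ℂ → ℝ≥0∞}

theorem char_eq (hpq : p.HolderConjugate q) (hμ : IsProductWeight μ μ₁ μ₂)
    (hW : IsWeightVersion p μ₁ μ₂ W₁ W₂) : char p μ = tentChar p q W₁ * tentChar p q W₂ := by
  unfold char tentChar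
  simp only [hartogsProd_inducedTent hpq hμ hW, ENNReal.iSup_mul]
  simp only [ENNReal.mul_iSup]

theorem char11_eq (hpq : p.HolderConjugate q) (hμ : IsProductWeight μ μ₁ μ₂)
    (hW : IsWeightVersion p μ₁ μ₂ W₁ W₂) :
    char11 p μ = smallTentChar p q W₁ * smallTentChar p q W₂ := by
  unfold char11 smallTentChar
  simp only [hartogsProd_inducedTent hpq hμ hW, ENNReal.iSup_mul]
  simp only [ENNReal.mul_iSup, iSup_and]
  refine iSup_congr fun z₁ => iSup_congr fun _ => ?_
  by_cases h : 1 / 2 < ‖z₁‖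
  · simp only [h, iSup_true]
  · simp only [h, iSup_false, iSup_bot]

/-- The four summands of the bound are the four terms of an expanded product: the superscripts 0 and
1 record whether a variable contributes its whole-disc term or its small-tent term. -/
theorem upperBound_eq (hpq : p.HolderConjugate q) (hμ : IsProductWeight μ μ₁ μ₂)
    (hW : IsWeightVersion p μ₁ μ₂ W₁ W₂) :
    upperBound p μ μ₁ μ₂ =
      (weightProd p q W₁ disc ^ (1 / p) +
        ENNReal.ofReal (p * q) * smallTentChar p q W₁ ^ max 1 (1 / (p - 1))) *
      (weightProd p q W₂ disc ^ (1 / p) +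
        ENNReal.ofReal (p * q) * smallTentChar p q W₂ ^ max 1 (1 / (p - 1))) := by
  have hp0 := hpq.pos
  have hq0 := hpq.symm.pos
  have e1 : ∀ z, discProd₁ p μ₁ (tent z) = weightProd p q W₁ (tent z) := fun z =>
    discProd₁_eq hpq hW (tent_subset_disc z)
  have e2 : ∀ z, discProd₂ p μ₂ (tent z) = weightProd p q W₂ (tent z) := fun z =>
    discProd₂_eq hpq hW (tent_subset_disc z)
  have hm : 0 ≤ max 1 (1 / (p - 1)) := zero_le_one.trans (le_max_left _ _)
  rw [upperBound, char00_eq hpq hμ hW, char11_eq hpq hμ hW, char10, char01,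
    discProd₁_eq hpq hW subset_rfl, discProd₂_eq hpq hW subset_rfl, (neg_conjExp_div hpq).1]
  simp only [e1, e2]
  rw [← smallTentChar, ← smallTentChar, ENNReal.ofReal_pow (by positivity),
    ENNReal.mul_rpow_of_nonneg _ _ (by positivity), ENNReal.mul_rpow_of_nonneg _ _ hm]
  ring

/-- Since 0 · ∞ = 0 in `ℝ≥0∞`, nonvanishing is what allows finiteness of a product to pass to each
factor. -/
theorem factor_ne_zero (hpq : p.HolderConjugate q) {W : ℂ → ℝ≥0∞} (hW : Measurable W)
    (h0 : ∀ x, W x ≠ 0) (ht : ∀ x, W x ≠ ∞) :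
    weightProd p q W disc ^ (1 / p) +
        ENNReal.ofReal (p * q) * smallTentChar p q W ^ max 1 (1 / (p - 1)) ≠ 0 := by
  have hp0 := hpq.pos
  have h := weightProd_ne_zero hpq hW h0 ht volume_disc_ne_zero measure_ball_lt_top.ne
  intro h'
  rw [add_eq_zero, ENNReal.rpow_eq_zero_iff_of_pos (by positivity)] at h'
  exact h h'.1

theorem finite_of_factor_ne_top (hpq : p.HolderConjugate q) {W : ℂ → ℝ≥0∞}
    (h : weightProd p q W disc ^ (1 / p) +
        ENNReal.ofReal (p * q) * smallTentChar p q W ^ max 1 (1 / (p - 1)) ≠ ∞) :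
    weightProd p q W disc ≠ ∞ ∧ smallTentChar p q W ≠ ∞ := by
  have hp0 := hpq.pos
  have hq0 := hpq.symm.pos
  have hm : 0 < max 1 (1 / (p - 1)) := zero_lt_one.trans_le (le_max_left _ _)
  rw [ENNReal.add_ne_top] at h
  refine ⟨fun h1 => h.1 ?_, fun h1 => h.2 ?_⟩
  · rw [h1, ENNReal.top_rpow_of_pos (by positivity)]
  · rw [h1, ENNReal.top_rpow_of_pos hm, ENNReal.mul_top]
    simp only [ne_eq, ENNReal.ofReal_eq_zero, not_le]
    positivity

theorem factor_ne_top (hpq : p.HolderConjugate q) {W : ℂ → ℝ≥0∞}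
    (h : tentChar p q W ≠ ∞) : weightProd p q W disc ^ (1 / p) +
        ENNReal.ofReal (p * q) * smallTentChar p q W ^ max 1 (1 / (p - 1)) ≠ ∞ := by
  have hp0 := hpq.pos
  have hm : 0 ≤ max 1 (1 / (p - 1)) := zero_le_one.trans (le_max_left _ _)
  have h1 := ne_top_of_le_ne_top h (weightProd_disc_le_tentChar p q W)
  have h2 := ne_top_of_le_ne_top h (smallTentChar_le_tentChar p q W)
  exact ENNReal.add_ne_top.mpr ⟨ENNReal.rpow_ne_top_of_nonneg (by positivity) h1,
    ENNReal.mul_ne_top ENNReal.ofReal_ne_top (ENNReal.rpow_ne_top_of_nonneg hm h2)⟩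

theorem rpow_one_sub_rpow_one_sub (hpq : p.HolderConjugate q) (x : ℝ≥0∞) :
    (x ^ (1 - q)) ^ (1 - p) = x := by
  have hqp := hpq.mul_eq_add
  rw [← ENNReal.rpow_mul, show (1 - q) * (1 - p) = 1 by linarith, ENNReal.rpow_one]

/-- The lenses of radius r < 1/2 are precisely the tents with vertex (1-r)ζ of modulus above 1/2, so
the small-tent supremum supplies the hypothesis on lenses. -/
theorem isFormBound_disc_weight (hpq : p.HolderConjugate q) {W : ℂ → ℝ≥0∞} (hW : Measurable W)
    (h0 : ∀ x, W x ≠ 0) (ht : ∀ x, W x ≠ ∞) (hB : smallTentChar p q W ≠ ∞) :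
    IsFormBound (volume.restrict disc) (fun z w => ‖discKernel z w‖ₑ) p q W (fun x => W x ^ (1 - q))
      (10 ^ 7 * (weightProd p q W disc ^ (1 / p) +
        ENNReal.ofReal (p * q) * smallTentChar p q W ^ max 1 (1 / (p - 1)))) := by
  refine isFormBound_disc hpq (hW.pow_const _) (fun x => ?_) (fun x => ?_)
    (fun x => (rpow_one_sub_rpow_one_sub hpq _).symm) hB
    (weightProd_mul_rpow hpq W volume_disc_ne_zero measure_ball_lt_top.ne).le
    fun ζ r hζ hr hr2 => ?_
  · simp [ENNReal.rpow_eq_zero_iff, h0, ht]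
  · simp [ENNReal.rpow_eq_top_iff, h0, ht]
  · have hn : ‖((1 - r : ℝ) : ℂ) * ζ‖ = 1 - r := by
      rw [norm_mul, hζ, mul_one, Complex.norm_real, Real.norm_of_nonneg (by linarith)]
    have hd : ((1 - r : ℝ) : ℂ) * ζ ∈ disc := by rw [mem_disc, hn]; linarith
    have he : tent (((1 - r : ℝ) : ℂ) * ζ) = lens ζ r := by
      have := tent_eq_lens hζ (r := r) (by linarith)
      simpa using this
    rw [← he, weightProd_mul_rpow hpq W (volume_tent_ne_zero hd) (volume_tent_ne_top _)]
    gcongr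
    exact le_iSup₂_of_le (f := fun z (_ : z ∈ disc) => ⨆ _ : 1 / 2 < ‖z‖, weightProd p q W (tent z))
      _ hd (le_iSup_of_le (by rw [hn]; linarith) le_rfl)

end Factor

/-! ### The upper bound -/

section Upper

variable {p q : ℝ} {μ : ℂ × ℂ → ℝ} {μ₁ μ₂ : ℂ → ℝ} {W₁ W₂ : ℂ → ℝ≥0∞}

theorem IsProductWeight.ae_pos (hμ : IsProductWeight μ μ₁ μ₂) :
    ∀ᵐ z ∂volume.restrict hartogs, 0 < μ z := by
  rw [ae_hartogs_iff]
  filter_upwards [ae_bidisc_snd_ne_zero, ae_bidisc_mem, ae_bidisc_of_ae hμ.pos₁ hμ.pos₂]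
    with t h0 hm hp
  rw [hμ.eq_mul _ ((hartogsEquiv_mem_iff h0).mpr hm), hartogsEquiv_fst_div h0, hartogsEquiv_snd]
  exact mul_pos hp.1 hp.2

theorem IsProductWeight.absolutelyContinuous (hμ : IsProductWeight μ μ₁ μ₂) :
    volume.restrict hartogs ≪ weightedVolume hartogs μ := by
  refine withDensity_absolutelyContinuous'
    hμ.locallyIntegrable.aestronglyMeasurable.aemeasurable.ennreal_ofReal ?_
  filter_upwards [hμ.ae_pos] with z hz
  simpa using hz

theorem measurable_hartogsKernel_left (z : ℂ × ℂ) : Measurable fun w => hartogsKernel z w := by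
  have h1 : Measurable fun w : ℂ × ℂ => (z.2 * conj w.2)⁻¹ := by
    have : Measurable fun w : ℂ × ℂ => z.2 * conj w.2 := by
      apply Continuous.measurable; fun_prop
    exact this.inv
  have h2 : Measurable fun w : ℂ × ℂ => (w.1 / w.2, w.2) :=
    (measurable_fst.div measurable_snd).prodMk measurable_snd
  exact h1.mul ((measurable_bidiscKernel_left _).comp h2)

theorem aestronglyMeasurable_kernelP_mul {f : ℂ × ℂ → ℂ}
    (hf : AEStronglyMeasurable f (volume.restrict hartogs)) {z : ℂ × ℂ} (hz : z ∈ hartogs) :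
    AEStronglyMeasurable (fun w => kernelP z w * f w) (volume.restrict hartogs) := by
  refine ((measurable_hartogsKernel_left z).aestronglyMeasurable.mul hf).congr ?_
  filter_upwards [ae_bergmanKernel_eq hz] with w hw
  rw [kernelP, hw]; rfl

theorem isLpBound_kernelP_of_kernelPplus (hμ : IsProductWeight μ μ₁ μ₂) {C : ℝ≥0∞}
    (h : IsLpBound hartogs kernelPplus p μ C) : IsLpBound hartogs kernelP p μ C := by
  intro f hf
  have hf' : MemLp (fun z => (‖f z‖ : ℂ)) (ENNReal.ofReal p) (weightedVolume hartogs μ) :=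
    hf.norm.ofReal
  have hfm := hf.1.mono_ac hμ.absolutelyContinuous
  have hn : ∀ z w, ‖kernelPplus z w * (‖f w‖ : ℂ)‖ = ‖kernelP z w * f w‖ := fun z w => by
    simp [kernelPplus, kernelP]
  obtain ⟨h1, h2⟩ := h _ hf'
  refine ⟨fun z hz => ?_, ?_⟩
  · exact Integrable.mono (h1 z hz) (aestronglyMeasurable_kernelP_mul hfm hz)
      (ae_of_all _ fun w => (hn z w).symm.le)
  · have e : eLpNorm (fun z => (‖f z‖ : ℂ)) (ENNReal.ofReal p) (weightedVolume hartogs μ) =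
        eLpNorm f (ENNReal.ofReal p) (weightedVolume hartogs μ) :=
      eLpNorm_congr_norm_ae (ae_of_all _ fun z => by simp)
    rw [← e]
    refine (eLpNorm_mono fun z => ?_).trans h2
    refine (norm_integral_le_integral_norm _).trans (le_of_eq ?_)
    have e2 : ∀ w, kernelPplus z w * (‖f w‖ : ℂ) = ((‖kernelP z w * f w‖ : ℝ) : ℂ) := fun w => by
      simp [kernelPplus, kernelP]
    simp_rw [e2]
    have e3 : ∫ w in hartogs, ((‖kernelP z w * f w‖ : ℝ) : ℂ) =
        ((∫ w in hartogs, ‖kernelP z w * f w‖ : ℝ) : ℂ) := integral_ofReal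
    rw [e3, Complex.norm_real, Real.norm_of_nonneg (integral_nonneg fun _ => norm_nonneg _)]

theorem lpOpNorm_kernelP_le (hμ : IsProductWeight μ μ₁ μ₂) :
    lpOpNorm hartogs kernelP p μ ≤ lpOpNorm hartogs kernelPplus p μ :=
  sInf_le_sInf fun _ h => isLpBound_kernelP_of_kernelPplus hμ h

theorem lintegral_dual_ne_top (hpq : p.HolderConjugate q) {W : ℂ → ℝ≥0∞} (hW : Measurable W)
    (h0 : ∀ x, W x ≠ 0) (h : weightProd p q W disc ≠ ∞) : ∫⁻ x in disc, W x ^ (1 - q) ≠ ∞ := by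
  have hp1 : 0 < p - 1 := sub_pos.mpr hpq.lt
  intro h'
  have h1 := weightProd_mul_rpow hpq W volume_disc_ne_zero measure_ball_lt_top.ne
  rw [h', ENNReal.top_rpow_of_pos hp1, ENNReal.mul_top (setLIntegral_ne_zero hW h0
    volume_disc_ne_zero)] at h1
  exact ENNReal.mul_ne_top h (ENNReal.rpow_ne_top_of_nonneg hpq.pos.le measure_ball_lt_top.ne) h1.symm

theorem lintegral_rpow_lt_top_of_memLp (hp : 0 < p) (hμ : IsProductWeight μ μ₁ μ₂)
    (hW : IsWeightVersion p μ₁ μ₂ W₁ W₂) {f : ℂ × ℂ → ℂ}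
    (hf : MemLp f (ENNReal.ofReal p) (weightedVolume hartogs μ)) :
    ∫⁻ t, ‖t.2 * f (hartogsEquiv t)‖ₑ ^ p * (W₁ t.1 * W₂ t.2) ∂bidisc < ∞ := by
  have h := hf.2
  rw [eLpNorm_weightedVolume hp hμ hW, ENNReal.rpow_lt_top_iff_of_pos (by positivity)] at h
  simpa only [enorm_mul] using h

/-- Hölder against the dual weight, whose total mass is finite as soon as the whole-disc quantities
are. Because the kernel is bounded in s for each fixed t, this secures absolute convergence at every
point and not only almost everywhere. -/
theorem integrable_of_memLp (hpq : p.HolderConjugate q) (hμ : IsProductWeight μ μ₁ μ₂)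
    (hW : IsWeightVersion p μ₁ μ₂ W₁ W₂) (h₁ : weightProd p q W₁ disc ≠ ∞)
    (h₂ : weightProd p q W₂ disc ≠ ∞) {f : ℂ × ℂ → ℂ}
    (hf : MemLp f (ENNReal.ofReal p) (weightedVolume hartogs μ)) :
    Integrable (fun t => t.2 * f (hartogsEquiv t)) bidisc := by
  have hm : AEStronglyMeasurable (fun t : ℂ × ℂ => t.2 * f (hartogsEquiv t)) bidisc :=
    measurable_snd.aestronglyMeasurable.mul
      (aestronglyMeasurable_comp_hartogsEquiv (hf.1.mono_ac hμ.absolutelyContinuous))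
  refine ⟨hm, ?_⟩
  rw [hasFiniteIntegral_iff_enorm]
  have hfin := lintegral_rpow_lt_top_of_memLp hpq.pos hμ hW hf
  have hvm₁ : Measurable fun x => W₁ x ^ (1 - q) := hW.meas₁.pow_const _
  have hvm₂ : Measurable fun x => W₂ x ^ (1 - q) := hW.meas₂.pow_const _
  have hne : ∀ (a b : ℝ≥0∞), a ≠ 0 → a ≠ ∞ → b ≠ 0 → b ≠ ∞ →
      a ^ (1 - q) * b ^ (1 - q) ≠ 0 ∧ a ^ (1 - q) * b ^ (1 - q) ≠ ∞ ∧
      a * b = (a ^ (1 - q) * b ^ (1 - q)) ^ (1 - p) := by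
    intro a b ha ha' hb hb'
    have hab := mul_ne_zero ha hb
    have hab' := ENNReal.mul_ne_top ha' hb'
    rw [← ENNReal.mul_rpow_of_ne_top ha' hb']
    refine ⟨?_, ?_, (rpow_one_sub_rpow_one_sub hpq _).symm⟩
    · simp [ENNReal.rpow_eq_zero_iff, hab, hab']
    · simp [ENNReal.rpow_eq_top_iff, hab, hab']
  have hh := lintegral_le_mul_rpow (m := bidisc) hpq (u := fun t : ℂ × ℂ => W₁ t.1 * W₂ t.2)
    (v := fun t : ℂ × ℂ => W₁ t.1 ^ (1 - q) * W₂ t.2 ^ (1 - q))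
    ((hvm₁.comp measurable_fst).mul (hvm₂.comp measurable_snd))
    (fun t => (hne _ _ (hW.ne_zero₁ t.1) (hW.ne_top₁ t.1) (hW.ne_zero₂ t.2) (hW.ne_top₂ t.2)).1)
    (fun t => (hne _ _ (hW.ne_zero₁ t.1) (hW.ne_top₁ t.1) (hW.ne_zero₂ t.2) (hW.ne_top₂ t.2)).2.1)
    (fun t => (hne _ _ (hW.ne_zero₁ t.1) (hW.ne_top₁ t.1) (hW.ne_zero₂ t.2) (hW.ne_top₂ t.2)).2.2)
    hm.enorm.measurable_mk
  have e1 : ∫⁻ t, hm.enorm.mk _ t ∂bidisc = ∫⁻ t, ‖t.2 * f (hartogsEquiv t)‖ₑ ∂bidisc :=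
    lintegral_congr_ae hm.enorm.ae_eq_mk.symm
  have e2 : ∫⁻ t, hm.enorm.mk _ t ^ p * (W₁ t.1 * W₂ t.2) ∂bidisc =
      ∫⁻ t, ‖t.2 * f (hartogsEquiv t)‖ₑ ^ p * (W₁ t.1 * W₂ t.2) ∂bidisc :=
    lintegral_congr_ae (by filter_upwards [hm.enorm.ae_eq_mk] with t ht; rw [ht])
  have e3 : ∫⁻ t : ℂ × ℂ, W₁ t.1 ^ (1 - q) * W₂ t.2 ^ (1 - q) ∂bidisc =
      (∫⁻ x in disc, W₁ x ^ (1 - q)) * ∫⁻ x in disc, W₂ x ^ (1 - q) := by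
    rw [bidisc]
    exact lintegral_prod_mul hvm₁.aemeasurable hvm₂.aemeasurable
  rw [e1, e2, e3] at hh
  refine hh.trans_lt (ENNReal.mul_lt_top ?_ ?_)
  · exact ENNReal.rpow_lt_top_of_nonneg (by have := hpq.pos; positivity) hfin.ne
  · exact ENNReal.rpow_lt_top_of_nonneg (by have := hpq.symm.pos; positivity)
      (ENNReal.mul_ne_top (lintegral_dual_ne_top hpq hW.meas₁ hW.ne_zero₁ h₁)
        (lintegral_dual_ne_top hpq hW.meas₂ hW.ne_zero₂ h₂))

theorem enorm_kernelPplus_mul_le {f : ℂ × ℂ → ℂ} {t : ℂ × ℂ} (h0 : t.2 ≠ 0)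
    (ht : t.1 ∈ disc ∧ t.2 ∈ disc) :
    ‖t.2‖ₑ * ‖∫ w in hartogs, kernelPplus (hartogsEquiv t) w * f w‖ₑ ≤
      ∫⁻ s, ‖bidiscKernel t s‖ₑ * ‖s.2 * f (hartogsEquiv s)‖ₑ ∂bidisc := by
  have hz := (hartogsEquiv_mem_iff h0).mpr ht
  have ha := ae_hartogs_iff.mp (ae_bergmanKernel_eq hz)
  calc ‖t.2‖ₑ * ‖∫ w in hartogs, kernelPplus (hartogsEquiv t) w * f w‖ₑ
      ≤ ‖t.2‖ₑ * ∫⁻ w in hartogs, ‖kernelPplus (hartogsEquiv t) w * f w‖ₑ := by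
        gcongr; exact enorm_integral_le_lintegral_enorm _
    _ = ∫⁻ s, ‖t.2‖ₑ * (‖s.2‖ₑ ^ 2 * ‖kernelPplus (hartogsEquiv t) (hartogsEquiv s) *
          f (hartogsEquiv s)‖ₑ) ∂bidisc := by
        rw [setLIntegral_hartogs, lintegral_const_mul' _ _ (by simp)]
    _ = _ := by
        refine lintegral_congr_ae ?_
        filter_upwards [ha, ae_bidisc_snd_ne_zero] with s hs hs0
        have e := norm_sq_mul_hartogsKernel (hartogsEquiv t) hs0 (f (hartogsEquiv s))
        rw [hartogsEquiv_fst_div h0, hartogsEquiv_snd] at e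
        have e' := congrArg (fun x : ℂ => ‖x‖ₑ) e
        simp only [enorm_mul, enorm_pow] at e'
        have hns : ‖((‖s.2‖ : ℝ) : ℂ)‖ₑ = ‖s.2‖ₑ := by
          rw [← ofReal_norm, Complex.norm_real, norm_norm, ofReal_norm]
        have hnk : ‖kernelPplus (hartogsEquiv t) (hartogsEquiv s)‖ₑ =
            ‖hartogsKernel (hartogsEquiv t) (hartogsEquiv s)‖ₑ := by
          rw [kernelPplus, hs, ← ofReal_norm, Complex.norm_real, norm_norm, ofReal_norm]
        rw [hns] at e'
        rw [enorm_mul, hnk, enorm_mul, e', ← mul_assoc, enorm_inv h0,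
          ENNReal.mul_inv_cancel (by simpa using h0) (by simp), one_mul]

theorem integrableOn_kernelPplus_mul {f : ℂ × ℂ → ℂ}
    (hf : AEStronglyMeasurable f (volume.restrict hartogs))
    (hi : Integrable (fun t => t.2 * f (hartogsEquiv t)) bidisc) {z : ℂ × ℂ} (hz : z ∈ hartogs) :
    IntegrableOn (fun w => kernelPplus z w * f w) hartogs := by
  have h1 := (integrableOn_hartogsKernel_iff hz f).mpr
    (integrable_bidiscKernel_mul hi (fst_div_mem_disc hz))
  refine Integrable.mono h1 ?_ ?_
  · have h2 : AEStronglyMeasurable (fun w => ((‖hartogsKernel z w‖ : ℝ) : ℂ) * f w)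
        (volume.restrict hartogs) :=
      (Complex.measurable_ofReal.comp
        (measurable_hartogsKernel_left z).norm).aestronglyMeasurable.mul hf
    refine h2.congr ?_
    filter_upwards [ae_bergmanKernel_eq hz] with w hw
    rw [kernelPplus, hw]
  · filter_upwards [ae_bergmanKernel_eq hz] with w hw
    rw [kernelPplus, hw]
    simp

/-- Each variable contributes 10⁷ times its factor of U_p, whence 10¹⁴. -/
theorem isLpBound_kernelPplus (hpq : p.HolderConjugate q) (hμ : IsProductWeight μ μ₁ μ₂)
    (hW : IsWeightVersion p μ₁ μ₂ W₁ W₂) (hU : upperBound p μ μ₁ μ₂ ≠ ∞) :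
    IsLpBound hartogs kernelPplus p μ (10 ^ 14 * upperBound p μ μ₁ μ₂) := by
  rw [upperBound_eq hpq hμ hW] at hU ⊢
  have hf₁ := factor_ne_zero hpq hW.meas₁ hW.ne_zero₁ hW.ne_top₁
  have hf₂ := factor_ne_zero hpq hW.meas₂ hW.ne_zero₂ hW.ne_top₂
  obtain ⟨ha₁, hb₁⟩ := finite_of_factor_ne_top hpq (W := W₁)
    (fun h => hU (by rw [h, ENNReal.top_mul hf₂]))
  obtain ⟨ha₂, hb₂⟩ := finite_of_factor_ne_top hpq (W := W₂)
    (fun h => hU (by rw [h, ENNReal.mul_top hf₁]))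
  have hprod := IsFormBound.prod measurable_discKernel.enorm measurable_discKernel.enorm hpq
    hW.meas₁ (hW.meas₁.pow_const _) hW.meas₂ (hW.meas₂.pow_const _)
    (isFormBound_disc_weight hpq hW.meas₁ hW.ne_zero₁ hW.ne_top₁ hb₁)
    (isFormBound_disc_weight hpq hW.meas₂ hW.ne_zero₂ hW.ne_top₂ hb₂)
  have hk : (fun z w : ℂ × ℂ => ‖discKernel z.1 w.1‖ₑ * ‖discKernel z.2 w.2‖ₑ) =
      fun t s => ‖bidiscKernel t s‖ₑ := by
    funext t s
    rw [bidiscKernel, enorm_mul]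
  rw [hk, ← bidisc] at hprod
  intro f hf
  have hfm := hf.1.mono_ac hμ.absolutelyContinuous
  have hi := integrable_of_memLp hpq hμ hW ha₁ ha₂ hf
  refine ⟨fun z hz => integrableOn_kernelPplus_mul hfm hi hz, ?_⟩
  have hum : Measurable fun t : ℂ × ℂ => W₁ t.1 * W₂ t.2 :=
    (hW.meas₁.comp measurable_fst).mul (hW.meas₂.comp measurable_snd)
  have hmain := hprod.lintegral_rpow_le_of_aemeasurable measurable_bidiscKernel.enorm hpq
    hum (fun t => mul_ne_zero (hW.ne_zero₁ _) (hW.ne_zero₂ _))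
    (fun t => ENNReal.mul_ne_top (hW.ne_top₁ _) (hW.ne_top₂ _))
    (fun t => (ENNReal.mul_rpow_of_ne_top (hW.ne_top₁ _) (hW.ne_top₂ _) _).symm) hi.1.enorm
  rw [eLpNorm_weightedVolume hpq.pos hμ hW, eLpNorm_weightedVolume hpq.pos hμ hW]
  have hp0 := hpq.pos
  refine (ENNReal.rpow_le_rpow (lintegral_mono_ae ?_) (by positivity)).trans (hmain.trans (le_of_eq ?_))
  · filter_upwards [ae_bidisc_snd_ne_zero, ae_bidisc_mem] with t h0 ht
    gcongr
    exact enorm_kernelPplus_mul_le h0 ht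
  · simp_rw [enorm_mul]
    ring

theorem lpOpNorm_kernelPplus_le (hpq : p.HolderConjugate q) (hμ : IsProductWeight μ μ₁ μ₂) :
    lpOpNorm hartogs kernelPplus p μ ≤ 10 ^ 14 * upperBound p μ μ₁ μ₂ := by
  obtain ⟨W₁, W₂, hW⟩ := hμ.exists_isWeightVersion p
  by_cases hU : upperBound p μ μ₁ μ₂ = ∞
  · rw [hU, ENNReal.mul_top (by norm_num)]
    exact le_top
  · exact sInf_le (isLpBound_kernelPplus hpq hμ hW hU)

theorem isBoundedOnLp_of_char_lt_top (hpq : p.HolderConjugate q) (hμ : IsProductWeight μ μ₁ μ₂)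
    (h : char p μ < ∞) : IsBoundedOnLp hartogs kernelP p μ := by
  obtain ⟨W₁, W₂, hW⟩ := hμ.exists_isWeightVersion p
  rw [char_eq hpq hμ hW] at h
  have key : ∀ W : ℂ → ℝ≥0∞, Measurable W → (∀ x, W x ≠ 0) → (∀ x, W x ≠ ∞) →
      tentChar p q W ≠ 0 := fun W hm h0 ht h' =>
    weightProd_ne_zero hpq hm h0 ht volume_disc_ne_zero measure_ball_lt_top.ne
      (nonpos_iff_eq_zero.mp (h' ▸ weightProd_disc_le_tentChar p q W))
  have h₁ : tentChar p q W₁ ≠ ∞ := fun h' => by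
    rw [h', ENNReal.top_mul (key _ hW.meas₂ hW.ne_zero₂ hW.ne_top₂)] at h
    exact lt_irrefl _ h
  have h₂ : tentChar p q W₂ ≠ ∞ := fun h' => by
    rw [h', ENNReal.mul_top (key _ hW.meas₁ hW.ne_zero₁ hW.ne_top₁)] at h
    exact lt_irrefl _ h
  have hU : upperBound p μ μ₁ μ₂ ≠ ∞ := by
    rw [upperBound_eq hpq hμ hW]
    exact ENNReal.mul_ne_top (factor_ne_top hpq h₁) (factor_ne_top hpq h₂)
  have hb := isLpBound_kernelP_of_kernelPplus hμ (isLpBound_kernelPplus hpq hμ hW hU)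
  refine ⟨(10 ^ 14 * upperBound p μ μ₁ μ₂).toNNReal, ?_⟩
  rwa [ENNReal.coe_toNNReal (ENNReal.mul_ne_top (by simp) hU)]

end Upper

/-! ### Lower bounds for the norm of the Bergman projection -/

section Lower

variable {p q : ℝ} {μ : ℂ × ℂ → ℝ} {μ₁ μ₂ : ℂ → ℝ} {W₁ W₂ : ℂ → ℝ≥0∞}

/-- The transfer in the other direction: a bound on ℍ is tested on f(w) = F(w₁/w₂, w₂)/w₂, for which
t₂ f is F off a null set. -/
theorem IsLpBound.bidiscOp_le (hpq : p.HolderConjugate q) (hμ : IsProductWeight μ μ₁ μ₂)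
    (hW : IsWeightVersion p μ₁ μ₂ W₁ W₂) {N : ℝ≥0∞} (hN : IsLpBound hartogs kernelP p μ N)
    {F : ℂ × ℂ → ℂ} (hF : Measurable F)
    (hfin : ∫⁻ t, ‖F t‖ₑ ^ p * (W₁ t.1 * W₂ t.2) ∂bidisc < ∞) :
    (∀ᵐ t ∂bidisc, Integrable (fun s => bidiscKernel t s * F s) bidisc) ∧
      (∫⁻ t, ‖bidiscOp F t‖ₑ ^ p * (W₁ t.1 * W₂ t.2) ∂bidisc) ^ (1 / p) ≤
        N * (∫⁻ t, ‖F t‖ₑ ^ p * (W₁ t.1 * W₂ t.2) ∂bidisc) ^ (1 / p) := by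
  have hp0 := hpq.pos
  set f : ℂ × ℂ → ℂ := fun w => F (w.1 / w.2, w.2) / w.2 with hf
  have hfm : Measurable f :=
    (hF.comp ((measurable_fst.div measurable_snd).prodMk measurable_snd)).div measurable_snd
  have hfe : ∀ s : ℂ × ℂ, s.2 ≠ 0 → s.2 * f (hartogsEquiv s) = F s := by
    intro s hs
    rw [hf]
    simp only
    rw [hartogsEquiv_fst_div hs, hartogsEquiv_snd]
    field_simp
  have hae : (fun s : ℂ × ℂ => s.2 * f (hartogsEquiv s)) =ᵐ[bidisc] F := by
    filter_upwards [ae_bidisc_snd_ne_zero] with s hs using hfe s hs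
  have hnorm : eLpNorm f (ENNReal.ofReal p) (weightedVolume hartogs μ) =
      (∫⁻ t, ‖F t‖ₑ ^ p * (W₁ t.1 * W₂ t.2) ∂bidisc) ^ (1 / p) := by
    rw [eLpNorm_weightedVolume hp0 hμ hW]
    congr 1
    refine lintegral_congr_ae ?_
    filter_upwards [hae] with s hs
    rw [← enorm_mul, hs]
  have hmem : MemLp f (ENNReal.ofReal p) (weightedVolume hartogs μ) :=
    ⟨hfm.aestronglyMeasurable, by
      rw [hnorm]; exact ENNReal.rpow_lt_top_of_nonneg (by positivity) hfin.ne⟩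
  obtain ⟨h1, h2⟩ := hN f hmem
  constructor
  · filter_upwards [ae_bidisc_snd_ne_zero, ae_bidisc_mem] with t h0 ht
    have hz := (hartogsEquiv_mem_iff h0).mpr ht
    have h3 : IntegrableOn (fun w => hartogsKernel (hartogsEquiv t) w * f w) hartogs := by
      refine Integrable.congr (h1 _ hz) ?_
      filter_upwards [ae_bergmanKernel_eq hz] with w hw
      rw [kernelP, hw]
    have h4 := (integrableOn_hartogsKernel_iff hz f).mp h3
    rw [hartogsEquiv_fst_div h0, hartogsEquiv_snd] at h4
    refine h4.congr ?_
    filter_upwards [hae] with s hs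
    rw [hs]
  · rw [hnorm, eLpNorm_weightedVolume hp0 hμ hW] at h2
    refine le_trans (le_of_eq ?_) h2
    congr 1
    refine lintegral_congr_ae ?_
    filter_upwards [ae_bidisc_snd_ne_zero, ae_bidisc_mem] with t h0 ht
    have hz := (hartogsEquiv_mem_iff h0).mpr ht
    have h3 : ∫ w in hartogs, kernelP (hartogsEquiv t) w * f w =
        ∫ w in hartogs, hartogsKernel (hartogsEquiv t) w * f w := by
      refine integral_congr_ae ?_
      filter_upwards [ae_bergmanKernel_eq hz] with w hw
      rw [kernelP, hw]
    have h4 : bidiscOp (fun s => s.2 * f (hartogsEquiv s)) t = bidiscOp F t := by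
      refine integral_congr_ae ?_
      filter_upwards [hae] with s hs
      rw [hs]
    rw [h3, setIntegral_hartogsKernel_mul, hartogsEquiv_fst_div h0, hartogsEquiv_snd, h4,
      enorm_mul, enorm_inv h0, ← mul_assoc ‖t.2‖ₑ, ENNReal.mul_inv_cancel (by simpa using h0)
      (by simp), one_mul]

/-- Lower bounds for the real part of the kernel bound the norm of the projection from below. -/
theorem IsLpBound.lintegral_le (hpq : p.HolderConjugate q) (hμ : IsProductWeight μ μ₁ μ₂)
    (hW : IsWeightVersion p μ₁ μ₂ W₁ W₂) {N : ℝ≥0∞} (hN : IsLpBound hartogs kernelP p μ N)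
    {Θ Θ' : Set (ℂ × ℂ)} (hΘ : MeasurableSet Θ) (hΘ' : MeasurableSet Θ')
    {k : ℂ × ℂ → ℂ × ℂ → ℝ≥0∞}
    (hk : ∀ t ∈ Θ', ∀ s ∈ Θ, 0 ≤ (bidiscKernel t s).re ∧ k t s ≤ ENNReal.ofReal (bidiscKernel t s).re)
    {φ : ℂ × ℂ → ℝ≥0} (hφ : Measurable φ)
    (hfin : ∫⁻ s in Θ, (φ s : ℝ≥0∞) ^ p * (W₁ s.1 * W₂ s.2) ∂bidisc < ∞) :
    (∫⁻ t in Θ', (∫⁻ s in Θ, k t s * φ s ∂bidisc) ^ p * (W₁ t.1 * W₂ t.2) ∂bidisc) ^ (1 / p) ≤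
      N * (∫⁻ s in Θ, (φ s : ℝ≥0∞) ^ p * (W₁ s.1 * W₂ s.2) ∂bidisc) ^ (1 / p) := by
  have hp0 := hpq.pos
  set F : ℂ × ℂ → ℂ := Θ.indicator fun s => ((φ s : ℝ) : ℂ) with hFdef
  have hF : Measurable F :=
    (Complex.measurable_ofReal.comp hφ.coe_nnreal_real).indicator hΘ
  have hFn : ∫⁻ s, ‖F s‖ₑ ^ p * (W₁ s.1 * W₂ s.2) ∂bidisc =
      ∫⁻ s in Θ, (φ s : ℝ≥0∞) ^ p * (W₁ s.1 * W₂ s.2) ∂bidisc := by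
    rw [← lintegral_indicator hΘ]
    refine lintegral_congr fun s => ?_
    by_cases hs : s ∈ Θ
    · have : ‖((φ s : ℝ) : ℂ)‖ₑ = φ s := by
        rw [← ofReal_norm, Complex.norm_real, Real.norm_of_nonneg (φ s).coe_nonneg,
          ENNReal.ofReal_coe_nnreal]
      rw [indicator_of_mem hs, hFdef, indicator_of_mem hs, this]
    · rw [indicator_of_notMem hs, hFdef, indicator_of_notMem hs, enorm_zero,
        ENNReal.zero_rpow_of_pos hp0, zero_mul]
  obtain ⟨h1, h2⟩ := hN.bidiscOp_le hpq hμ hW hF (hFn ▸ hfin)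
  rw [hFn] at h2
  refine le_trans (ENNReal.rpow_le_rpow ?_ (by positivity)) h2
  refine le_trans ?_ (setLIntegral_le_lintegral Θ' _)
  refine setLIntegral_mono_ae' hΘ' ?_
  filter_upwards [h1] with t hi ht
  gcongr
  have e1 : (bidiscOp F t).re = ∫ s, (bidiscKernel t s * F s).re ∂bidisc :=
    (integral_re hi).symm
  have e2 : ∀ s, 0 ≤ (bidiscKernel t s * F s).re := by
    intro s
    by_cases hs : s ∈ Θ
    · rw [hFdef, indicator_of_mem hs, Complex.re_mul_ofReal]
      exact mul_nonneg (hk t ht s hs).1 (φ s).2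
    · rw [hFdef, indicator_of_notMem hs, mul_zero, Complex.zero_re]
  calc ∫⁻ s in Θ, k t s * φ s ∂bidisc
      ≤ ∫⁻ s in Θ, ENNReal.ofReal (bidiscKernel t s * F s).re ∂bidisc := by
        refine setLIntegral_mono' hΘ fun s hs => ?_
        rw [hFdef, indicator_of_mem hs, Complex.re_mul_ofReal,
          ENNReal.ofReal_mul (hk t ht s hs).1, ENNReal.ofReal_coe_nnreal]
        gcongr
        exact (hk t ht s hs).2
    _ ≤ ∫⁻ s, ENNReal.ofReal (bidiscKernel t s * F s).re ∂bidisc := setLIntegral_le_lintegral _ _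
    _ = ENNReal.ofReal (bidiscOp F t).re := by
        rw [e1]
        exact (ofReal_integral_eq_lintegral_ofReal hi.re (ae_of_all _ e2)).symm
    _ ≤ ‖bidiscOp F t‖ₑ := by
        rw [← ofReal_norm]
        exact ENNReal.ofReal_le_ofReal (Complex.re_le_norm _)

/-! ### Regions where the kernel has almost constant argument -/

theorem le_re_inv {u : ℂ} (hu : ‖u - 1‖ ≤ 1 / 2) : 2 / 9 ≤ (u⁻¹).re := by
  have h1 := Complex.abs_re_le_norm (u - 1)
  rw [Complex.sub_re, Complex.one_re] at h1
  have h2 : 1 / 2 ≤ u.re := by have := abs_le.mp (h1.trans hu); linarith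
  have h3 : ‖u‖ ≤ 3 / 2 := by
    have := norm_le_norm_add_norm_sub (1 : ℂ) u
    rw [norm_sub_rev, norm_one] at this
    linarith
  have h4 : 0 < ‖u‖ := by
    rw [norm_pos_iff]; rintro rfl; simp at h2; linarith
  rw [Complex.inv_re, Complex.normSq_eq_norm_sq, le_div_iff₀ (by positivity)]
  nlinarith

/-- After division by ρ₁ and ρ₂ both factors are within 1/10 of 1, hence their product within 21/100
and its square within 1/2. The tolerance 1/10 is what two variables and the square can afford while
the real part stays positive. -/
theorem le_re_bidiscKernel {t s : ℂ × ℂ} {ρ₁ ρ₂ : ℝ} (h₁ : 0 < ρ₁) (h₂ : 0 < ρ₂)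
    (ht₁ : ‖1 - t.1 * conj s.1 - ρ₁‖ ≤ ρ₁ / 10) (ht₂ : ‖1 - t.2 * conj s.2 - ρ₂‖ ≤ ρ₂ / 10) :
    (50 * (ρ₁ * ρ₂) ^ 2)⁻¹ ≤ (bidiscKernel t s).re := by
  have aux : ∀ {a : ℂ} {ρ : ℝ}, 0 < ρ → ‖a - ρ‖ ≤ ρ / 10 → ‖a / ρ - 1‖ ≤ 1 / 10 := by
    intro a ρ hρ h
    have hρ' : (ρ : ℂ) ≠ 0 := by exact_mod_cast hρ.ne'
    have e : a / ρ - 1 = (a - ρ) / ρ := by field_simp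
    rw [e, norm_div, Complex.norm_real, Real.norm_of_nonneg hρ.le, div_le_iff₀ hρ]
    linarith
  set u := (1 - t.1 * conj s.1) / ρ₁ with hu
  set v := (1 - t.2 * conj s.2) / ρ₂ with hv
  have hu1 : ‖u - 1‖ ≤ 1 / 10 := aux h₁ ht₁
  have hv1 : ‖v - 1‖ ≤ 1 / 10 := aux h₂ ht₂
  have huv : ‖u * v - 1‖ ≤ 21 / 100 := by
    have e : u * v - 1 = (u - 1) * (v - 1) + (u - 1) + (v - 1) := by ring
    rw [e]
    refine (norm_add₃_le).trans ?_
    rw [norm_mul]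
    nlinarith [norm_nonneg (u - 1), norm_nonneg (v - 1)]
  have huv2 : ‖(u * v) ^ 2 - 1‖ ≤ 1 / 2 := by
    have e : (u * v) ^ 2 - 1 = (u * v - 1) * (u * v - 1) + (u * v - 1) + (u * v - 1) := by ring
    rw [e]
    refine (norm_add₃_le).trans ?_
    rw [norm_mul]
    nlinarith [norm_nonneg (u * v - 1)]
  have hre := le_re_inv huv2
  have hρ₁ : (ρ₁ : ℂ) ≠ 0 := by exact_mod_cast h₁.ne'
  have hρ₂ : (ρ₂ : ℂ) ≠ 0 := by exact_mod_cast h₂.ne'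
  have e : bidiscKernel t s = ((Real.pi ^ 2 * (ρ₁ * ρ₂) ^ 2 : ℝ) : ℂ)⁻¹ * ((u * v) ^ 2)⁻¹ := by
    have e1 : 1 - t.1 * conj s.1 = u * ρ₁ := by rw [hu]; field_simp
    have e2 : 1 - t.2 * conj s.2 = v * ρ₂ := by rw [hv]; field_simp
    rw [bidiscKernel, discKernel, discKernel, e1, e2, ← mul_inv, ← mul_inv]
    push_cast
    congr 1
    ring
  rw [e, ← Complex.ofReal_inv, Complex.re_ofReal_mul]
  have hπ : Real.pi ^ 2 ≤ 10 := by nlinarith [Real.pi_lt_d2, Real.pi_gt_three]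
  have hπ0 := Real.pi_pos
  have h5 : (10 * (ρ₁ * ρ₂) ^ 2)⁻¹ ≤ (Real.pi ^ 2 * (ρ₁ * ρ₂) ^ 2)⁻¹ := by gcongr
  calc (50 * (ρ₁ * ρ₂) ^ 2)⁻¹ = (10 * (ρ₁ * ρ₂) ^ 2)⁻¹ * (1 / 5) := by field_simp; norm_num
    _ ≤ (Real.pi ^ 2 * (ρ₁ * ρ₂) ^ 2)⁻¹ * (((u * v) ^ 2)⁻¹).re := by
        gcongr; linarith

/-- A set that the Bergman kernel sees from a tent under an almost constant argument. -/
theorem exists_companion {z : ℂ} (hz : z ∈ disc) : ∃ (T : Set ℂ) (ρ : ℝ), MeasurableSet T ∧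
    T ⊆ disc ∧ 0 < ρ ∧ (∀ t ∈ T, ∀ s ∈ tent z, ‖1 - t * conj s - ρ‖ ≤ ρ / 10) ∧
    ENNReal.ofReal (ρ ^ 2 / 6400) ≤ volume T ∧ ENNReal.ofReal (ρ ^ 2 / 6400) ≤ volume (tent z) := by
  have hπ := Real.pi_gt_three
  rw [mem_disc] at hz
  have hball : ∀ (U : Set ℂ), U ⊆ disc → ∀ t ∈ Metric.ball (0 : ℂ) (1 / 20), ∀ s ∈ U,
      ‖1 - t * conj s - (1 : ℝ)‖ ≤ 1 / 10 := by
    intro U hU t ht s hs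
    have hs' := mem_disc.mp (hU hs)
    rw [mem_ball_zero_iff] at ht
    rw [Complex.ofReal_one, sub_right_comm, sub_self, zero_sub, norm_neg, norm_mul,
      RCLike.norm_conj]
    nlinarith [norm_nonneg t, norm_nonneg s]
  have hbd : Metric.ball (0 : ℂ) (1 / 20) ⊆ disc := Metric.ball_subset_ball (by norm_num)
  have hvb : ENNReal.ofReal (1 ^ 2 / 6400) ≤ volume (Metric.ball (0 : ℂ) (1 / 20)) := by
    rw [volume_ball_eq _ (by norm_num)]
    exact ENNReal.ofReal_le_ofReal (by nlinarith)
  by_cases h0 : z = 0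
  · refine ⟨Metric.ball 0 (1 / 20), 1, measurableSet_ball, hbd, one_pos,
      hball _ (tent_subset_disc z), hvb, ?_⟩
    rw [h0, tent_zero]
    exact hvb.trans (measure_mono hbd)
  · have hn := norm_pos_iff.mpr h0
    rw [tent_of_ne_zero h0]
    set ζ := z / (‖z‖ : ℂ) with hζ
    set r := 1 - ‖z‖ with hr
    have hζ1 : ‖ζ‖ = 1 := by rw [hζ, norm_div, Complex.norm_real, norm_norm, div_self hn.ne']
    have hr0 : 0 < r := by rw [hr]; linarith
    have hr1 : r ≤ 1 := by rw [hr]; linarith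
    have hlens := le_volume_lens hζ1 hr0 hr1
    have hld : lens ζ r ⊆ disc := by rw [hζ, hr, ← tent_of_ne_zero h0]; exact tent_subset_disc z
    -- For small tents the companion is a disc of radius r at depth ρ = 20r over the same boundary
    -- point; displacements of size r in t and in s cost at most 2r = ρ/10. For large tents a disc
    -- about the origin works with ρ = 1. In terms of ρ the tent area π r²/16 is at least ρ²/6400 in
    -- both cases.
    by_cases hr2 : r ≤ 1 / 20
    · refine ⟨Metric.ball (((1 - 20 * r : ℝ) : ℂ) * ζ) r, 20 * r, measurableSet_ball, ?_,
        by positivity, ?_, ?_, ?_⟩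
      · intro t ht
        rw [Metric.mem_ball, dist_eq_norm] at ht
        rw [mem_disc]
        have h1 := norm_le_norm_add_norm_sub (((1 - 20 * r : ℝ) : ℂ) * ζ) t
        rw [norm_sub_rev, norm_mul, hζ1, Complex.norm_real, Real.norm_of_nonneg (by linarith)] at h1
        linarith
      · intro t ht s hs
        rw [Metric.mem_ball, dist_eq_norm] at ht
        have hs' := (mem_lens.mp hs).1
        have hζζ : ζ * conj ζ = 1 := by
          rw [Complex.mul_conj, Complex.normSq_eq_norm_sq, hζ1]; norm_num
        set x := t - ((1 - 20 * r : ℝ) : ℂ) * ζ with hx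
        set y := s - ζ with hy
        have e : 1 - t * conj s - ((20 * r : ℝ) : ℂ) =
            -(((1 - 20 * r : ℝ) : ℂ) * (ζ * conj y) + x * conj ζ + x * conj y) := by
          have e1 : t = ((1 - 20 * r : ℝ) : ℂ) * ζ + x := by rw [hx]; ring
          have e2 : s = ζ + y := by rw [hy]; ring
          rw [e1, e2, map_add]
          push_cast
          linear_combination (-(1 - 20 * (r : ℂ))) * hζζ
        rw [e, norm_neg]
        refine (norm_add₃_le).trans ?_
        simp only [norm_mul, RCLike.norm_conj, hζ1]
        rw [Complex.norm_real, Real.norm_of_nonneg (by linarith)]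
        nlinarith [norm_nonneg x, norm_nonneg y]
      · rw [volume_ball_eq _ hr0.le]
        exact ENNReal.ofReal_le_ofReal (by nlinarith [pow_pos hr0 2])
      · exact le_trans (ENNReal.ofReal_le_ofReal (by nlinarith [pow_pos hr0 2])) hlens
    · refine ⟨Metric.ball 0 (1 / 20), 1, measurableSet_ball, hbd, one_pos, hball _ hld, hvb, ?_⟩
      exact le_trans (ENNReal.ofReal_le_ofReal (by nlinarith)) hlens

end Lower

section Lower

variable {p q : ℝ} {μ : ℂ × ℂ → ℝ} {μ₁ μ₂ : ℂ → ℝ} {W₁ W₂ : ℂ → ℝ≥0∞}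

/-- The test function is the dual weight V = W^{1-q}, for which V^p W = V. Its integral is not yet
known to be finite, so V is first restricted to the sets where V ≤ n and the limit is taken at the
end. -/
theorem lintegral_dual_rpow_mul_le {X : Type*} [MeasurableSpace X] {m : Measure X}
    [IsFiniteMeasure m] (hpq : p.HolderConjugate q) {W : X → ℝ≥0∞} (hW : Measurable W)
    (h0 : ∀ x, W x ≠ 0) (ht : ∀ x, W x ≠ ∞) {Y M : ℝ≥0∞}
    (H : ∀ φ : X → ℝ≥0, Measurable φ → ∫⁻ x, (φ x : ℝ≥0∞) ^ p * W x ∂m < ∞ →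
      (∫⁻ x, φ x ∂m) * Y ^ (1 / p) ≤ M * (∫⁻ x, (φ x : ℝ≥0∞) ^ p * W x ∂m) ^ (1 / p)) :
    (∫⁻ x, W x ^ (1 - q) ∂m) ^ (p - 1) * Y ≤ M ^ p := by
  have hp0 := hpq.pos
  have hp1 : 0 < p - 1 := sub_pos.mpr hpq.lt
  have hqp := hpq.mul_eq_add
  set V : X → ℝ≥0∞ := fun x => W x ^ (1 - q) with hV
  have hVm : Measurable V := hW.pow_const _
  set F : ℕ → X → ℝ≥0∞ := fun n => {x | V x ≤ n}.indicator V with hF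
  have hFm : ∀ n, Measurable (F n) := fun n =>
    hVm.indicator (measurableSet_le hVm measurable_const)
  have hFle : ∀ n x, F n x ≤ n := by
    intro n x
    by_cases hx : x ∈ {x | V x ≤ n}
    · rw [hF]; simp only; rw [indicator_of_mem hx]; exact hx
    · rw [hF]; simp only; rw [indicator_of_notMem hx]; exact zero_le
  have hFW : ∀ n x, F n x ^ p * W x = F n x := by
    intro n x
    by_cases hx : x ∈ {x | V x ≤ n}
    · simp only [hF]
      rw [indicator_of_mem hx, hV]
      simp only
      rw [← ENNReal.rpow_mul]
      nth_rewrite 2 [← ENNReal.rpow_one (W x)]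
      rw [← ENNReal.rpow_add _ _ (h0 x) (ht x)]
      congr 1; linarith
    · simp only [hF]
      rw [indicator_of_notMem hx, ENNReal.zero_rpow_of_pos hp0, zero_mul]
  have hstep : ∀ n, (∫⁻ x, F n x ∂m) ^ (p - 1) * Y ≤ M ^ p := by
    intro n
    have hc : ∀ x, ((F n x).toNNReal : ℝ≥0∞) = F n x := fun x =>
      ENNReal.coe_toNNReal (ne_top_of_le_ne_top (ENNReal.natCast_ne_top n) (hFle n x))
    have hI : ∫⁻ x, F n x ∂m < ∞ := by
      refine (lintegral_mono (hFle n)).trans_lt ?_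
      rw [lintegral_const]
      exact ENNReal.mul_lt_top (ENNReal.natCast_lt_top n) (measure_lt_top m _)
    have h := H (fun x => (F n x).toNNReal) (hFm n).ennreal_toNNReal
    simp only [hc, hFW] at h
    have h' := h hI
    set I := ∫⁻ x, F n x ∂m with hIdef
    rcases eq_or_ne I 0 with hz | hz
    · rw [hz, ENNReal.zero_rpow_of_pos hp1, zero_mul]; exact zero_le
    have h2 := ENNReal.rpow_le_rpow h' hp0.le
    rw [ENNReal.mul_rpow_of_nonneg _ _ hp0.le, ENNReal.mul_rpow_of_nonneg _ _ hp0.le,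
      ← ENNReal.rpow_mul, ← ENNReal.rpow_mul, one_div_mul_cancel hp0.ne', ENNReal.rpow_one,
      ENNReal.rpow_one] at h2
    have e : I ^ p = I * I ^ (p - 1) := by
      nth_rewrite 2 [← ENNReal.rpow_one I]
      rw [← ENNReal.rpow_add _ _ hz hI.ne]
      congr 1; ring
    rw [e, mul_assoc, mul_comm (M ^ p)] at h2
    exact (ENNReal.mul_le_mul_iff_right hz hI.ne).mp h2
  have hmono : Monotone F := by
    intro n k hnk x
    simp only [hF]
    refine indicator_le_indicator_of_subset (fun y hy => ?_) (fun _ => zero_le) x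
    have hy' : V y ≤ n := hy
    exact hy'.trans (by exact_mod_cast hnk)
  have hsup : ∀ x, ⨆ n, F n x = V x := by
    intro x
    refine le_antisymm (iSup_le fun n => indicator_le_self _ _ x) ?_
    have hVx : V x ≠ ∞ := by
      rw [hV]; simp [ENNReal.rpow_eq_top_iff, h0, ht]
    obtain ⟨n, hn⟩ := ENNReal.exists_nat_gt hVx
    refine le_iSup_of_le n (le_of_eq ?_)
    simp only [hF]
    rw [indicator_of_mem (show x ∈ {x | V x ≤ n} from hn.le)]
  have e1 : ∫⁻ x, V x ∂m = ⨆ n, ∫⁻ x, F n x ∂m := by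
    rw [← lintegral_iSup hFm hmono]
    exact lintegral_congr fun x => (hsup x).symm
  have e2 : (⨆ n, ∫⁻ x, F n x ∂m) ^ (p - 1) = ⨆ n, (∫⁻ x, F n x ∂m) ^ (p - 1) :=
    (ENNReal.orderIsoRpow (p - 1) hp1).map_iSup _
  rw [e1, e2, ENNReal.iSup_mul]
  exact iSup_le hstep

/-- If the kernel is almost constant on `Θ' × Θ`, the weight and its dual are related there. -/
theorem IsLpBound.dual_rpow_mul_le (hpq : p.HolderConjugate q) (hμ : IsProductWeight μ μ₁ μ₂)
    (hW : IsWeightVersion p μ₁ μ₂ W₁ W₂) {N : ℝ≥0∞} (hN : IsLpBound hartogs kernelP p μ N)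
    {Θ Θ' : Set (ℂ × ℂ)} (hΘ : MeasurableSet Θ) (hΘ' : MeasurableSet Θ') {κ : ℝ} (hκ : 0 < κ)
    (hk : ∀ t ∈ Θ', ∀ s ∈ Θ, κ⁻¹ ≤ (bidiscKernel t s).re) :
    (∫⁻ s in Θ, (W₁ s.1 * W₂ s.2) ^ (1 - q) ∂bidisc) ^ (p - 1) *
      ∫⁻ t in Θ', W₁ t.1 * W₂ t.2 ∂bidisc ≤ (N * ENNReal.ofReal κ) ^ p := by
  have hp0 := hpq.pos
  have hum : Measurable fun t : ℂ × ℂ => W₁ t.1 * W₂ t.2 :=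
    (hW.meas₁.comp measurable_fst).mul (hW.meas₂.comp measurable_snd)
  refine lintegral_dual_rpow_mul_le hpq hum (fun t => mul_ne_zero (hW.ne_zero₁ _) (hW.ne_zero₂ _))
    (fun t => ENNReal.mul_ne_top (hW.ne_top₁ _) (hW.ne_top₂ _)) fun φ hφ hfin => ?_
  have h := hN.lintegral_le hpq hμ hW hΘ hΘ' (k := fun _ _ => ENNReal.ofReal κ⁻¹)
    (fun t ht s hs => ⟨(inv_pos.mpr hκ).le.trans (hk t ht s hs),
      ENNReal.ofReal_le_ofReal (hk t ht s hs)⟩) hφ hfin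
  have hκ' : ENNReal.ofReal κ ≠ 0 := by simpa using hκ
  rw [lintegral_const_mul' _ _ ENNReal.ofReal_ne_top, lintegral_const_mul _ hum,
    ENNReal.mul_rpow_of_nonneg _ _ (by positivity : (0 : ℝ) ≤ 1 / p), ← ENNReal.rpow_mul,
    mul_one_div_cancel hp0.ne', ENNReal.rpow_one, ENNReal.ofReal_inv_of_pos hκ] at h
  calc _ = ENNReal.ofReal κ * ((ENNReal.ofReal κ)⁻¹ * (∫⁻ s in Θ, φ s ∂bidisc) *
        (∫⁻ t in Θ', W₁ t.1 * W₂ t.2 ∂bidisc) ^ (1 / p)) := by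
        rw [← mul_assoc, ← mul_assoc, ENNReal.mul_inv_cancel hκ' ENNReal.ofReal_ne_top, one_mul]
    _ ≤ ENNReal.ofReal κ * (N * (∫⁻ s in Θ, (φ s : ℝ≥0∞) ^ p * (W₁ s.1 * W₂ s.2) ∂bidisc) ^ (1 / p)) := by
        gcongr
    _ = _ := by ring

theorem bidisc_restrict_prod {U₁ U₂ : Set ℂ} (h₁ : U₁ ⊆ disc) (h₂ : U₂ ⊆ disc) :
    bidisc.restrict (U₁ ×ˢ U₂) = (volume.restrict U₁).prod (volume.restrict U₂) := by
  rw [bidisc, ← Measure.prod_restrict, Measure.restrict_restrict_of_subset h₁,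
    Measure.restrict_restrict_of_subset h₂]

theorem setLIntegral_bidisc_mul {U₁ U₂ : Set ℂ} (h₁ : U₁ ⊆ disc) (h₂ : U₂ ⊆ disc)
    {f g : ℂ → ℝ≥0∞} (hf : Measurable f) (hg : Measurable g) :
    ∫⁻ s in U₁ ×ˢ U₂, f s.1 * g s.2 ∂bidisc = (∫⁻ s in U₁, f s) * ∫⁻ s in U₂, g s := by
  rw [bidisc_restrict_prod h₁ h₂]
  exact lintegral_prod_mul hf.aemeasurable hg.aemeasurable

/-- Hölder for 1 = W^{1/p} W^{-1/p}: a product of averages of a weight and its dual never falls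
below 1. -/
theorem measure_rpow_le {X : Type*} [MeasurableSpace X] {m : Measure X} (hpq : p.HolderConjugate q)
    {W : X → ℝ≥0∞} (hW : Measurable W) (h0 : ∀ x, W x ≠ 0) (ht : ∀ x, W x ≠ ∞) :
    m univ ^ p ≤ (∫⁻ x, W x ∂m) * (∫⁻ x, W x ^ (1 - q) ∂m) ^ (p - 1) := by
  have hp0 := hpq.pos
  have hqp := hpq.mul_eq_add
  have h := lintegral_le_mul_rpow (m := m) hpq (u := W) (v := fun x => W x ^ (1 - q))
    (hW.pow_const _) (fun x => by simp [ENNReal.rpow_eq_zero_iff, h0, ht])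
    (fun x => by simp [ENNReal.rpow_eq_top_iff, h0, ht])
    (fun x => (rpow_one_sub_rpow_one_sub hpq _).symm) (f := fun _ => 1) measurable_const
  simp only [ENNReal.one_rpow, one_mul, lintegral_const] at h
  have h2 := ENNReal.rpow_le_rpow h hp0.le
  rw [ENNReal.mul_rpow_of_nonneg _ _ hp0.le, ← ENNReal.rpow_mul, ← ENNReal.rpow_mul,
    one_div_mul_cancel hp0.ne', ENNReal.rpow_one] at h2
  have e : 1 / q * p = p - 1 := by
    have := hpq.symm.pos
    field_simp; linarith
  rwa [e] at h2

/-- The testing inequality is used from tent to companion and back. In the product of the two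
results the companion appears with both its weight and dual weight, which Hölder bounds below, so
what remains is the tent alone. The two uses produce the exponent 2p. -/
theorem IsLpBound.hartogsProd_le (hpq : p.HolderConjugate q) (hμ : IsProductWeight μ μ₁ μ₂)
    {N : ℝ≥0∞} (hN : IsLpBound hartogs kernelP p μ N) {z₁ z₂ : ℂ} (hz₁ : z₁ ∈ disc)
    (hz₂ : z₂ ∈ disc) :
    hartogsProd p μ (inducedTent z₁ z₂) ≤ (50 * 6400 ^ 2 * N) ^ (2 * p) := by
  obtain ⟨W₁, W₂, hW⟩ := hμ.exists_isWeightVersion p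
  obtain ⟨T₁, ρ₁, hT₁, hTd₁, hρ₁, hk₁, hv₁, hw₁⟩ := exists_companion hz₁
  obtain ⟨T₂, ρ₂, hT₂, hTd₂, hρ₂, hk₂, hv₂, hw₂⟩ := exists_companion hz₂
  have hp0 := hpq.pos
  set S₁ := tent z₁ with hS₁
  set S₂ := tent z₂ with hS₂
  have hSm : MeasurableSet (S₁ ×ˢ S₂) := (measurableSet_tent z₁).prod (measurableSet_tent z₂)
  have hTm : MeasurableSet (T₁ ×ˢ T₂) := hT₁.prod hT₂
  have hSd₁ : S₁ ⊆ disc := tent_subset_disc z₁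
  have hSd₂ : S₂ ⊆ disc := tent_subset_disc z₂
  set κ : ℝ := 50 * (ρ₁ * ρ₂) ^ 2 with hκ
  have hκ0 : 0 < κ := by positivity
  have hum : Measurable fun t : ℂ × ℂ => W₁ t.1 * W₂ t.2 :=
    (hW.meas₁.comp measurable_fst).mul (hW.meas₂.comp measurable_snd)
  have hsym : ∀ {t s : ℂ} {ρ : ℝ}, ‖1 - t * conj s - ρ‖ = ‖1 - s * conj t - ρ‖ := by
    intro t s ρ
    rw [← RCLike.norm_conj (1 - t * conj s - ρ)]
    simp [mul_comm]
  have a1 := hN.dual_rpow_mul_le hpq hμ hW hSm hTm hκ0 fun t ht s hs =>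
    le_re_bidiscKernel hρ₁ hρ₂ (hk₁ _ ht.1 _ hs.1) (hk₂ _ ht.2 _ hs.2)
  have a2 := hN.dual_rpow_mul_le hpq hμ hW hTm hSm hκ0 fun t ht s hs =>
    le_re_bidiscKernel hρ₁ hρ₂ (hsym.trans_le (hk₁ _ hs.1 _ ht.1))
      (hsym.trans_le (hk₂ _ hs.2 _ ht.2))
  have a3 := measure_rpow_le (m := bidisc.restrict (T₁ ×ˢ T₂)) hpq hum
    (fun t => mul_ne_zero (hW.ne_zero₁ _) (hW.ne_zero₂ _))
    (fun t => ENNReal.mul_ne_top (hW.ne_top₁ _) (hW.ne_top₂ _))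
  have hT : bidisc.restrict (T₁ ×ˢ T₂) univ = volume T₁ * volume T₂ := by
    rw [bidisc_restrict_prod hTd₁ hTd₂, ← univ_prod_univ, Measure.prod_prod,
      Measure.restrict_apply_univ, Measure.restrict_apply_univ]
  rw [hT] at a3
  set X := ∫⁻ t in S₁ ×ˢ S₂, W₁ t.1 * W₂ t.2 ∂bidisc with hX
  set X' := ∫⁻ s in S₁ ×ˢ S₂, (W₁ s.1 * W₂ s.2) ^ (1 - q) ∂bidisc with hX'
  set Y := ∫⁻ t in T₁ ×ˢ T₂, W₁ t.1 * W₂ t.2 ∂bidisc with hY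
  set Y' := ∫⁻ s in T₁ ×ˢ T₂, (W₁ s.1 * W₂ s.2) ^ (1 - q) ∂bidisc with hY'
  have hprod : hartogsProd p μ (inducedTent z₁ z₂) * (volume S₁ * volume S₂) ^ p = X * X' ^ (p - 1) := by
    have e1 : X = (∫⁻ s in S₁, W₁ s) * ∫⁻ s in S₂, W₂ s :=
      setLIntegral_bidisc_mul hSd₁ hSd₂ hW.meas₁ hW.meas₂
    have e2 : X' = (∫⁻ s in S₁, W₁ s ^ (1 - q)) * ∫⁻ s in S₂, W₂ s ^ (1 - q) := by
      rw [hX', ← setLIntegral_bidisc_mul hSd₁ hSd₂ (hW.meas₁.pow_const _) (hW.meas₂.pow_const _)]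
      refine lintegral_congr fun s => ?_
      rw [ENNReal.mul_rpow_of_ne_top (hW.ne_top₁ _) (hW.ne_top₂ _)]
    rw [hartogsProd_inducedTent hpq hμ hW, e1, e2,
      ENNReal.mul_rpow_of_nonneg _ _ (sub_pos.mpr hpq.lt).le, mul_mul_mul_comm,
      weightProd_mul_rpow hpq W₁ (volume_tent_ne_zero hz₁) (volume_tent_ne_top _),
      weightProd_mul_rpow hpq W₂ (volume_tent_ne_zero hz₂) (volume_tent_ne_top _),
      ENNReal.mul_rpow_of_nonneg _ _ hp0.le]
    ring
  -- A common lower bound for the areas of tent and companion. The kernel bound κ equals 50 · 6400²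
  -- β, so all dependence on the size of the tents cancels.
  set β : ℝ≥0∞ := ENNReal.ofReal (ρ₁ ^ 2 / 6400) * ENNReal.ofReal (ρ₂ ^ 2 / 6400) with hβ
  have hβ0 : β ≠ 0 := by
    refine mul_ne_zero ?_ ?_ <;> · rw [Ne, ENNReal.ofReal_eq_zero, not_le]; positivity
  have hβt : β ≠ ∞ := ENNReal.mul_ne_top ENNReal.ofReal_ne_top ENNReal.ofReal_ne_top
  have hκβ : ENNReal.ofReal κ = 50 * 6400 ^ 2 * β := by
    rw [hβ, ← ENNReal.ofReal_mul (by positivity), hκ,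
      show (50 * (ρ₁ * ρ₂) ^ 2 : ℝ) = 50 * 6400 ^ 2 * (ρ₁ ^ 2 / 6400 * (ρ₂ ^ 2 / 6400)) by
        field_simp, ENNReal.ofReal_mul (by norm_num)]
    congr 1
    norm_num
  have hβS : β ≤ volume S₁ * volume S₂ := mul_le_mul' hw₁ hw₂
  have hβT : β ≤ volume T₁ * volume T₂ := mul_le_mul' hv₁ hv₂
  have key : hartogsProd p μ (inducedTent z₁ z₂) * β ^ (2 * p) ≤
      (50 * 6400 ^ 2 * N) ^ (2 * p) * β ^ (2 * p) := by
    have e2p : ∀ x : ℝ≥0∞, x ^ (2 * p) = x ^ p * x ^ p := fun x => by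
      rw [mul_comm 2 p, ENNReal.rpow_mul, ENNReal.rpow_ofNat, sq]
    calc hartogsProd p μ (inducedTent z₁ z₂) * β ^ (2 * p)
        = hartogsProd p μ (inducedTent z₁ z₂) * β ^ p * β ^ p := by rw [e2p, mul_assoc]
      _ ≤ hartogsProd p μ (inducedTent z₁ z₂) * (volume S₁ * volume S₂) ^ p *
            (volume T₁ * volume T₂) ^ p := by gcongr
      _ ≤ X * X' ^ (p - 1) * (Y * Y' ^ (p - 1)) := by rw [hprod]; gcongr
      _ = (X' ^ (p - 1) * Y) * (Y' ^ (p - 1) * X) := by ring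
      _ ≤ (N * ENNReal.ofReal κ) ^ p * (N * ENNReal.ofReal κ) ^ p := mul_le_mul' a1 a2
      _ = (50 * 6400 ^ 2 * N) ^ (2 * p) * β ^ (2 * p) := by
          rw [← e2p, ← ENNReal.mul_rpow_of_nonneg _ _ (by positivity), hκβ]
          congr 1; ring
  have hb0 : β ^ (2 * p) ≠ 0 := by simp [ENNReal.rpow_eq_zero_iff, hβ0, hβt]
  have hbt : β ^ (2 * p) ≠ ∞ := ENNReal.rpow_ne_top_of_nonneg (by positivity) hβt
  exact (ENNReal.mul_le_mul_iff_left hb0 hbt).mp key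

theorem IsLpBound.char_le (hpq : p.HolderConjugate q) (hμ : IsProductWeight μ μ₁ μ₂)
    {N : ℝ≥0∞} (hN : IsLpBound hartogs kernelP p μ N) :
    char p μ ≤ (50 * 6400 ^ 2 * N) ^ (2 * p) :=
  iSup₂_le fun _ h₁ => iSup₂_le fun _ h₂ => hN.hartogsProd_le hpq hμ h₁ h₂

theorem char_rpow_le (hpq : p.HolderConjugate q) (hμ : IsProductWeight μ μ₁ μ₂) :
    char p μ ^ (1 / (2 * p)) ≤ 50 * 6400 ^ 2 * lpOpNorm hartogs kernelP p μ := by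
  have hp0 := hpq.pos
  have hc0 : (50 * 6400 ^ 2 : ℝ≥0∞) ≠ 0 := by norm_num
  have hct : (50 * 6400 ^ 2 : ℝ≥0∞) ≠ ∞ := by
    exact ENNReal.mul_ne_top (by norm_num) (by norm_num)
  rw [mul_comm (50 * 6400 ^ 2 : ℝ≥0∞), ← ENNReal.div_le_iff hc0 hct]
  refine le_sInf fun N hN => ?_
  rw [ENNReal.div_le_iff hc0 hct, mul_comm N]
  have h := ENNReal.rpow_le_rpow (IsLpBound.char_le hpq hμ hN)
    (by positivity : (0 : ℝ) ≤ 1 / (2 * p))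
  rwa [← ENNReal.rpow_mul, mul_one_div_cancel (by positivity), ENNReal.rpow_one] at h

theorem char_lt_top_of_isBoundedOnLp (hpq : p.HolderConjugate q) (hμ : IsProductWeight μ μ₁ μ₂)
    (h : IsBoundedOnLp hartogs kernelP p μ) : char p μ < ∞ := by
  obtain ⟨C, hC⟩ := h
  have hp0 := hpq.pos
  refine (IsLpBound.char_le hpq hμ hC).trans_lt (ENNReal.rpow_lt_top_of_nonneg (by positivity) ?_)
  exact ENNReal.mul_ne_top (ENNReal.mul_ne_top (by norm_num) (by norm_num)) ENNReal.coe_ne_top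

end Lower

/-! ### Power weights with a singularity at a boundary point -/

/-- Polar coordinates: the constant α is the angular measure of the cone, and radial integrals over
a cone reduce to one dimension. -/
theorem lintegral_cone {S : Set ℂ} (hS : MeasurableSet S)
    (hcone : ∀ x : ℝ, 0 < x → ∀ b : ℂ, (x : ℂ) * b ∈ S ↔ b ∈ S) : ∃ α : ℝ≥0∞, α ≠ ∞ ∧
    ∀ h : ℝ → ℝ≥0∞, Measurable h →
      ∫⁻ b in S, h ‖b‖ = α * ∫⁻ x in Ioi (0 : ℝ), ENNReal.ofReal x * h x := by
  have hem : Measurable fun θ : ℝ => circleMap 0 1 θ := (continuous_circleMap 0 1).measurable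
  set A : Set ℝ := {θ | circleMap 0 1 θ ∈ S} with hA
  have hAm : MeasurableSet A := hem hS
  refine ⟨∫⁻ θ in Ioo (-Real.pi) Real.pi, A.indicator 1 θ, ?_, fun h hh => ?_⟩
  · refine ne_of_lt (lt_of_le_of_lt (lintegral_mono (g := fun _ => 1) fun θ => ?_) ?_)
    · exact indicator_le_self' (fun _ _ => zero_le) θ
    · rw [setLIntegral_one]; exact measure_Ioo_lt_top
  · rw [← lintegral_indicator hS, ← Complex.lintegral_comp_polarCoord_symm, polarCoord_target,
      Measure.volume_eq_prod, ← Measure.prod_restrict, mul_comm]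
    have hm : Measurable fun x : ℝ => ENNReal.ofReal x * h x := by fun_prop
    rw [← lintegral_prod_mul hm.aemeasurable (measurable_one.indicator hAm).aemeasurable,
      Measure.prod_restrict]
    refine setLIntegral_congr_fun (measurableSet_Ioi.prod measurableSet_Ioo) fun y hy => ?_
    have hy0 : (0 : ℝ) < y.1 := hy.1
    have e : circleMap 0 y.1 y.2 = (y.1 : ℂ) * circleMap 0 1 y.2 := by simp [circleMap]
    have hn : ‖circleMap 0 y.1 y.2‖ = y.1 := by simp [abs_of_pos hy0]
    simp only [polarCoord_symm_eq_circleMap, smul_eq_mul]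
    by_cases hb : circleMap 0 1 y.2 ∈ S
    · rw [indicator_of_mem (by rw [e]; exact (hcone _ hy0 _).mpr hb), hn,
        indicator_of_mem (show y.2 ∈ A from hb), Pi.one_apply, mul_one]
    · rw [indicator_of_notMem (by rw [e]; exact fun h => hb ((hcone _ hy0 _).mp h)),
        indicator_of_notMem (show y.2 ∉ A from hb), mul_zero, mul_zero]

theorem lintegral_ofReal_mul_rpow {δ X : ℝ} (hδ : 0 < δ) (hX : 0 < X) :
    ∫⁻ x in Ioi (0 : ℝ), ENNReal.ofReal x *
      (Iio X).indicator (fun x => ENNReal.ofReal x ^ (δ - 2)) x = ENNReal.ofReal (X ^ δ / δ) := by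
  have h1 : ∀ x ∈ Ioi (0 : ℝ), ENNReal.ofReal x *
      (Iio X).indicator (fun x => ENNReal.ofReal x ^ (δ - 2)) x =
      (Iio X).indicator (fun x => ENNReal.ofReal (x ^ (δ - 1))) x := by
    intro x hx
    have hx0 : (0 : ℝ) < x := hx
    by_cases hxX : x ∈ Iio X
    · rw [indicator_of_mem hxX, indicator_of_mem hxX, ENNReal.ofReal_rpow_of_pos hx0,
        ← ENNReal.ofReal_mul hx0.le]
      congr 1
      nth_rewrite 1 [← Real.rpow_one x]
      rw [← Real.rpow_add hx0]
      congr 1; ring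
    · rw [indicator_of_notMem hxX, indicator_of_notMem hxX, mul_zero]
  have hint : IntervalIntegrable (fun x : ℝ => x ^ (δ - 1)) volume 0 X :=
    intervalIntegral.intervalIntegrable_rpow' (by linarith)
  rw [setLIntegral_congr_fun measurableSet_Ioi h1, setLIntegral_indicator measurableSet_Iio,
    Iio_inter_Ioi, setLIntegral_congr Ioo_ae_eq_Ioc, ← ofReal_integral_eq_lintegral_ofReal
      ((intervalIntegrable_iff_integrableOn_Ioc_of_le hX.le).mp hint),
    ← intervalIntegral.integral_of_le hX.le, integral_rpow (Or.inl (by linarith))]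
  · congr 1
    rw [sub_add_cancel, Real.zero_rpow hδ.ne', sub_zero]
  · filter_upwards [ae_restrict_mem measurableSet_Ioc] with x hx
    exact Real.rpow_nonneg hx.1.le _

theorem lintegral_ofReal_mul_rpow_neg_two {x₀ R : ℝ} (hx₀ : 0 < x₀) (hR : x₀ ≤ R) :
    ∫⁻ x in Ioi (0 : ℝ), ENNReal.ofReal x *
      (Ioo x₀ R).indicator (fun x => ENNReal.ofReal x ^ (-2 : ℝ)) x =
      ENNReal.ofReal (Real.log (R / x₀)) := by
  have h1 : ∀ x ∈ Ioi (0 : ℝ), ENNReal.ofReal x *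
      (Ioo x₀ R).indicator (fun x => ENNReal.ofReal x ^ (-2 : ℝ)) x =
      (Ioo x₀ R).indicator (fun x => ENNReal.ofReal x⁻¹) x := by
    intro x hx
    have hx0 : (0 : ℝ) < x := hx
    by_cases hxX : x ∈ Ioo x₀ R
    · rw [indicator_of_mem hxX, indicator_of_mem hxX, ENNReal.ofReal_rpow_of_pos hx0,
        ← ENNReal.ofReal_mul hx0.le]
      congr 1
      nth_rewrite 1 [← Real.rpow_one x]
      rw [← Real.rpow_add hx0, ← Real.rpow_neg_one]
      congr 1; norm_num
    · rw [indicator_of_notMem hxX, indicator_of_notMem hxX, mul_zero]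
  have hint : IntervalIntegrable (fun x : ℝ => x⁻¹) volume x₀ R := by
    refine intervalIntegral.intervalIntegrable_inv (fun x hx => ?_) continuousOn_id
    rw [uIcc_of_le hR] at hx
    exact (hx₀.trans_le hx.1).ne'
  have hsub : Ioo x₀ R ∩ Ioi 0 = Ioo x₀ R :=
    inter_eq_self_of_subset_left fun x hx => hx₀.trans hx.1
  rw [setLIntegral_congr_fun measurableSet_Ioi h1, setLIntegral_indicator measurableSet_Ioo,
    hsub, setLIntegral_congr Ioo_ae_eq_Ioc, ← ofReal_integral_eq_lintegral_ofReal
      ((intervalIntegrable_iff_integrableOn_Ioc_of_le hR).mp hint),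
    ← intervalIntegral.integral_of_le hR, integral_inv_of_pos hx₀ (hx₀.trans_le hR)]
  filter_upwards [ae_restrict_mem measurableSet_Ioc] with x hx
  exact (inv_pos.mpr (hx₀.trans hx.1)).le

/-- The weight `|1 - t|^{δ - 2}`. -/
def powerWeight (δ : ℝ) (t : ℂ) : ℝ≥0∞ := if t = 1 then 1 else ‖1 - t‖ₑ ^ (δ - 2)

theorem measurable_powerWeight (δ : ℝ) : Measurable (powerWeight δ) := by
  refine Measurable.ite (measurableSet_singleton 1) measurable_const ?_
  exact ((measurable_const.sub measurable_id).enorm).pow_const _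

theorem powerWeight_of_ne {δ : ℝ} {t : ℂ} (ht : t ≠ 1) : powerWeight δ t = ‖1 - t‖ₑ ^ (δ - 2) :=
  if_neg ht

theorem powerWeight_ne_zero (δ : ℝ) (t : ℂ) : powerWeight δ t ≠ 0 := by
  by_cases ht : t = 1
  · rw [powerWeight, if_pos ht]; exact one_ne_zero
  · rw [powerWeight_of_ne ht]
    have : (1 - t) ≠ 0 := sub_ne_zero.mpr (Ne.symm ht)
    simp [ENNReal.rpow_eq_zero_iff, this]

theorem powerWeight_ne_top (δ : ℝ) (t : ℂ) : powerWeight δ t ≠ ∞ := by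
  by_cases ht : t = 1
  · rw [powerWeight, if_pos ht]; exact ENNReal.one_ne_top
  · rw [powerWeight_of_ne ht]
    have : (1 - t) ≠ 0 := sub_ne_zero.mpr (Ne.symm ht)
    simp [ENNReal.rpow_eq_top_iff, this]

theorem ne_one_of_mem_disc {t : ℂ} (ht : t ∈ disc) : t ≠ 1 := by
  rintro rfl
  rw [mem_disc, norm_one] at ht
  exact lt_irrefl _ ht

theorem setLIntegral_cone {S : Set ℂ} (hS : MeasurableSet S) {α : ℝ≥0∞}
    (hα : ∀ h : ℝ → ℝ≥0∞, Measurable h →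
      ∫⁻ b in S, h ‖b‖ = α * ∫⁻ x in Ioi (0 : ℝ), ENNReal.ofReal x * h x)
    (X : ℝ) {h : ℝ → ℝ≥0∞} (hh : Measurable h) :
    ∫⁻ t in {t | 1 - t ∈ S ∧ ‖1 - t‖ < X}, h ‖1 - t‖ =
      α * ∫⁻ x in Ioi (0 : ℝ), ENNReal.ofReal x * (Iio X).indicator h x := by
  have hm : Measurable fun t : ℂ => 1 - t := measurable_const.sub measurable_id
  have hset : MeasurableSet {t : ℂ | 1 - t ∈ S ∧ ‖1 - t‖ < X} :=
    (hm hS).inter (measurableSet_lt hm.norm measurable_const)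
  rw [← hα _ (hh.indicator measurableSet_Iio), ← lintegral_indicator hS,
    ← lintegral_sub_left_eq_self (μ := (volume : Measure ℂ)) _ (1 : ℂ), ← lintegral_indicator hset]
  refine lintegral_congr fun t => ?_
  by_cases hs : 1 - t ∈ S
  · rw [indicator_of_mem hs]
    by_cases hx : ‖1 - t‖ < X
    · rw [indicator_of_mem (show t ∈ {t : ℂ | 1 - t ∈ S ∧ ‖1 - t‖ < X} from ⟨hs, hx⟩),
        indicator_of_mem (show ‖1 - t‖ ∈ Iio X from hx)]
    · rw [indicator_of_notMem (show t ∉ {t : ℂ | 1 - t ∈ S ∧ ‖1 - t‖ < X} from fun h => hx h.2),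
        indicator_of_notMem (show ‖1 - t‖ ∉ Iio X from hx)]
  · rw [indicator_of_notMem hs,
      indicator_of_notMem (show t ∉ {t : ℂ | 1 - t ∈ S ∧ ‖1 - t‖ < X} from fun h => hs h.1)]

theorem setLIntegral_cone_powerWeight {S : Set ℂ} (hS : MeasurableSet S) {α : ℝ≥0∞}
    (hα : ∀ h : ℝ → ℝ≥0∞, Measurable h →
      ∫⁻ b in S, h ‖b‖ = α * ∫⁻ x in Ioi (0 : ℝ), ENNReal.ofReal x * h x)
    {δ X : ℝ} (hδ : 0 < δ) (hX : 0 < X) :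
    ∫⁻ t in {t | 1 - t ∈ S ∧ ‖1 - t‖ < X}, powerWeight δ t = α * ENNReal.ofReal (X ^ δ / δ) := by
  rw [← lintegral_ofReal_mul_rpow hδ hX,
    ← setLIntegral_cone hS hα X (ENNReal.measurable_ofReal.pow_const (δ - 2))]
  refine lintegral_congr_ae (ae_restrict_of_ae ?_)
  have h1 : ∀ᵐ t : ℂ, t ≠ 1 := by rw [ae_iff]; simp
  filter_upwards [h1] with t ht
  rw [powerWeight_of_ne ht, ofReal_norm]

theorem exists_mem_tent_ball {z : ℂ} (hz : z ∈ disc) : ∃ (x : ℂ) (r : ℝ), 0 < r ∧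
    tent z ⊆ Metric.ball x r ∧ ENNReal.ofReal (r ^ 2 / 16) ≤ volume (tent z) := by
  have hπ := Real.pi_gt_three
  rw [mem_disc] at hz
  by_cases h0 : z = 0
  · refine ⟨0, 1, one_pos, ?_, ?_⟩
    · rw [h0, tent_zero]; exact subset_rfl
    · rw [h0, tent_zero, disc, volume_ball_eq _ zero_le_one]
      exact ENNReal.ofReal_le_ofReal (by linarith)
  · have hn := norm_pos_iff.mpr h0
    have hζ1 : ‖z / (‖z‖ : ℂ)‖ = 1 := by
      rw [norm_div, Complex.norm_real, norm_norm, div_self hn.ne']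
    have hr0 : 0 < 1 - ‖z‖ := by linarith
    refine ⟨z / ‖z‖, 1 - ‖z‖, hr0, ?_, ?_⟩
    · rw [tent_of_ne_zero h0]; exact inter_subset_left
    · rw [tent_of_ne_zero h0]
      refine le_trans (ENNReal.ofReal_le_ofReal ?_) (le_volume_lens hζ1 hr0 (by linarith))
      nlinarith [pow_pos hr0 2]

/-- If y is the largest possible order of |1-t| on the tent, the weight averages to at most a
multiple of δ⁻¹ y^{δ-2} and the dual weight contributes at most y^{2-δ}, so y cancels. The constant
is uniform in p because the dual part uses only a pointwise bound. -/
theorem exists_weightProd_powerWeight_le : ∃ K : ℝ≥0∞, K ≠ ∞ ∧ ∀ {p q : ℝ}, p.HolderConjugate q →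
    ∀ {δ : ℝ}, 0 < δ → δ ≤ 1 → ∀ z ∈ disc,
      weightProd p q (powerWeight δ) (tent z) ≤ K * ENNReal.ofReal δ⁻¹ := by
  obtain ⟨α, hαt, hα⟩ := lintegral_cone MeasurableSet.univ (fun _ _ _ => by simp)
  refine ⟨α * 144 + 9, ENNReal.add_ne_top.mpr ⟨ENNReal.mul_ne_top hαt (by norm_num), by norm_num⟩, ?_⟩
  intro p q hpq δ hδ hδ1 z hz
  have hp0 := hpq.pos
  have hp1 : 0 < p - 1 := sub_pos.mpr hpq.lt
  have hq1 : 0 < q - 1 := sub_pos.mpr hpq.symm.lt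
  have hqp := hpq.mul_eq_add
  set T := tent z with hT
  have hTd : T ⊆ disc := tent_subset_disc z
  have hTm : MeasurableSet T := measurableSet_tent z
  have hv0 := volume_tent_ne_zero hz
  have hvt := volume_tent_ne_top z
  have hVT : ∀ t ∈ T, powerWeight δ t = ‖1 - t‖ₑ ^ (δ - 2) := fun t ht =>
    powerWeight_of_ne (ne_one_of_mem_disc (hTd ht))
  have hδi : (1 : ℝ≥0∞) ≤ ENNReal.ofReal δ⁻¹ := by
    rw [← ENNReal.ofReal_one]
    exact ENNReal.ofReal_le_ofReal ((one_le_inv₀ hδ).mpr hδ1)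
  obtain ⟨y, hy0, hy1, hy2⟩ : ∃ y : ℝ, 0 < y ∧ (∀ t ∈ T, ‖1 - t‖ ≤ y) ∧
      ∫⁻ t in T, powerWeight δ t ≤
        (α * 144 + 9) * ENNReal.ofReal δ⁻¹ * ENNReal.ofReal y ^ (δ - 2) * volume T := by
    obtain ⟨x, r, hr, hsub, hvol⟩ := exists_mem_tent_ball hz
    have hdist : ∀ t ∈ T, ‖t - x‖ < r := fun t ht => by
      have := hsub ht
      rwa [Metric.mem_ball, dist_eq_norm] at this
    -- If the tent comes close to 1, the integral over a full disc of radius 3r about 1 gives the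
    -- loss δ⁻¹; here 144 = 9 · 16. Otherwise |1-t| lies between D/2 and 3D/2 on the tent, and the
    -- weight varies by a factor of at most 3² = 9.
    by_cases hnear : ‖1 - x‖ ≤ 2 * r
    · have hle : ∀ t ∈ T, ‖1 - t‖ < 3 * r := fun t ht => by
        have h1 := hdist t ht
        have h2 : ‖1 - t‖ ≤ ‖1 - x‖ + ‖t - x‖ := by
          rw [show 1 - t = (1 - x) - (t - x) by ring]; exact norm_sub_le _ _
        linarith
      refine ⟨3 * r, by positivity, fun t ht => (hle t ht).le, ?_⟩
      have hr3 : 0 < 3 * r := by positivity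
      have h1 := setLIntegral_cone_powerWeight MeasurableSet.univ hα hδ hr3
      have h2 : ∫⁻ t in T, powerWeight δ t ≤ α * ENNReal.ofReal ((3 * r) ^ δ / δ) := by
        rw [← h1]
        exact lintegral_mono_set fun t ht => ⟨mem_univ _, hle t ht⟩
      have h3 : ENNReal.ofReal ((3 * r) ^ δ / δ) ≤
          144 * ENNReal.ofReal δ⁻¹ * ENNReal.ofReal (3 * r) ^ (δ - 2) * volume T := by
        refine le_trans (le_of_eq ?_) (mul_le_mul_right hvol _)
        rw [ENNReal.ofReal_rpow_of_pos hr3, show (144 : ℝ≥0∞) = ENNReal.ofReal 144 by norm_num,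
          ← ENNReal.ofReal_mul (by norm_num), ← ENNReal.ofReal_mul (by positivity),
          ← ENNReal.ofReal_mul (by positivity)]
        congr 1
        rw [Real.rpow_sub hr3, Real.rpow_ofNat]
        field_simp
        norm_num
      calc ∫⁻ t in T, powerWeight δ t
          ≤ α * (144 * ENNReal.ofReal δ⁻¹ * ENNReal.ofReal (3 * r) ^ (δ - 2) * volume T) :=
            h2.trans (mul_le_mul_right h3 _)
        _ = α * 144 * ENNReal.ofReal δ⁻¹ * ENNReal.ofReal (3 * r) ^ (δ - 2) * volume T := by ring
        _ ≤ _ := by gcongr; exact le_self_add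
    · rw [not_le] at hnear
      set D := ‖1 - x‖ with hD
      have hD0 : 0 < D := by linarith
      refine ⟨3 * D / 2, by positivity, fun t ht => ?_, ?_⟩
      · have h1 := hdist t ht
        have h2 : ‖1 - t‖ ≤ ‖1 - x‖ + ‖t - x‖ := by
          rw [show 1 - t = (1 - x) - (t - x) by ring]; exact norm_sub_le _ _
        linarith
      · have h3 : ∀ t ∈ T, powerWeight δ t ≤ 9 * ENNReal.ofReal (3 * D / 2) ^ (δ - 2) := by
          intro t ht
          have h1 := hdist t ht
          have h2 : ‖1 - x‖ - ‖t - x‖ ≤ ‖1 - t‖ := by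
            rw [show 1 - t = (1 - x) - (t - x) by ring]; exact norm_sub_norm_le _ _
          have h4 : D / 2 ≤ ‖1 - t‖ := by linarith
          have h5 : 0 < ‖1 - t‖ := by linarith
          rw [hVT t ht, ← ofReal_norm, ENNReal.ofReal_rpow_of_pos h5,
            ENNReal.ofReal_rpow_of_pos (by positivity), show (9 : ℝ≥0∞) = ENNReal.ofReal 9 by norm_num,
            ← ENNReal.ofReal_mul (by norm_num)]
          refine ENNReal.ofReal_le_ofReal ?_
          calc ‖1 - t‖ ^ (δ - 2) ≤ (D / 2) ^ (δ - 2) :=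
                Real.rpow_le_rpow_of_nonpos (by positivity) h4 (by linarith)
            _ = (3 : ℝ) ^ (2 - δ) * (3 * D / 2) ^ (δ - 2) := by
                rw [show D / 2 = 3⁻¹ * (3 * D / 2) by ring, Real.mul_rpow (by norm_num) (by positivity),
                  Real.inv_rpow (by norm_num), ← Real.rpow_neg (by norm_num), neg_sub]
            _ ≤ (3 : ℝ) ^ (2 : ℝ) * (3 * D / 2) ^ (δ - 2) := by
                gcongr
                · norm_num
                · linarith
            _ = 9 * (3 * D / 2) ^ (δ - 2) := by norm_num
        calc ∫⁻ t in T, powerWeight δ t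
            ≤ ∫⁻ t in T, 9 * ENNReal.ofReal (3 * D / 2) ^ (δ - 2) := setLIntegral_mono' hTm h3
          _ = 9 * 1 * ENNReal.ofReal (3 * D / 2) ^ (δ - 2) * volume T := by
              rw [setLIntegral_const, mul_one]
          _ ≤ _ := by gcongr; exact le_add_self
  have hdual : (∫⁻ t in T, powerWeight δ t ^ (1 - q)) ^ (p - 1) ≤
      ENNReal.ofReal y ^ (2 - δ) * volume T ^ (p - 1) := by
    have h1 : ∀ t ∈ T, powerWeight δ t ^ (1 - q) ≤ ENNReal.ofReal y ^ ((δ - 2) * (1 - q)) := by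
      intro t ht
      rw [hVT t ht, ← ENNReal.rpow_mul, ← ofReal_norm]
      exact ENNReal.rpow_le_rpow (ENNReal.ofReal_le_ofReal (hy1 t ht)) (by nlinarith)
    have h2 := setLIntegral_mono' (μ := volume) hTm h1
    rw [setLIntegral_const] at h2
    have h3 := ENNReal.rpow_le_rpow h2 hp1.le
    rw [ENNReal.mul_rpow_of_nonneg _ _ hp1.le, ← ENNReal.rpow_mul,
      show (δ - 2) * (1 - q) * (p - 1) = 2 - δ by linear_combination (2 - δ) * hqp] at h3
    exact h3
  have hYy : ENNReal.ofReal y ^ (δ - 2) * ENNReal.ofReal y ^ (2 - δ) = 1 := by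
    rw [← ENNReal.rpow_add _ _ (by simpa using hy0) ENNReal.ofReal_ne_top]
    simp
  have hvp : volume T * volume T ^ (p - 1) = volume T ^ p := by
    nth_rewrite 1 [← ENNReal.rpow_one (volume T)]
    rw [← ENNReal.rpow_add _ _ hv0 hvt]
    congr 1; ring
  have hvp0 : volume T ^ p ≠ 0 := (ENNReal.rpow_pos (pos_iff_ne_zero.mpr hv0) hvt).ne'
  have hvpt : volume T ^ p ≠ ∞ := ENNReal.rpow_ne_top_of_nonneg hp0.le hvt
  refine (ENNReal.mul_le_mul_iff_left hvp0 hvpt).mp ?_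
  rw [← weightProd_mul_rpow hpq _ hv0 hvt]
  refine (mul_le_mul' hy2 hdual).trans (le_of_eq ?_)
  calc _ = (α * 144 + 9) * ENNReal.ofReal δ⁻¹ *
        (ENNReal.ofReal y ^ (δ - 2) * ENNReal.ofReal y ^ (2 - δ)) *
        (volume T * volume T ^ (p - 1)) := by ring
    _ = _ := by rw [hYy, hvp, mul_one]

/-! ### Sharpness -/

/-- A narrow cone around the positive real axis. -/
def narrowCone : Set ℂ := {b | ‖b - (‖b‖ : ℂ)‖ ≤ ‖b‖ / 20 ∧ 0 < ‖b‖}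

/-- The part of the approach region `1 - t ∈ narrowCone` at distance less than `X` from `1`. -/
def approach (X : ℝ) : Set ℂ := {t | 1 - t ∈ narrowCone ∧ ‖1 - t‖ < X}

theorem measurableSet_narrowCone : MeasurableSet narrowCone := by
  have h : Measurable fun b : ℂ => ‖b - (‖b‖ : ℂ)‖ := by
    apply Continuous.measurable; fun_prop
  exact (measurableSet_le h (measurable_norm.div_const 20)).inter
    (measurableSet_lt measurable_const measurable_norm)

theorem measurableSet_approach (X : ℝ) : MeasurableSet (approach X) := by
  have hm : Measurable fun t : ℂ => 1 - t := measurable_const.sub measurable_id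
  exact (hm measurableSet_narrowCone).inter (measurableSet_lt hm.norm measurable_const)

theorem mul_mem_narrowCone {x : ℝ} (hx : 0 < x) (b : ℂ) : (x : ℂ) * b ∈ narrowCone ↔ b ∈ narrowCone := by
  have hn : ‖(x : ℂ) * b‖ = x * ‖b‖ := by
    rw [norm_mul, Complex.norm_real, Real.norm_of_nonneg hx.le]
  have e : (x : ℂ) * b - ((x * ‖b‖ : ℝ) : ℂ) = x * (b - (‖b‖ : ℂ)) := by push_cast; ring
  change ‖(x : ℂ) * b - (‖(x : ℂ) * b‖ : ℂ)‖ ≤ ‖(x : ℂ) * b‖ / 20 ∧ 0 < ‖(x : ℂ) * b‖ ↔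
    ‖b - (‖b‖ : ℂ)‖ ≤ ‖b‖ / 20 ∧ 0 < ‖b‖
  rw [hn, e, norm_mul, Complex.norm_real, Real.norm_of_nonneg hx.le, mul_div_assoc]
  exact and_congr (mul_le_mul_iff_right₀ hx) (mul_pos_iff_of_pos_left hx)

theorem approach_subset_disc {X : ℝ} (hX : X ≤ 1 / 20) : approach X ⊆ disc := by
  rintro t ⟨⟨h1, h2⟩, h3⟩
  rw [mem_disc]
  set b := 1 - t with hb
  have e : t = ((1 - ‖b‖ : ℝ) : ℂ) - (b - (‖b‖ : ℂ)) := by rw [hb]; push_cast; ring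
  rw [e]
  refine (norm_sub_le _ _).trans_lt ?_
  rw [Complex.norm_real, Real.norm_of_nonneg (by linarith)]
  linarith

/-- With a = 1-t and b = 1-s the quantity is a + b̄ - a b̄. Each of a and b deviates from its
modulus by at most a twentieth of it, and the product term is small because both moduli are below
1/20. -/
theorem norm_one_sub_mul_conj_le {t s : ℂ} (ht : t ∈ approach (1 / 20)) (hs : s ∈ approach (1 / 20)) :
    ‖1 - t * conj s - ((‖1 - t‖ + ‖1 - s‖ : ℝ) : ℂ)‖ ≤ (‖1 - t‖ + ‖1 - s‖) / 10 := by
  obtain ⟨⟨a1, a2⟩, a3⟩ := ht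
  obtain ⟨⟨b1, b2⟩, b3⟩ := hs
  set a := 1 - t with ha
  set b := 1 - s with hb
  have e : 1 - t * conj s - ((‖a‖ + ‖b‖ : ℝ) : ℂ) =
      (a - (‖a‖ : ℂ)) + conj (b - (‖b‖ : ℂ)) + -(a * conj b) := by
    have e1 : t = 1 - a := by rw [ha]; ring
    have e2 : s = 1 - b := by rw [hb]; ring
    rw [e1, e2]
    simp only [map_sub, map_one, Complex.conj_ofReal]
    push_cast
    ring
  rw [e]
  refine norm_add₃_le.trans ?_
  rw [RCLike.norm_conj, norm_neg, norm_mul, RCLike.norm_conj]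
  nlinarith [norm_nonneg a, norm_nonneg b]

/-- The angle of the narrow cone. -/
theorem exists_narrowCone_angle : ∃ α : ℝ≥0∞, α ≠ 0 ∧ α ≠ ∞ ∧ ∀ h : ℝ → ℝ≥0∞, Measurable h →
    ∫⁻ b in narrowCone, h ‖b‖ = α * ∫⁻ x in Ioi (0 : ℝ), ENNReal.ofReal x * h x := by
  obtain ⟨α, hαt, hα⟩ := lintegral_cone measurableSet_narrowCone fun x hx b => mul_mem_narrowCone hx b
  refine ⟨α, ?_, hαt, hα⟩
  rintro rfl
  have h := hα (fun _ => 1) measurable_const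
  rw [zero_mul, setLIntegral_one] at h
  have hsub : Metric.ball (1 / 2 : ℂ) (1 / 100) ⊆ narrowCone := by
    intro b hb
    rw [Metric.mem_ball, dist_eq_norm] at hb
    have h12 : ‖(1 / 2 : ℂ)‖ = 1 / 2 := by norm_num
    have h1 := abs_norm_sub_norm_le b (1 / 2)
    rw [h12] at h1
    have h2 := abs_le.mp h1
    have h3 : ‖b - (‖b‖ : ℂ)‖ ≤ ‖b - 1 / 2‖ + |‖b‖ - 1 / 2| := by
      have e : b - (‖b‖ : ℂ) = (b - 1 / 2) - ((‖b‖ - 1 / 2 : ℝ) : ℂ) := by push_cast; ring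
      rw [e]
      refine (norm_sub_le _ _).trans ?_
      rw [Complex.norm_real, Real.norm_eq_abs]
    exact ⟨by linarith, by linarith⟩
  have h0 := measure_mono_null hsub h
  exact (Metric.measure_ball_pos volume (1 / 2 : ℂ) (by norm_num : (0 : ℝ) < 1 / 100)).ne' h0

/-- A lower bound for the modulus of the Bergman kernel in the approach region. -/
def approachKernel (t s : ℂ) : ℝ≥0∞ := (‖1 - t‖ₑ + ‖1 - s‖ₑ) ^ (-2 : ℝ)

theorem measurable_approachKernel : Measurable fun x : ℂ × ℂ => approachKernel x.1 x.2 :=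
  (((measurable_const.sub measurable_fst).enorm).add
    ((measurable_const.sub measurable_snd).enorm)).pow_const _

theorem approachKernel_eq {t : ℂ} (ht : t ∈ approach (1 / 20)) (s : ℂ) :
    approachKernel t s = ENNReal.ofReal ((‖1 - t‖ + ‖1 - s‖) ^ 2)⁻¹ := by
  have h1 : 0 < ‖1 - t‖ := ht.1.2
  have h2 : 0 < ‖1 - t‖ + ‖1 - s‖ := by positivity
  rw [approachKernel, ← ofReal_norm, ← ofReal_norm, ← ENNReal.ofReal_add (norm_nonneg _) (norm_nonneg _),
    ENNReal.ofReal_rpow_of_pos h2, Real.rpow_neg h2.le, Real.rpow_ofNat]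

/-- The two variables carry the same weight, so the test function φ ⊗ φ turns a one-variable gain L
into a gain L² for the norm. This is where the quadratic growth comes from. -/
theorem IsLpBound.le_of_approach {p q : ℝ} (hpq : p.HolderConjugate q) {μ : ℂ × ℂ → ℝ} {μ₁ μ₂ : ℂ → ℝ}
    (hμ : IsProductWeight μ μ₁ μ₂) {W : ℂ → ℝ≥0∞} (hW : IsWeightVersion p μ₁ μ₂ W W)
    {N : ℝ≥0∞} (hN : IsLpBound hartogs kernelP p μ N) {φ : ℂ → ℝ≥0} (hφ : Measurable φ) {L : ℝ≥0∞}
    (h0 : ∫⁻ s in approach (1 / 20), (φ s : ℝ≥0∞) ^ p * W s ≠ 0)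
    (ht : ∫⁻ s in approach (1 / 20), (φ s : ℝ≥0∞) ^ p * W s ≠ ∞)
    (hL : L ^ p * ∫⁻ s in approach (1 / 20), (φ s : ℝ≥0∞) ^ p * W s ≤
      ∫⁻ t in approach (1 / 20), (∫⁻ s in approach (1 / 20), approachKernel t s * φ s) ^ p * W t) :
    ENNReal.ofReal 50⁻¹ * L ^ 2 ≤ N := by
  have hp0 := hpq.pos
  set Γ := approach (1 / 20) with hΓ
  have hΓm : MeasurableSet Γ := measurableSet_approach _
  have hΓd : Γ ⊆ disc := approach_subset_disc le_rfl
  set J := ∫⁻ s in Γ, (φ s : ℝ≥0∞) ^ p * W s with hJ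
  set G : ℂ → ℝ≥0∞ := fun t => ∫⁻ s in Γ, approachKernel t s * φ s with hG
  have hφm : Measurable fun s => (φ s : ℝ≥0∞) := hφ.coe_nnreal_ennreal
  have hGm : Measurable G := by
    have : Measurable fun x : ℂ × ℂ => approachKernel x.1 x.2 * (φ x.2 : ℝ≥0∞) :=
      measurable_approachKernel.mul (hφm.comp measurable_snd)
    exact this.lintegral_prod_right'
  have hkm : ∀ t, Measurable fun s => approachKernel t s * (φ s : ℝ≥0∞) := fun t =>
    ((measurable_const.add ((measurable_const.sub measurable_id).enorm)).pow_const _).mul hφm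
  have hJm : Measurable fun s => (φ s : ℝ≥0∞) ^ p * W s := (hφm.pow_const _).mul hW.meas₁
  have hIm : Measurable fun t => G t ^ p * W t := (hGm.pow_const _).mul hW.meas₁
  have e1 : ∫⁻ s in Γ ×ˢ Γ, ((φ s.1 * φ s.2 : ℝ≥0) : ℝ≥0∞) ^ p * (W s.1 * W s.2) ∂bidisc = J * J := by
    rw [hJ, ← setLIntegral_bidisc_mul hΓd hΓd hJm hJm]
    refine lintegral_congr fun s => ?_
    rw [ENNReal.coe_mul, ENNReal.mul_rpow_of_nonneg _ _ hp0.le]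
    ring
  have h := hN.lintegral_le hpq hμ hW (hΓm.prod hΓm) (hΓm.prod hΓm)
    (k := fun t s => ENNReal.ofReal 50⁻¹ * (approachKernel t.1 s.1 * approachKernel t.2 s.2))
    (fun t ht s hs => by
      have h1 : 0 < ‖1 - t.1‖ + ‖1 - s.1‖ := by have := ht.1.1.2; positivity
      have h2 : 0 < ‖1 - t.2‖ + ‖1 - s.2‖ := by have := ht.2.1.2; positivity
      have h3 := le_re_bidiscKernel h1 h2 (norm_one_sub_mul_conj_le ht.1 hs.1)
        (norm_one_sub_mul_conj_le ht.2 hs.2)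
      refine ⟨le_trans (by positivity) h3, ?_⟩
      rw [approachKernel_eq ht.1, approachKernel_eq ht.2, ← ENNReal.ofReal_mul (by positivity),
        ← ENNReal.ofReal_mul (by positivity)]
      refine ENNReal.ofReal_le_ofReal (le_trans (le_of_eq ?_) h3)
      rw [mul_pow, ← mul_inv, ← mul_inv])
    (φ := fun s => φ s.1 * φ s.2) ((hφ.comp measurable_fst).mul (hφ.comp measurable_snd))
    (by rw [e1]; exact ENNReal.mul_lt_top ht.lt_top ht.lt_top)
  have e2 : ∀ t : ℂ × ℂ, ∫⁻ s in Γ ×ˢ Γ, ENNReal.ofReal 50⁻¹ *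
      (approachKernel t.1 s.1 * approachKernel t.2 s.2) * ((φ s.1 * φ s.2 : ℝ≥0) : ℝ≥0∞) ∂bidisc =
      ENNReal.ofReal 50⁻¹ * (G t.1 * G t.2) := by
    intro t
    rw [hG]
    simp only
    rw [← setLIntegral_bidisc_mul hΓd hΓd (hkm t.1) (hkm t.2), ← lintegral_const_mul' _ _
      ENNReal.ofReal_ne_top]
    refine lintegral_congr fun s => ?_
    rw [ENNReal.coe_mul]
    ring
  have e3 : ∫⁻ t in Γ ×ˢ Γ, (ENNReal.ofReal 50⁻¹ * (G t.1 * G t.2)) ^ p * (W t.1 * W t.2) ∂bidisc =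
      ENNReal.ofReal 50⁻¹ ^ p * ((∫⁻ t in Γ, G t ^ p * W t) * ∫⁻ t in Γ, G t ^ p * W t) := by
    rw [← setLIntegral_bidisc_mul hΓd hΓd hIm hIm, ← lintegral_const_mul' _ _
      (ENNReal.rpow_ne_top_of_nonneg hp0.le ENNReal.ofReal_ne_top)]
    refine lintegral_congr fun t => ?_
    rw [ENNReal.mul_rpow_of_nonneg _ _ hp0.le, ENNReal.mul_rpow_of_nonneg _ _ hp0.le]
    ring
  simp only [e2] at h
  rw [e1, e3] at h
  have hJJ0 : (J * J) ^ (1 / p) ≠ 0 :=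
    (ENNReal.rpow_pos (pos_iff_ne_zero.mpr (mul_ne_zero h0 h0)) (ENNReal.mul_ne_top ht ht)).ne'
  have hJJt : (J * J) ^ (1 / p) ≠ ∞ :=
    ENNReal.rpow_ne_top_of_nonneg (by positivity) (ENNReal.mul_ne_top ht ht)
  refine (ENNReal.mul_le_mul_iff_left hJJ0 hJJt).mp (le_trans ?_ h)
  have e4 : ENNReal.ofReal 50⁻¹ * L ^ 2 * (J * J) ^ (1 / p) =
      (ENNReal.ofReal 50⁻¹ ^ p * ((L ^ p * J) * (L ^ p * J))) ^ (1 / p) := by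
    have : ENNReal.ofReal 50⁻¹ ^ p * ((L ^ p * J) * (L ^ p * J)) =
        (ENNReal.ofReal 50⁻¹ * L ^ 2) ^ p * (J * J) := by
      rw [ENNReal.mul_rpow_of_nonneg _ _ hp0.le, sq, ENNReal.mul_rpow_of_nonneg _ _ hp0.le]
      ring
    rw [this, ENNReal.mul_rpow_of_nonneg ((ENNReal.ofReal 50⁻¹ * L ^ 2) ^ p) (J * J)
      (by positivity : (0 : ℝ) ≤ 1 / p),
      ← ENNReal.rpow_mul, mul_one_div_cancel hp0.ne', ENNReal.rpow_one]
  rw [e4]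
  exact ENNReal.rpow_le_rpow (by gcongr) (by positivity)

theorem approach_mono {X Y : ℝ} (h : X ≤ Y) : approach X ⊆ approach Y :=
  fun _ ht => ⟨ht.1, ht.2.trans_le h⟩

theorem ne_one_of_mem_approach {X : ℝ} {t : ℂ} (ht : t ∈ approach X) : t ≠ 1 := by
  rintro rfl
  have := ht.1.2
  simp at this

theorem le_approachKernel {t s : ℂ} {y : ℝ} (ht : ‖1 - t‖ ≤ y) (hs : ‖1 - s‖ ≤ y) :
    4⁻¹ * ENNReal.ofReal y ^ (-2 : ℝ) ≤ approachKernel t s := by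
  have h1 : ‖1 - t‖ₑ + ‖1 - s‖ₑ ≤ 2 * ENNReal.ofReal y := by
    rw [two_mul, ← ofReal_norm, ← ofReal_norm]
    exact add_le_add (ENNReal.ofReal_le_ofReal ht) (ENNReal.ofReal_le_ofReal hs)
  rw [approachKernel, ENNReal.rpow_neg, ENNReal.rpow_neg,
    ← ENNReal.mul_inv (Or.inl (by norm_num)) (Or.inl (by norm_num)), ENNReal.inv_le_inv]
  refine (ENNReal.rpow_le_rpow h1 zero_le_two).trans (le_of_eq ?_)
  rw [ENNReal.mul_rpow_of_nonneg _ _ zero_le_two, ENNReal.rpow_ofNat 2 2]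
  norm_num

/-- Only points s farther from 1 than t are kept. There the kernel is at least |1-s|⁻²/4, whose
integral over the cone diverges logarithmically. -/
theorem log_le_lintegral_approachKernel {α : ℝ≥0∞} (hα : ∀ h : ℝ → ℝ≥0∞, Measurable h →
      ∫⁻ b in narrowCone, h ‖b‖ = α * ∫⁻ x in Ioi (0 : ℝ), ENNReal.ofReal x * h x)
    {t : ℂ} {R : ℝ} (ht : t ∈ approach R) :
    4⁻¹ * (α * ENNReal.ofReal (Real.log (R / ‖1 - t‖))) ≤
      ∫⁻ s in approach R, approachKernel t s := by
  have hm : Measurable ((Ioo ‖1 - t‖ R).indicator fun x => ENNReal.ofReal x ^ (-2 : ℝ)) :=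
    (ENNReal.measurable_ofReal.pow_const _).indicator measurableSet_Ioo
  have h1 := setLIntegral_cone measurableSet_narrowCone hα R hm
  rw [indicator_indicator, inter_eq_self_of_subset_right Ioo_subset_Iio_self,
    lintegral_ofReal_mul_rpow_neg_two ht.1.2 ht.2.le] at h1
  rw [← h1, ← lintegral_const_mul' _ _ (by norm_num)]
  refine lintegral_mono fun s => ?_
  by_cases hs : ‖1 - s‖ ∈ Ioo ‖1 - t‖ R
  · rw [indicator_of_mem hs]
    exact le_approachKernel hs.1.le le_rfl
  · rw [indicator_of_notMem hs, mul_zero]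
    exact zero_le

/-- Only points s closer to 1 than t are kept. There the kernel is at least |1-t|⁻²/4, and the
weight has mass of order |1-t|^δ/δ: the weight is bounded below by its image with ratio of order
δ⁻¹. -/
theorem powerWeight_le_lintegral_approachKernel {α : ℝ≥0∞} (hα : ∀ h : ℝ → ℝ≥0∞, Measurable h →
      ∫⁻ b in narrowCone, h ‖b‖ = α * ∫⁻ x in Ioi (0 : ℝ), ENNReal.ofReal x * h x)
    {δ : ℝ} (hδ : 0 < δ) {t : ℂ} {R : ℝ} (ht : t ∈ approach R) :
    4⁻¹ * (α * ENNReal.ofReal δ⁻¹) * powerWeight δ t ≤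
      ∫⁻ s in approach R, approachKernel t s * powerWeight δ s := by
  have h0 := ht.1.2
  calc 4⁻¹ * (α * ENNReal.ofReal δ⁻¹) * powerWeight δ t
      = 4⁻¹ * ENNReal.ofReal ‖1 - t‖ ^ (-2 : ℝ) * (α * ENNReal.ofReal (‖1 - t‖ ^ δ / δ)) := by
        rw [powerWeight_of_ne (ne_one_of_mem_approach ht), div_eq_mul_inv,
          ENNReal.ofReal_mul (by positivity), ← ENNReal.ofReal_rpow_of_pos h0, ofReal_norm,
          show δ - 2 = -2 + δ by ring, ENNReal.rpow_add _ _ (by simpa using h0.ne') (by simp)]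
        ring
    _ = ∫⁻ s in approach ‖1 - t‖, 4⁻¹ * ENNReal.ofReal ‖1 - t‖ ^ (-2 : ℝ) * powerWeight δ s := by
        rw [← setLIntegral_cone_powerWeight measurableSet_narrowCone hα hδ h0,
          ← lintegral_const_mul _ (measurable_powerWeight δ)]
        rfl
    _ ≤ ∫⁻ s in approach ‖1 - t‖, approachKernel t s * powerWeight δ s := by
        refine setLIntegral_mono' (measurableSet_approach _) fun s hs => ?_
        gcongr
        exact le_approachKernel le_rfl hs.2.le
    _ ≤ _ := lintegral_mono_set (approach_mono ht.2.le)

theorem lintegral_powerWeight_ne {α : ℝ≥0∞} (hα : ∀ h : ℝ → ℝ≥0∞, Measurable h →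
      ∫⁻ b in narrowCone, h ‖b‖ = α * ∫⁻ x in Ioi (0 : ℝ), ENNReal.ofReal x * h x)
    (h0 : α ≠ 0) (ht : α ≠ ∞) {δ X : ℝ} (hδ : 0 < δ) (hX : 0 < X) :
    ∫⁻ t in approach X, powerWeight δ t ≠ 0 ∧ ∫⁻ t in approach X, powerWeight δ t ≠ ∞ := by
  have h := setLIntegral_cone_powerWeight measurableSet_narrowCone hα hδ hX
  rw [approach, h]
  have : 0 < X ^ δ / δ := by positivity
  exact ⟨mul_ne_zero h0 (by simpa using this), ENNReal.mul_ne_top ht ENNReal.ofReal_ne_top⟩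

section LowerBound

variable {p q : ℝ} {μ : ℂ × ℂ → ℝ} {μ₁ μ₂ : ℂ → ℝ}

/-- The test function is 1. Its image is logarithmically large near the point 1, and the weight
concentrates enough mass there for the logarithm to be of size δ⁻¹ on a fixed proportion. -/
theorem IsLpBound.le_of_powerWeight (hpq : p.HolderConjugate q) (hμ : IsProductWeight μ μ₁ μ₂)
    {α : ℝ≥0∞} (hα : ∀ h : ℝ → ℝ≥0∞, Measurable h →
      ∫⁻ b in narrowCone, h ‖b‖ = α * ∫⁻ x in Ioi (0 : ℝ), ENNReal.ofReal x * h x)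
    (h0 : α ≠ 0) (ht : α ≠ ∞) {δ : ℝ} (hδ : 0 < δ)
    (hW : IsWeightVersion p μ₁ μ₂ (powerWeight δ) (powerWeight δ))
    {N : ℝ≥0∞} (hN : IsLpBound hartogs kernelP p μ N) :
    ENNReal.ofReal 50⁻¹ * (12⁻¹ * (α * ENNReal.ofReal δ⁻¹)) ^ 2 ≤ N := by
  have hp0 := hpq.pos
  have hJ := lintegral_powerWeight_ne hα h0 ht hδ (by norm_num : (0 : ℝ) < 1 / 20)
  -- Below this radius the logarithm is at least δ⁻¹, while X^δ = e⁻¹ (1/20)^δ, so the smaller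
  -- region keeps more than a third of the mass.
  set X : ℝ := 1 / 20 * Real.exp (-δ⁻¹) with hX
  have hX0 : 0 < X := by positivity
  have hX1 : X ≤ 1 / 20 := by
    have : Real.exp (-δ⁻¹) ≤ 1 := Real.exp_le_one_iff.mpr (by simpa using hδ.le)
    linarith
  have hXJ : 3⁻¹ * ∫⁻ t in approach (1 / 20), powerWeight δ t ≤ ∫⁻ t in approach X, powerWeight δ t := by
    rw [approach, approach, setLIntegral_cone_powerWeight measurableSet_narrowCone hα hδ hX0,
      setLIntegral_cone_powerWeight measurableSet_narrowCone hα hδ (by norm_num), mul_left_comm]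
    gcongr
    rw [show (3 : ℝ≥0∞)⁻¹ = ENNReal.ofReal 3⁻¹ by
      rw [ENNReal.ofReal_inv_of_pos (by norm_num)]; norm_num, ← ENNReal.ofReal_mul (by norm_num)]
    refine ENNReal.ofReal_le_ofReal ?_
    rw [hX, Real.mul_rpow (by norm_num) (Real.exp_pos _).le, ← Real.exp_mul, neg_mul,
      inv_mul_cancel₀ hδ.ne', Real.exp_neg, ← mul_div_assoc, mul_comm]
    gcongr
    exact Real.exp_one_lt_three.le
  refine hN.le_of_approach hpq hμ hW (φ := fun _ => 1) measurable_const ?_ ?_ ?_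
  · simpa using hJ.1
  · simpa using hJ.2
  · simp only [ENNReal.coe_one, ENNReal.one_rpow, one_mul, mul_one]
    have hp3 : ((12 : ℝ≥0∞)⁻¹ * (α * ENNReal.ofReal δ⁻¹)) ^ p ≤
        (4⁻¹ * (α * ENNReal.ofReal δ⁻¹)) ^ p * 3⁻¹ := by
      have e : (12 : ℝ≥0∞)⁻¹ = 4⁻¹ * 3⁻¹ := by
        rw [← ENNReal.mul_inv (by simp) (by simp)]; norm_num
      rw [e, mul_right_comm, ENNReal.mul_rpow_of_nonneg _ _ hp0.le]
      gcongr
      exact ENNReal.rpow_le_self_of_le_one (by norm_num) hpq.lt.le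
    calc _ ≤ (4⁻¹ * (α * ENNReal.ofReal δ⁻¹)) ^ p * 3⁻¹ *
          ∫⁻ t in approach (1 / 20), powerWeight δ t := by gcongr
      _ ≤ (4⁻¹ * (α * ENNReal.ofReal δ⁻¹)) ^ p * ∫⁻ t in approach X, powerWeight δ t := by
          rw [mul_assoc]; gcongr
      _ = ∫⁻ t in approach X, (4⁻¹ * (α * ENNReal.ofReal δ⁻¹)) ^ p * powerWeight δ t :=
          (lintegral_const_mul _ (measurable_powerWeight δ)).symm
      _ ≤ ∫⁻ t in approach X, (∫⁻ s in approach (1 / 20), approachKernel t s) ^ p *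
            powerWeight δ t := by
          refine setLIntegral_mono' (measurableSet_approach _) fun t htX => ?_
          gcongr
          refine le_trans ?_ (log_le_lintegral_approachKernel hα (approach_mono hX1 htX))
          gcongr
          have h1 : 0 < ‖1 - t‖ := htX.1.2
          rw [Real.le_log_iff_exp_le (by positivity), le_div_iff₀ h1]
          calc Real.exp δ⁻¹ * ‖1 - t‖ ≤ Real.exp δ⁻¹ * X := by gcongr; exact htX.2.le
            _ = 1 / 20 := by
              rw [hX, mul_left_comm, ← Real.exp_add, add_neg_cancel, Real.exp_zero, mul_one]
      _ ≤ _ := lintegral_mono_set (approach_mono hX1)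

/-- With V the power weight and W = V^{1-p}, the test function is V itself. Then V^p W = V, and the
image exceeds a multiple of δ⁻¹ V pointwise, so no concentration argument is needed. -/
theorem IsLpBound.le_of_powerWeight_rpow (hpq : p.HolderConjugate q) (hμ : IsProductWeight μ μ₁ μ₂)
    {α : ℝ≥0∞} (hα : ∀ h : ℝ → ℝ≥0∞, Measurable h →
      ∫⁻ b in narrowCone, h ‖b‖ = α * ∫⁻ x in Ioi (0 : ℝ), ENNReal.ofReal x * h x)
    (h0 : α ≠ 0) (ht : α ≠ ∞) {δ : ℝ} (hδ : 0 < δ)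
    (hW : IsWeightVersion p μ₁ μ₂ (fun t => powerWeight δ t ^ (1 - p))
      (fun t => powerWeight δ t ^ (1 - p)))
    {N : ℝ≥0∞} (hN : IsLpBound hartogs kernelP p μ N) :
    ENNReal.ofReal 50⁻¹ * (12⁻¹ * (α * ENNReal.ofReal δ⁻¹)) ^ 2 ≤ N := by
  have hp0 := hpq.pos
  have hJ := lintegral_powerWeight_ne hα h0 ht hδ (by norm_num : (0 : ℝ) < 1 / 20)
  have hc : ∀ t, ((powerWeight δ t).toNNReal : ℝ≥0∞) = powerWeight δ t := fun t =>
    ENNReal.coe_toNNReal (powerWeight_ne_top δ t)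
  have hpow : ∀ t, powerWeight δ t ^ p * powerWeight δ t ^ (1 - p) = powerWeight δ t := fun t => by
    rw [← ENNReal.rpow_add _ _ (powerWeight_ne_zero δ t) (powerWeight_ne_top δ t),
      add_sub_cancel, ENNReal.rpow_one]
  have h124 : (12 : ℝ≥0∞)⁻¹ ≤ 4⁻¹ := ENNReal.inv_le_inv.mpr (by norm_num)
  refine hN.le_of_approach hpq hμ hW (φ := fun t => (powerWeight δ t).toNNReal)
    (measurable_powerWeight δ).ennreal_toNNReal ?_ ?_ ?_
  · simp only [hc, hpow]; exact hJ.1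
  · simp only [hc, hpow]; exact hJ.2
  · simp only [hc, hpow]
    rw [← lintegral_const_mul _ (measurable_powerWeight δ)]
    refine setLIntegral_mono' (measurableSet_approach _) fun t htR => ?_
    calc (12⁻¹ * (α * ENNReal.ofReal δ⁻¹)) ^ p * powerWeight δ t
        = (12⁻¹ * (α * ENNReal.ofReal δ⁻¹) * powerWeight δ t) ^ p * powerWeight δ t ^ (1 - p) := by
          rw [ENNReal.mul_rpow_of_nonneg _ (powerWeight δ t) hp0.le, mul_assoc, hpow]
      _ ≤ _ := by
          gcongr
          refine le_trans ?_ (powerWeight_le_lintegral_approachKernel hα hδ htR)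
          gcongr

end LowerBound

/-- The factor |z₂|^{p-2} is chosen so that |t|^{2-p} μ₂ coincides with μ₁, which makes both
variables carry the same one-variable weight. -/
theorem isProductWeight_norm_rpow (p e : ℝ) :
    IsProductWeight (fun z => ‖1 - z.1 / z.2‖ ^ e * (‖z.2‖ ^ (p - 2) * ‖1 - z.2‖ ^ e))
      (fun t => ‖1 - t‖ ^ e) (fun t => ‖t‖ ^ (p - 2) * ‖1 - t‖ ^ e) := by
  have hpos : ∀ t ∈ disc, 0 < ‖1 - t‖ := fun t ht =>
    norm_pos_iff.mpr (sub_ne_zero.mpr (ne_one_of_mem_disc ht).symm)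
  refine ⟨?_, ?_, fun _ _ => rfl, ?_⟩
  · filter_upwards [ae_restrict_mem measurableSet_disc] with t ht
    exact Real.rpow_pos_of_pos (hpos t ht) _
  · filter_upwards [ae_restrict_mem measurableSet_disc, ae_disc_ne_zero] with t ht h0
    exact mul_pos (Real.rpow_pos_of_pos (norm_pos_iff.mpr h0) _) (Real.rpow_pos_of_pos (hpos t ht) _)
  · refine ContinuousOn.locallyIntegrableOn ?_ measurableSet_hartogs
    have hn0 : ∀ z ∈ hartogs, z.2 ≠ 0 := fun z hz => snd_ne_zero_of_mem_hartogs hz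
    have h1 : ContinuousOn (fun z : ℂ × ℂ => ‖1 - z.1 / z.2‖) hartogs :=
      (continuousOn_const.sub (continuousOn_fst.div continuousOn_snd hn0)).norm
    refine (h1.rpow_const fun z hz => Or.inl (hpos _ (fst_div_mem_disc hz).1).ne').mul
      ((continuousOn_snd.norm.rpow_const fun z hz => Or.inl (norm_ne_zero_iff.mpr (hn0 z hz))).mul
        ((continuousOn_const.sub continuousOn_snd).norm.rpow_const fun z hz => Or.inl
          (hpos _ (mem_disc.mpr hz.2)).ne'))

theorem isWeightVersion_powerWeight_rpow (p δ β : ℝ) :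
    IsWeightVersion p (fun t => ‖1 - t‖ ^ ((δ - 2) * β)) (fun t => ‖t‖ ^ (p - 2) * ‖1 - t‖ ^ ((δ - 2) * β))
      (fun t => powerWeight δ t ^ β) (fun t => powerWeight δ t ^ β) := by
  have hm : Measurable fun t => powerWeight δ t ^ β := (measurable_powerWeight δ).pow_const _
  have h0 : ∀ t, powerWeight δ t ^ β ≠ 0 := fun t => by
    simp [ENNReal.rpow_eq_zero_iff, powerWeight_ne_zero, powerWeight_ne_top]
  have ht : ∀ t, powerWeight δ t ^ β ≠ ∞ := fun t => by
    simp [ENNReal.rpow_eq_top_iff, powerWeight_ne_zero, powerWeight_ne_top]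
  have he : ∀ t ∈ disc, 0 < ‖1 - t‖ ∧
      powerWeight δ t ^ β = ENNReal.ofReal (‖1 - t‖ ^ ((δ - 2) * β)) := by
    intro t ht
    have h1 := ne_one_of_mem_disc ht
    have h2 : 0 < ‖1 - t‖ := norm_pos_iff.mpr (sub_ne_zero.mpr h1.symm)
    refine ⟨h2, ?_⟩
    rw [powerWeight_of_ne h1, ← ENNReal.rpow_mul, ← ofReal_norm, ENNReal.ofReal_rpow_of_pos h2]
  refine ⟨hm, hm, h0, h0, ht, ht, ?_, ?_⟩
  · filter_upwards [ae_restrict_mem measurableSet_disc] with t ht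
    exact ⟨Real.rpow_pos_of_pos (he t ht).1 _, (he t ht).2⟩
  · filter_upwards [ae_restrict_mem measurableSet_disc, ae_disc_ne_zero] with t ht h0
    have hn := norm_pos_iff.mpr h0
    refine ⟨mul_pos (Real.rpow_pos_of_pos hn _) (Real.rpow_pos_of_pos (he t ht).1 _), ?_⟩
    rw [(he t ht).2, ← mul_assoc, ← Real.rpow_add hn, show 2 - p + (p - 2) = 0 by ring,
      Real.rpow_zero, one_mul]

theorem weightProd_rpow_one_sub {p q : ℝ} (hpq : p.HolderConjugate q) (W : ℂ → ℝ≥0∞) (U : Set ℂ) :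
    weightProd p q (fun t => W t ^ (1 - p)) U = weightProd q p W U ^ (p - 1) := by
  have hp1 : 0 < p - 1 := sub_pos.mpr hpq.lt
  have hqp := hpq.mul_eq_add
  unfold weightProd
  simp only [rpow_one_sub_rpow_one_sub hpq.symm]
  rw [ENNReal.mul_rpow_of_nonneg _ _ hp1.le, ← ENNReal.rpow_mul,
    show (q - 1) * (p - 1) = 1 by linarith, ENNReal.rpow_one, mul_comm]

/-- The exponent γ is 1 for p ≥ 2 and p - 1 for p ≤ 2, so that the power in the bound restores D
exactly. The whole-disc term needs only γ/p ≤ 1. -/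
theorem upperBound_le_of_tentChar_le {p q : ℝ} (hpq : p.HolderConjugate q) {μ : ℂ × ℂ → ℝ}
    {μ₁ μ₂ : ℂ → ℝ} (hμ : IsProductWeight μ μ₁ μ₂) {W : ℂ → ℝ≥0∞} (hW : IsWeightVersion p μ₁ μ₂ W W)
    {γ : ℝ} (hγp : γ / p ≤ 1) (hγ : γ * max 1 (1 / (p - 1)) = 1) {D : ℝ≥0∞}
    (hD : 1 ≤ D) (h : tentChar p q W ≤ D ^ γ) :
    upperBound p μ μ₁ μ₂ ≤ ((1 + ENNReal.ofReal (p * q)) * D) ^ 2 := by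
  have hp0 := hpq.pos
  have hm : 0 ≤ max 1 (1 / (p - 1)) := zero_le_one.trans (le_max_left _ _)
  have h1 : weightProd p q W disc ^ (1 / p) ≤ D := by
    refine (ENNReal.rpow_le_rpow ((weightProd_disc_le_tentChar p q W).trans h)
      (by positivity)).trans ?_
    rw [← ENNReal.rpow_mul, mul_one_div]
    exact (ENNReal.rpow_le_rpow_of_exponent_le hD hγp).trans_eq (ENNReal.rpow_one D)
  have h2 : smallTentChar p q W ^ max 1 (1 / (p - 1)) ≤ D := by
    refine (ENNReal.rpow_le_rpow ((smallTentChar_le_tentChar p q W).trans h) hm).trans ?_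
    rw [← ENNReal.rpow_mul, hγ, ENNReal.rpow_one]
  rw [upperBound_eq hpq hμ hW, ← sq, add_mul, one_mul]
  gcongr

/-- In one fixed tent at the point 1, the cone contributes mass of order δ⁻¹ to the weight, while a
disc away from 1 keeps the integral of the dual weight bounded below independently of δ. -/
theorem exists_le_weightProd_powerWeight {p q : ℝ} (hpq : p.HolderConjugate q) :
    ∃ c : ℝ≥0∞, c ≠ 0 ∧ ∀ {δ : ℝ}, 0 < δ → δ ≤ 1 → c * ENNReal.ofReal δ⁻¹ ≤
      weightProd p q (powerWeight δ) (tent (3 / 4)) := by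
  have hp0 := hpq.pos
  have hp1 : 0 < p - 1 := sub_pos.mpr hpq.lt
  obtain ⟨α, h0, -, hα⟩ := exists_narrowCone_angle
  have hz : (3 / 4 : ℂ) ∈ disc := by rw [mem_disc]; norm_num
  have hT : tent (3 / 4) = lens 1 (1 / 4) := by
    have := tent_eq_lens (ζ := 1) norm_one (r := 1 / 4) (by norm_num)
    norm_num at this
    exact this
  have hv0 := volume_tent_ne_zero hz
  have hvt := volume_tent_ne_top (3 / 4)
  set T := tent (3 / 4) with hTdef
  set G : Set ℂ := Metric.ball (13 / 16) (1 / 16) with hG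
  have hGd : ∀ t ∈ G, ‖t - 1‖ ≤ 1 / 4 ∧ 1 / 8 ≤ ‖1 - t‖ ∧ t ∈ T := by
    intro t ht
    rw [hG, Metric.mem_ball, dist_eq_norm] at ht
    have h1 : ‖t - 1‖ ≤ ‖t - 13 / 16‖ + ‖(3 / 16 : ℂ)‖ := by
      rw [show t - 1 = (t - 13 / 16) - 3 / 16 by ring]; exact norm_sub_le _ _
    have h2 : ‖(3 / 16 : ℂ)‖ - ‖t - 13 / 16‖ ≤ ‖1 - t‖ := by
      rw [show 1 - t = 3 / 16 - (t - 13 / 16) by ring]; exact norm_sub_norm_le _ _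
    have h3 : ‖t‖ ≤ ‖t - 13 / 16‖ + ‖(13 / 16 : ℂ)‖ := by
      conv_lhs => rw [show t = (t - 13 / 16) + 13 / 16 by ring]
      exact norm_add_le _ _
    have h4 : ‖(3 / 16 : ℂ)‖ = 3 / 16 := by norm_num
    have h5 : ‖(13 / 16 : ℂ)‖ = 13 / 16 := by norm_num
    rw [h4] at h1 h2
    rw [h5] at h3
    refine ⟨by linarith, by linarith, ?_⟩
    rw [hT, mem_lens]
    exact ⟨by linarith, by linarith⟩
  have hG0 : volume G ≠ 0 := (Metric.measure_ball_pos volume _ (by norm_num)).ne'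
  have hGt : volume G ≠ ∞ := measure_ball_lt_top.ne
  have hvp0 : volume T ^ p ≠ 0 := (ENNReal.rpow_pos (pos_iff_ne_zero.mpr hv0) hvt).ne'
  have hvpt : volume T ^ p ≠ ∞ := ENNReal.rpow_ne_top_of_nonneg hp0.le hvt
  refine ⟨α * ENNReal.ofReal (1 / 20) * (volume G / 64 ^ q) ^ (p - 1) / volume T ^ p, ?_, ?_⟩
  · refine ENNReal.div_ne_zero.mpr ⟨mul_ne_zero (mul_ne_zero h0 (by simp)) ?_, hvpt⟩
    have h64 : (64 : ℝ≥0∞) ^ q ≠ ∞ := ENNReal.rpow_ne_top_of_nonneg hpq.symm.pos.le (by norm_num)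
    refine (ENNReal.rpow_pos (ENNReal.div_pos hG0 h64) (ENNReal.div_ne_top hGt ?_)).ne'
    exact (ENNReal.rpow_pos (by norm_num) (by norm_num)).ne'
  · intro δ hδ hδ1
    rw [← ENNReal.mul_div_right_comm]
    refine ENNReal.div_le_of_le_mul ?_
    rw [← weightProd_mul_rpow hpq _ hv0 hvt, mul_right_comm]
    refine mul_le_mul' ?_ (ENNReal.rpow_le_rpow ?_ hp1.le)
    · have hsub : approach (1 / 20) ⊆ T := fun t ht => by
        rw [hT, mem_lens, norm_sub_rev]
        exact ⟨by linarith [ht.2], mem_disc.mp (approach_subset_disc le_rfl ht)⟩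
      refine le_trans ?_ (lintegral_mono_set hsub)
      rw [approach, setLIntegral_cone_powerWeight measurableSet_narrowCone hα hδ (by norm_num),
        mul_assoc, ← ENNReal.ofReal_mul (by norm_num), ← div_eq_mul_inv]
      gcongr
      calc (1 / 20 : ℝ) = (1 / 20) ^ (1 : ℝ) := (Real.rpow_one _).symm
        _ ≤ _ := Real.rpow_le_rpow_of_exponent_ge (by norm_num) (by norm_num) hδ1
    · have hGT : G ⊆ T := fun t ht => (hGd t ht).2.2
      refine le_trans ?_ (lintegral_mono_set hGT)
      rw [div_eq_mul_inv, mul_comm, ← setLIntegral_const]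
      refine setLIntegral_mono' measurableSet_ball fun t ht => ?_
      have h1 := (hGd t ht).2.1
      have h2 : ‖1 - t‖ ≤ 1 := by
        have := (hGd t ht).1
        rw [norm_sub_rev] at this
        linarith
      have h3 : 0 < ‖1 - t‖ := by linarith
      have hq1 : 0 < q - 1 := sub_pos.mpr hpq.symm.lt
      rw [powerWeight_of_ne (ne_one_of_mem_disc (tent_subset_disc _ (hGT ht))), ← ENNReal.rpow_mul,
        ← ENNReal.rpow_neg, ← ofReal_norm, ENNReal.ofReal_rpow_of_pos h3,
        show (64 : ℝ≥0∞) = ENNReal.ofReal 64 by norm_num, ENNReal.ofReal_rpow_of_pos (by norm_num)]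
      refine ENNReal.ofReal_le_ofReal ?_
      calc (64 : ℝ) ^ (-q) = (1 / 8 : ℝ) ^ (2 * q) := by
            rw [show (64 : ℝ) = (1 / 8) ^ (-2 : ℝ) by
              rw [Real.rpow_neg (by norm_num), Real.rpow_ofNat]; norm_num,
              ← Real.rpow_mul (by norm_num)]
            congr 1; ring
        _ ≤ ‖1 - t‖ ^ (2 * q) := Real.rpow_le_rpow (by norm_num) h1 (by linarith)
        _ ≤ ‖1 - t‖ ^ ((δ - 2) * (1 - q)) :=
            Real.rpow_le_rpow_of_exponent_ge h3 h2 (by nlinarith)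

theorem le_smallTentChar (p q : ℝ) (W : ℂ → ℝ≥0∞) :
    weightProd p q W (tent (3 / 4)) ≤ smallTentChar p q W := by
  have hn : ‖(3 / 4 : ℂ)‖ = 3 / 4 := by norm_num
  exact le_iSup₂_of_le (f := fun z (_ : z ∈ disc) => ⨆ _ : 1 / 2 < ‖z‖, weightProd p q W (tent z))
    (3 / 4) (by rw [mem_disc, hn]; norm_num) (le_iSup_of_le (by rw [hn]; norm_num) le_rfl)

theorem exists_sharp_of_family {p q : ℝ} (hpq : p.HolderConjugate q) {β γ : ℝ} (hγ0 : 0 < γ)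
    (hγp : γ / p ≤ 1) (hγ : γ * max 1 (1 / (p - 1)) = 1) {K c a : ℝ≥0∞} (hK : 1 ≤ K) (hKt : K ≠ ∞)
    (hc : c ≠ 0) (ha : a ≠ 0) (hat : a ≠ ∞)
    (hup : ∀ {δ : ℝ}, 0 < δ → δ ≤ 1 →
      tentChar p q (fun t => powerWeight δ t ^ β) ≤ (K * ENNReal.ofReal δ⁻¹) ^ γ)
    (hlo : ∀ {δ : ℝ}, 0 < δ → δ ≤ 1 →
      (c * ENNReal.ofReal δ⁻¹) ^ γ ≤ smallTentChar p q fun t => powerWeight δ t ^ β)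
    (hop : ∀ {δ : ℝ}, 0 < δ → ∀ {μ : ℂ × ℂ → ℝ} {μ₁ μ₂ : ℂ → ℝ}, IsProductWeight μ μ₁ μ₂ →
      IsWeightVersion p μ₁ μ₂ (fun t => powerWeight δ t ^ β) (fun t => powerWeight δ t ^ β) →
      ∀ {N : ℝ≥0∞}, IsLpBound hartogs kernelP p μ N → (a * ENNReal.ofReal δ⁻¹) ^ 2 ≤ N) :
    ∃ c : ℝ≥0, 0 < c ∧ ∀ M : ℝ≥0, ∃ (μ : ℂ × ℂ → ℝ) (μ₁ μ₂ : ℂ → ℝ),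
      IsProductWeight μ μ₁ μ₂ ∧ M ≤ char11 p μ ∧ upperBound p μ μ₁ μ₂ < ∞ ∧
        c * upperBound p μ μ₁ μ₂ ≤ lpOpNorm hartogs kernelP p μ := by
  set B : ℝ≥0∞ := (1 + ENNReal.ofReal (p * q)) * K with hB
  have hB1 : 1 ≤ B := le_trans hK (le_mul_of_one_le_left zero_le le_self_add)
  have hB0 : B ≠ 0 := (zero_lt_one.trans_le hB1).ne'
  have hBt : B ≠ ∞ := ENNReal.mul_ne_top (by simp) hKt
  have haBt : (a / B) ^ 2 ≠ ∞ := ENNReal.pow_ne_top (ENNReal.div_ne_top hat hB0)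
  have haB0 : (a / B) ^ 2 ≠ 0 := pow_ne_zero _ (ENNReal.div_ne_zero.mpr ⟨ha, hBt⟩)
  refine ⟨((a / B) ^ 2).toNNReal, ENNReal.toNNReal_pos haB0 haBt, fun M => ?_⟩
  -- The parameter δ = 1/(n+1) is taken so small that each of the two equal factors of the
  -- small-tent constant exceeds both M and 1; their product then exceeds M.
  obtain ⟨n, hn⟩ := ENNReal.exists_nat_mul_gt (b := (max (M : ℝ≥0∞) 1) ^ (1 / γ)) hc
    (ENNReal.rpow_ne_top_of_nonneg (by positivity) (by simp))
  have hδ0 : (0 : ℝ) < 1 / (n + 1) := by positivity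
  have hδ1 : (1 : ℝ) / (n + 1) ≤ 1 := by
    rw [div_le_one (by positivity)]; linarith [(Nat.cast_nonneg n : (0 : ℝ) ≤ n)]
  set δ : ℝ := 1 / (n + 1) with hδ
  have hδi : ENNReal.ofReal δ⁻¹ = n + 1 := by
    rw [hδ, one_div, inv_inv, ENNReal.ofReal_add (by positivity) zero_le_one]; simp
  have hμ := isProductWeight_norm_rpow p ((δ - 2) * β)
  have hW := isWeightVersion_powerWeight_rpow p δ β
  have hU := upperBound_le_of_tentChar_le hpq hμ hW hγp hγ
    (le_trans hK (le_mul_of_one_le_right zero_le (by rw [hδi]; exact le_add_self))) (hup hδ0 hδ1)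
  rw [← mul_assoc, ← hB] at hU
  refine ⟨_, _, _, hμ, ?_, ?_, ?_⟩
  · rw [char11_eq hpq hμ hW]
    have h1 : max (M : ℝ≥0∞) 1 ≤ smallTentChar p q fun t => powerWeight δ t ^ β := by
      refine le_trans ?_ (hlo hδ0 hδ1)
      calc max (M : ℝ≥0∞) 1 = (max (M : ℝ≥0∞) 1 ^ (1 / γ)) ^ γ := by
            rw [← ENNReal.rpow_mul, one_div_mul_cancel hγ0.ne', ENNReal.rpow_one]
        _ ≤ (c * ENNReal.ofReal δ⁻¹) ^ γ := by
            refine ENNReal.rpow_le_rpow (hn.le.trans ?_) hγ0.le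
            rw [mul_comm, hδi]
            gcongr
            exact le_self_add
    calc (M : ℝ≥0∞) ≤ max (M : ℝ≥0∞) 1 * 1 := by rw [mul_one]; exact le_max_left _ _
      _ ≤ _ := mul_le_mul' h1 ((le_max_right _ _).trans h1)
  · exact hU.trans_lt (ENNReal.pow_lt_top (ENNReal.mul_lt_top hBt.lt_top ENNReal.ofReal_lt_top))
  · refine le_sInf fun N hN => le_trans ?_ (hop hδ0 hμ hW hN)
    rw [ENNReal.coe_toNNReal haBt]
    refine (mul_le_mul_right hU _).trans (le_of_eq ?_)
    rw [← mul_pow, ← mul_assoc, ENNReal.div_mul_cancel hB0 hBt]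

theorem exists_sharp {p q : ℝ} (hpq : p.HolderConjugate q) :
    ∃ c : ℝ≥0, 0 < c ∧ ∀ M : ℝ≥0, ∃ (μ : ℂ × ℂ → ℝ) (μ₁ μ₂ : ℂ → ℝ),
      IsProductWeight μ μ₁ μ₂ ∧ M ≤ char11 p μ ∧ upperBound p μ μ₁ μ₂ < ∞ ∧
        c * upperBound p μ μ₁ μ₂ ≤ lpOpNorm hartogs kernelP p μ := by
  have hp0 := hpq.pos
  have hp1 : 0 < p - 1 := sub_pos.mpr hpq.lt
  obtain ⟨α, h0, ht, hα⟩ := exists_narrowCone_angle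
  obtain ⟨K, hKt, hK⟩ := exists_weightProd_powerWeight_le
  have hK' : ∀ {p q : ℝ}, p.HolderConjugate q → ∀ {δ : ℝ}, 0 < δ → δ ≤ 1 → ∀ z ∈ disc,
      weightProd p q (powerWeight δ) (tent z) ≤ (1 + K) * ENNReal.ofReal δ⁻¹ :=
    fun hpq _ h h1 z hz => (hK hpq h h1 z hz).trans (mul_le_mul_left le_add_self _)
  -- A factor whose square 1/64 stays below the kernel constant 1/50.
  set a : ℝ≥0∞ := ENNReal.ofReal (1 / 8) * (12⁻¹ * α) with ha
  have ha0 : a ≠ 0 := mul_ne_zero (by simp) (mul_ne_zero (by simp) h0)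
  have hat : a ≠ ∞ := ENNReal.mul_ne_top ENNReal.ofReal_ne_top (ENNReal.mul_ne_top (by simp) ht)
  have hsq : ∀ x : ℝ≥0∞, (a * x) ^ 2 ≤ ENNReal.ofReal 50⁻¹ * (12⁻¹ * (α * x)) ^ 2 := fun x => by
    rw [ha, mul_assoc, mul_assoc, mul_pow, ← ENNReal.ofReal_pow (by norm_num)]
    gcongr
    norm_num
  rcases le_total 2 p with h2 | h2
  · obtain ⟨c, hc, hcl⟩ := exists_le_weightProd_powerWeight hpq
    have hmax : max 1 (1 / (p - 1)) = 1 := max_eq_left (by rw [div_le_one hp1]; linarith)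
    refine exists_sharp_of_family (β := 1) (γ := 1) (K := 1 + K) (c := c) (a := a) hpq one_pos
      (by rw [div_le_one hp0]; linarith) (by rw [hmax, one_mul]) le_self_add (by simp [hKt]) hc ha0 hat
      ?_ ?_ ?_
    · intro δ hδ hδ1
      simp only [ENNReal.rpow_one]
      exact iSup₂_le (hK' hpq hδ hδ1)
    · intro δ hδ hδ1
      simp only [ENNReal.rpow_one]
      exact (hcl hδ hδ1).trans (le_smallTentChar p q _)
    · intro δ hδ μ μ₁ μ₂ hμ hW N hN
      simp only [ENNReal.rpow_one] at hW
      exact (hsq _).trans (hN.le_of_powerWeight hpq hμ hα h0 ht hδ hW)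
  · obtain ⟨c, hc, hcl⟩ := exists_le_weightProd_powerWeight hpq.symm
    have hmax : max 1 (1 / (p - 1)) = 1 / (p - 1) := max_eq_right (by
      rw [le_div_iff₀ hp1]; linarith)
    refine exists_sharp_of_family (β := 1 - p) (γ := p - 1) (K := 1 + K) (c := c) (a := a) hpq hp1
      (by rw [div_le_one hp0]; linarith) (by rw [hmax, mul_one_div_cancel hp1.ne']) le_self_add
      (by simp [hKt]) hc ha0 hat ?_ ?_ ?_
    · intro δ hδ hδ1
      refine iSup₂_le fun z hz => ?_
      rw [weightProd_rpow_one_sub hpq]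
      exact ENNReal.rpow_le_rpow (hK' hpq.symm hδ hδ1 z hz) hp1.le
    · intro δ hδ hδ1
      refine le_trans ?_ (le_smallTentChar p q _)
      rw [weightProd_rpow_one_sub hpq]
      exact ENNReal.rpow_le_rpow (hcl hδ hδ1) hp1.le
    · intro δ hδ μ μ₁ μ₂ hμ hW N hN
      exact (hsq _).trans (hN.le_of_powerWeight_rpow hpq hμ hα h0 ht hδ hW)

end HartogsBergman

end

theorem theorem1p2 :
    (∃ C : ℝ≥0, ∀ p : ℝ, 1 < p → ∀ (μ : ℂ × ℂ → ℝ) (μ₁ μ₂ : ℂ → ℝ),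
      HartogsBergman.IsProductWeight μ μ₁ μ₂ →
        (HartogsBergman.IsBoundedOnLp HartogsBergman.hartogs HartogsBergman.kernelP p μ ↔
          HartogsBergman.char p μ < ∞) ∧
        HartogsBergman.char p μ ^ (1 / (2 * p)) ≤
          C * HartogsBergman.lpOpNorm HartogsBergman.hartogs HartogsBergman.kernelP p μ ∧
        HartogsBergman.lpOpNorm HartogsBergman.hartogs HartogsBergman.kernelP p μ ≤
          HartogsBergman.lpOpNorm HartogsBergman.hartogs HartogsBergman.kernelPplus p μ ∧
        HartogsBergman.lpOpNorm HartogsBergman.hartogs HartogsBergman.kernelPplus p μ ≤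
          C * HartogsBergman.upperBound p μ μ₁ μ₂) ∧
    (∀ p : ℝ, 1 < p → ∃ c : ℝ≥0, 0 < c ∧ ∀ M : ℝ≥0, ∃ (μ : ℂ × ℂ → ℝ) (μ₁ μ₂ : ℂ → ℝ),
      HartogsBergman.IsProductWeight μ μ₁ μ₂ ∧
        M ≤ HartogsBergman.char11 p μ ∧
        HartogsBergman.upperBound p μ μ₁ μ₂ < ∞ ∧
        c * HartogsBergman.upperBound p μ μ₁ μ₂ ≤
          HartogsBergman.lpOpNorm HartogsBergman.hartogs HartogsBergman.kernelP p μ) := by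
  -- One constant serves both estimates: the lower bound needs only 50 · 6400².
  refine ⟨⟨10 ^ 14, fun p hp μ μ₁ μ₂ hμ => ?_⟩, fun p hp =>
    HartogsBergman.exists_sharp (Real.HolderConjugate.conjExponent hp)⟩
  have hpq := Real.HolderConjugate.conjExponent hp
  refine ⟨⟨HartogsBergman.char_lt_top_of_isBoundedOnLp hpq hμ,
    HartogsBergman.isBoundedOnLp_of_char_lt_top hpq hμ⟩, ?_,
    HartogsBergman.lpOpNorm_kernelP_le hμ, ?_⟩
  · refine (HartogsBergman.char_rpow_le hpq hμ).trans ?_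
    gcongr
    push_cast
    norm_num
  · have h := HartogsBergman.lpOpNorm_kernelPplus_le hpq hμ
    exact_mod_cast h
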